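/- **Theorem 4.3 (2-classification).** Let $K$ be an imaginary quadratic field with ring of integers $\mathbb Z_K$, odd class number and unit group $U_K=\{\pm1\}$ or $U_K=\langle\mu_6\rangle$, and let $c$ be the nontrivial automorphism of $K$. An idele class character of a number field $F$ is a continuous homomorphism from the idele group $I_F$ to the unit circle that is trivial on $F^\times$; it is quadratic if it has order exactly $2$. A character of the form $\nu\circ N_{K/\mathbb Q}$, with $\nu$ an idele class character of $\mathbb Q$, is said to arise from base change. We write $\chi^c(x)=\chi(c(x))$, and $\chi_v$ for the local component of $\chi$ at a finite place $v$. The conductor of $\chi$ is $\mathfrak f_\chi=\prod_v v^{n(\chi_v)}$, where $n(\chi_v)=0$ if $\chi_v$ is trivial on the units of $K_v$, and otherwise $n(\chi_v)$ is the least $n\ge1$ such that $\chi_v$ is trivial on $1+\mathcal M_v^n$, with $\mathcal M_v$ the maximal ideal of the ring of integers of $K_v$. For each prime $p$ that splits in $K$ choose one place of $K$ above $p$, and let $S_K$ be the set of these chosen places. If $2$ ramifies in $K$, fix a uniformizer $\pi_v$ of $K_v$ for $v\mid 2$; if $2$ is inert, fix a primitive cube root of unity $\mu_3\in K_v$ for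 $v\mid2$. For an idele class character $\chi$ of $K$ and an ideal $\mathfrak f=\prod_v v^{m(v)}$ (with $\mathfrak f=\mathfrak f_\chi$ whenever values of $\chi$ are mentioned) consider the conditions: * (A) No place above an odd inert prime divides $\mathfrak f$. * (B) At most one place $v$ above a ramified prime $\equiv 3 \bmod 4$ divides $\mathfrak f$, and then $m(v)=1$. * (C) If a place $v$ above a split prime $p$ divides $\mathfrak f$, then $v\in S_K$, and $m(v)=1$ if $p$ is odd, $m(v)\in\{2,3\}$ if $p=2$. * (D) If a place $v$ above $2$ divides $\mathfrak f$ and $2$ does not split in $K$, then: if $2$ ramifies, $m(v)\in\{4,5\}$ and $\chi_v(1+\pi_v)=1$; if $2$ is inert, $m(v)=2$, $\chi_v(-1)=-1$ and $\chi_v(1+2\mu_3)=1$. Then: (I) For every quadratic idele class character $\chi$ of $K$ there is an idele class character $\mu$ of $K$ arising from base change, with $\mu^2=1$, such that $\chi\mu$ satisfies (A)–(D). (II) A quadratic idele class character $\chi$ of $K$ with $\mathfrak f_\chi\neq\mathbb Z_K$ that satisfies (A)–(D) does not arise from base change; moreover $\chi^c=\chi\cdot\delta$ for some quadratic idele class character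 $\delta$ of $K$. (III) If $\chi\ne\eta$ are quadratic idele class characters of $K$ satisfying (A)–(D), then $\chi\eta^{-1}$ does not arise from base change. (IV) Let $\mathfrak f=\prod_v v^{m(v)}\ne\mathbb Z_K$ be a nonzero integral ideal of $K$ whose exponents satisfy (A)–(D) (in (D), only the conditions on $m(v)$), and let $r(\mathfrak f)$ be the number of places $v\mid\mathfrak f$ above primes $p\equiv3\bmod4$. Then there is a quadratic idele class character $\chi$ of $K$ with conductor $\mathfrak f$ satisfying (A)–(D) if and only if both of the following hold: if no $v\mid\mathfrak f$ is above $2$, then $r(\mathfrak f)$ is even; and if some $v\mid\mathfrak f$ above $2$ has $m(v)=2$ or $4$, then $r(\mathfrak f)$ is odd. -/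

import Mathlib

open NumberField IsDedekindDomain

noncomputable section

namespace IdeleClass

/-! ### Functoriality of the adele ring

For a homomorphism `f : K → L` of number fields and a place `w` of `L`, let `v` be the place of
`K` below `w`.  Then `f` extends by continuity to `f_w : K_v → L_w`, and these maps together give
a ring homomorphism `𝔸_K → 𝔸_L`, namely `(x_v)_v ↦ (f_w (x_{v(w)}))_w`. -/

section Functoriality

variable {K L : Type*} [Field K] [NumberField K] [Field L] [NumberField L]

/-- The finite place of `K` below the finite place `w` of `L`, along `f : K → L`. -/
def placeBelow (f : K →+* L) (w : HeightOneSpectrum (𝓞 L)) : HeightOneSpectrum (𝓞 K) where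
  asIdeal := w.asIdeal.comap (RingOfIntegers.mapRingHom f)
  isPrime := w.isPrime.comap _
  ne_bot := by
    let _ := f.toAlgebra
    exact Ideal.comap_ne_bot_of_integral_mem (R := 𝓞 K) (S := 𝓞 L)
      (Submodule.exists_mem_ne_zero_of_ne_bot w.ne_bot).choose_spec.2
      (Submodule.exists_mem_ne_zero_of_ne_bot w.ne_bot).choose_spec.1
      (Algebra.IsIntegral.isIntegral _)

theorem continuous_withValMap (f : K →+* L) (w : HeightOneSpectrum (𝓞 L)) :
    Continuous (WithVal.map ((placeBelow f w).valuation K) (w.valuation L) f) := by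
  let _ := f.toAlgebra
  have : w.asIdeal.LiesOver (placeBelow f w).asIdeal := ⟨rfl⟩
  exact (HeightOneSpectrum.uniformContinuous_algebraMap_liesOver K L
    (placeBelow f w) w).continuous

/-- The extension by continuity `K_v → L_w` of `f : K → L`, where `v` is the place below `w`. -/
def finiteLocalMap (f : K →+* L) (w : HeightOneSpectrum (𝓞 L)) :
    (placeBelow f w).adicCompletion K →+* w.adicCompletion L :=
  ((HeightOneSpectrum.adicCompletion.equiv L w).symm.toRingHom.comp
    (UniformSpace.Completion.mapRingHom
      (WithVal.map ((placeBelow f w).valuation K) (w.valuation L) f)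
      (continuous_withValMap f w))).comp
    (HeightOneSpectrum.adicCompletion.equiv K (placeBelow f w)).toRingHom

theorem finiteLocalMap_coe (f : K →+* L) (w : HeightOneSpectrum (𝓞 L)) (x : K) :
    finiteLocalMap f w (x : (placeBelow f w).adicCompletion K) = (f x : w.adicCompletion L) := by
  apply HeightOneSpectrum.adicCompletion.ext
  exact UniformSpace.Completion.mapRingHom_coe (continuous_withValMap f w) _

theorem finiteLocalMap_mapsTo (f : K →+* L) (w : HeightOneSpectrum (𝓞 L)) :
    Set.MapsTo (finiteLocalMap f w) ((placeBelow f w).adicCompletionIntegers K)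
      (w.adicCompletionIntegers L) := by
  have hcont : Continuous (finiteLocalMap f w) :=
    (HeightOneSpectrum.adicCompletion.continuous_ofCompletion L w).comp
      (UniformSpace.Completion.continuous_map.comp
        (HeightOneSpectrum.adicCompletion.continuous_toCompletion K (placeBelow f w)))
  have hopen : IsOpen (((placeBelow f w).adicCompletionIntegers K :
      Set ((placeBelow f w).adicCompletion K))) := Valued.isOpen_valuationSubring _
  have hclosed : IsClosed ((w.adicCompletionIntegers L : Set (w.adicCompletion L))) :=
    Valued.isClosed_valuationSubring _
  intro x
  refine isClosed_property (HeightOneSpectrum.denseRange_algebraMap K (placeBelow f w))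
    (p := fun x ↦ x ∈ (placeBelow f w).adicCompletionIntegers K →
      finiteLocalMap f w x ∈ w.adicCompletionIntegers L) ?_ ?_ x
  · have := hopen.isClosed_compl.union (hclosed.preimage hcont)
    convert this using 1
    ext y
    simp [imp_iff_not_or]
  · intro k hk
    let _ := f.toAlgebra
    have : w.asIdeal.LiesOver (placeBelow f w).asIdeal := ⟨rfl⟩
    have h1 := HeightOneSpectrum.valuation_liesOver L (placeBelow f w) w k
    have h2 : (placeBelow f w).valuation K k ≤ 1 := by
      have h3 := (HeightOneSpectrum.mem_adicCompletionIntegers (𝓞 K) K (placeBelow f w)).1 hk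
      rwa [← HeightOneSpectrum.valuedAdicCompletion_eq_valuation' (placeBelow f w) k]
    have h4 : finiteLocalMap f w (algebraMap K _ k) = (f k : w.adicCompletion L) :=
      finiteLocalMap_coe f w k
    rw [h4, HeightOneSpectrum.mem_adicCompletionIntegers,
      HeightOneSpectrum.valuedAdicCompletion_eq_valuation']
    calc w.valuation L (f k) = _ := h1.symm
      _ ≤ 1 := pow_le_one₀ zero_le h2

theorem tendsto_placeBelow (f : K →+* L) :
    Filter.Tendsto (placeBelow f) Filter.cofinite Filter.cofinite := by
  refine Filter.Tendsto.cofinite_of_finite_preimage_singleton fun v ↦ ?_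
  let _ := f.toAlgebra
  have := v.isMaximal
  refine Set.Finite.of_finite_image
    ((IsDedekindDomain.primesOver_finite v.asIdeal (𝓞 L)).subset ?_)
    (f := HeightOneSpectrum.asIdeal) (fun a _ b _ h ↦ HeightOneSpectrum.ext h)
  rintro _ ⟨w, hw, rfl⟩
  exact ⟨w.isPrime, ⟨(congrArg HeightOneSpectrum.asIdeal hw).symm⟩⟩

/-- The map of finite adele rings induced by `f : K → L`. -/
def finiteAdeleMap (f : K →+* L) : FiniteAdeleRing (𝓞 K) K →+* FiniteAdeleRing (𝓞 L) L :=
  RestrictedProduct.mapAlongRingHom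
    (fun v : HeightOneSpectrum (𝓞 K) ↦ v.adicCompletion K)
    (fun w : HeightOneSpectrum (𝓞 L) ↦ w.adicCompletion L)
    (placeBelow f) (tendsto_placeBelow f) (finiteLocalMap f)
    (Filter.Eventually.of_forall (finiteLocalMap_mapsTo f))

/-- The extension by continuity `K_v → L_w` of `f : K → L` at an infinite place `w` of `L`, where
`v` is the place below `w`. -/
def infiniteLocalMap (f : K →+* L) (w : InfinitePlace L) :
    (w.comap f).Completion →+* w.Completion :=
  letI := f.toAlgebra
  haveI : w.LiesOver (w.comap f) := ⟨rfl⟩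
  LiesOver.completionMap

/-- The map of infinite adele rings induced by `f : K → L`. -/
def infiniteAdeleMap (f : K →+* L) : InfiniteAdeleRing K →+* InfiniteAdeleRing L :=
  RingHom.pi fun w ↦ (infiniteLocalMap f w).comp
    (Pi.evalRingHom (fun v : InfinitePlace K ↦ v.Completion) (w.comap f))

/-- The map of adele rings induced by `f : K → L`. -/
def adeleMap (f : K →+* L) : AdeleRing (𝓞 K) K →+* AdeleRing (𝓞 L) L :=
  RingHom.prodMap (infiniteAdeleMap f) (finiteAdeleMap f)

end Functoriality

/-! ### Ideles, the norm, and idele class characters -/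

/-- The idele group of `K`, with its usual topology as the unit group of the adele ring. -/
abbrev IdeleGroup (K : Type*) [Field K] [NumberField K] : Type _ := (AdeleRing (𝓞 K) K)ˣ

section Ideles

variable (K : Type*) [Field K] [NumberField K]

/-- The diagonal embedding `Kˣ → I_K`. -/
def principalIdele : Kˣ →* IdeleGroup K := Units.map (algebraMap K (AdeleRing (𝓞 K) K))

/-- The norm `N_{K/ℚ} : I_K → I_ℚ`: the norm of the adele ring `𝔸_K`, as a free module of rank
`[K : ℚ]` over `𝔸_ℚ`, restricted to units.  Here `𝔸_K` is an algebra over `𝔸_ℚ` through the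
canonical map. -/
def ideleNorm : IdeleGroup K →* IdeleGroup ℚ :=
  letI := (adeleMap (algebraMap ℚ K)).toAlgebra
  Units.map (Algebra.norm (AdeleRing (𝓞 ℚ) ℚ) (S := AdeleRing (𝓞 K) K))

/-- An automorphism of `K` acting on the ideles of `K`. -/
def ideleConj {K : Type*} [Field K] [NumberField K] (c : K ≃ₐ[ℚ] K) :
    IdeleGroup K →* IdeleGroup K :=
  Units.map (adeleMap (c : K →+* K) : AdeleRing (𝓞 K) K →* AdeleRing (𝓞 K) K)

open scoped Classical in
/-- The embedding `K_vˣ → I_K` at a finite place `v` (with component `1` at all other places). -/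
def localIdele {K : Type*} [Field K] [NumberField K] (v : HeightOneSpectrum (𝓞 K)) :
    (v.adicCompletion K)ˣ →* IdeleGroup K :=
  Units.map
    { toFun := fun x ↦ ((1 : InfiniteAdeleRing K),
        (RestrictedProduct.mulSingle (fun w : HeightOneSpectrum (𝓞 K) ↦
          w.adicCompletionIntegers K) v x : FiniteAdeleRing (𝓞 K) K))
      map_one' := Prod.ext rfl (RestrictedProduct.mulSingle_one _ _)
      map_mul' := fun x y ↦ Prod.ext (one_mul _).symm (RestrictedProduct.mulSingle_mul _ _ x y) }

/-- The group of idele class characters of `K`: continuous homomorphisms from the idele group to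
the unit circle which are trivial on `Kˣ`. -/
def IdeleClassChar : Subgroup (IdeleGroup K →ₜ* Circle) where
  carrier := {χ | ∀ a : Kˣ, χ (principalIdele K a) = 1}
  one_mem' _ := rfl
  mul_mem' {χ η} hχ hη a := by
    change χ _ * η _ = 1
    rw [hχ a, hη a, one_mul]
  inv_mem' {χ} hχ a := by
    change (χ _)⁻¹ = 1
    rw [hχ a, inv_one]

end Ideles

section Characters

variable {K : Type*} [Field K] [NumberField K]

/-- `χ` is a quadratic character, i.e. of order exactly `2`. -/
def IsQuadratic (χ : IdeleClassChar K) : Prop := orderOf χ = 2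

/-- `μ` arises from base change: `μ = ν ∘ N_{K/ℚ}` for an idele class character `ν` of `ℚ`. -/
def IsBaseChange (μ : IdeleClassChar K) : Prop :=
  ∃ ν : IdeleClassChar ℚ, ∀ x : IdeleGroup K, μ.1 x = ν.1 (ideleNorm K x)

/-- The local component `χ_v : K_vˣ → S¹` at a finite place `v`. -/
def localComponent (χ : IdeleClassChar K) (v : HeightOneSpectrum (𝓞 K)) :
    (v.adicCompletion K)ˣ →* Circle :=
  (χ.1 : IdeleGroup K →* Circle).comp (localIdele v)

/-- `χ_v(x) = z`, for a nonzero `x ∈ K_v`. -/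
def LocalValueEq (χ : IdeleClassChar K) (v : HeightOneSpectrum (𝓞 K))
    (x : v.adicCompletion K) (z : Circle) : Prop :=
  ∃ u : (v.adicCompletion K)ˣ, (u : v.adicCompletion K) = x ∧ localComponent χ v u = z

/-- The exponent of the conductor of `χ_v`: the least `n` such that `χ_v` is trivial on the units
of `O_v` congruent to `1` modulo `M_v ^ n`.  It is `0` exactly when `χ_v` is unramified. -/
def conductorExponent (χ : IdeleClassChar K) (v : HeightOneSpectrum (𝓞 K)) : ℕ :=
  sInf {n : ℕ | ∀ u : (v.adicCompletion K)ˣ, Valued.v (u : v.adicCompletion K) = 1 →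
    Valued.v ((u : v.adicCompletion K) - 1) ≤ WithZero.exp (-(n : ℤ)) →
      localComponent χ v u = 1}

/-- The conductor of `χ`, an ideal of `𝓞 K` (all but finitely many factors are trivial). -/
def conductor (χ : IdeleClassChar K) : Ideal (𝓞 K) :=
  ∏ᶠ v : HeightOneSpectrum (𝓞 K), v.asIdeal ^ conductorExponent χ v

end Characters

/-! ### Decomposition of primes in a quadratic field -/

section Primes

variable {K : Type*} [Field K] [NumberField K]

/-- The finite place `v` of `K` is above the rational prime `p`. -/
def IsAbove (v : HeightOneSpectrum (𝓞 K)) (p : ℕ) : Prop := (p : 𝓞 K) ∈ v.asIdeal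

variable (K)

/-- The prime `p` is inert in `K`. -/
def IsInert (p : ℕ) : Prop := (Ideal.span {(p : 𝓞 K)}).IsPrime

/-- The prime `p` ramifies in `K`. -/
def Ramifies (p : ℕ) : Prop :=
  ∃ v : HeightOneSpectrum (𝓞 K), v.asIdeal ^ 2 ∣ Ideal.span {(p : 𝓞 K)}

/-- The prime `p` splits in the quadratic field `K`: it is the product of two distinct primes. -/
def Splits (p : ℕ) : Prop :=
  ∃ v w : HeightOneSpectrum (𝓞 K), v ≠ w ∧ Ideal.span {(p : 𝓞 K)} = v.asIdeal * w.asIdeal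

variable {K}

/-- `S` consists of exactly one place above `p` for each rational prime `p` split in `K`. -/
structure IsChoiceAboveSplit (S : Set (HeightOneSpectrum (𝓞 K))) : Prop where
  above_split : ∀ v ∈ S, ∃ p : ℕ, p.Prime ∧ Splits K p ∧ IsAbove v p
  existsUnique : ∀ p : ℕ, p.Prime → Splits K p → ∃! v, v ∈ S ∧ IsAbove v p

/-- The number of places `v` dividing `𝔣` which are above a prime `p ≡ 3 mod 4`. -/
def numPlacesThreeModFour (𝔣 : Ideal (𝓞 K)) : ℕ :=
  {v : HeightOneSpectrum (𝓞 K) |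
    v.asIdeal ∣ 𝔣 ∧ ∃ p : ℕ, p.Prime ∧ p % 4 = 3 ∧ IsAbove v p}.ncard

end Primes

/-! ### The local conditions -/

section Conditions

variable {K : Type*} [Field K] [NumberField K]

/-- The conditions (A)-(D) on the exponents `m(v)` of an ideal `𝔣 = ∏ v ^ m(v)`. -/
structure IdealConditions (S : Set (HeightOneSpectrum (𝓞 K))) (𝔣 : Ideal (𝓞 K)) : Prop where
  /-- (A): no place above an odd inert prime divides `𝔣`. -/
  inert : ∀ (p : ℕ) (v : HeightOneSpectrum (𝓞 K)), p.Prime → p ≠ 2 → IsInert K p →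
    IsAbove v p → ¬ v.asIdeal ∣ 𝔣
  /-- (B), first half: at most one place above a ramified prime `≡ 3 mod 4` divides `𝔣`. -/
  ramified_unique : ∀ (p q : ℕ) (v w : HeightOneSpectrum (𝓞 K)),
    p.Prime → p % 4 = 3 → Ramifies K p → IsAbove v p → v.asIdeal ∣ 𝔣 →
    q.Prime → q % 4 = 3 → Ramifies K q → IsAbove w q → w.asIdeal ∣ 𝔣 → v = w
  /-- (B), second half: such a place divides `𝔣` exactly once. -/
  ramified_exponent : ∀ (p : ℕ) (v : HeightOneSpectrum (𝓞 K)),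
    p.Prime → p % 4 = 3 → Ramifies K p → IsAbove v p → v.asIdeal ∣ 𝔣 →
      emultiplicity v.asIdeal 𝔣 = 1
  /-- (C): places above split primes. -/
  split : ∀ (p : ℕ) (v : HeightOneSpectrum (𝓞 K)), p.Prime → Splits K p → IsAbove v p →
    v.asIdeal ∣ 𝔣 → v ∈ S ∧
      (p ≠ 2 → emultiplicity v.asIdeal 𝔣 = 1) ∧
      (p = 2 → emultiplicity v.asIdeal 𝔣 = 2 ∨ emultiplicity v.asIdeal 𝔣 = 3)
  /-- (D), exponent at a place above `2`, if `2` ramifies. -/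
  two_ramified : ∀ v : HeightOneSpectrum (𝓞 K), Ramifies K 2 → IsAbove v 2 → v.asIdeal ∣ 𝔣 →
    emultiplicity v.asIdeal 𝔣 = 4 ∨ emultiplicity v.asIdeal 𝔣 = 5
  /-- (D), exponent at a place above `2`, if `2` is inert. -/
  two_inert : ∀ v : HeightOneSpectrum (𝓞 K), IsInert K 2 → IsAbove v 2 → v.asIdeal ∣ 𝔣 →
    emultiplicity v.asIdeal 𝔣 = 2

/-- The conditions (A)-(D) on an idele class character `χ`, where `π v` is a uniformizer and
`ζ v` a primitive cube root of unity in `K_v` (used only for `v` above `2`). -/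
structure CharConditions (S : Set (HeightOneSpectrum (𝓞 K)))
    (π ζ : ∀ v : HeightOneSpectrum (𝓞 K), v.adicCompletion K) (χ : IdeleClassChar K) :
    Prop where
  /-- (A)-(D) for the exponents of the conductor. -/
  ideal : IdealConditions S (conductor χ)
  /-- (D), values of `χ_v` if `2` ramifies. -/
  value_ramified : ∀ v : HeightOneSpectrum (𝓞 K), Ramifies K 2 → IsAbove v 2 →
    v.asIdeal ∣ conductor χ → LocalValueEq χ v (1 + π v) 1
  /-- (D), values of `χ_v` if `2` is inert. -/
  value_inert : ∀ v : HeightOneSpectrum (𝓞 K), IsInert K 2 → IsAbove v 2 →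
    v.asIdeal ∣ conductor χ → LocalValueEq χ v (-1) (-1) ∧ LocalValueEq χ v (1 + 2 * ζ v) 1

end Conditions

end IdeleClass

end

open IdeleClass

open NumberField IsDedekindDomain

noncomputable section

namespace IdeleClass

/-! ### Characters of exponent two -/

/-! The hypotheses force K = ℚ(√-q) with q = 2 or q a prime ≡ 3 mod 4, and q is the only ramified
prime (`exists_isQuadraticData`).

Everything else rests on a local-to-global principle for characters χ with χ² = 1. If the class
number h is odd, x^h is a principal idele times an idele that is a unit at all finite places, and
χ(x) = χ(x)^h. So χ is determined by its archimedean part and by its restrictions χ_v to the local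
units (`eq_one_of_unitComponent`). Conversely, a family of local characters, almost all trivial,
extends as soon as its product is 1 on the global units (`exists_ideleClassChar`). For K the
archimedean part is trivial because ℂˣ consists of squares, and since u³ = ±1 for every unit u, the
only condition left is ∏ χ_v(-1) = 1. For ℚ the sign character at infinity absorbs -1, so there is
no condition at all.

For χ² = 1, the conditions (A)-(D) amount to conditions `LocalGood` on the χ_v that are stable under
products. The centre of the proof is a rigidity statement, `eq_one_of_conj_invariant`: if such a χ
is moreover invariant under c, it is trivial. Invariance kills χ_v at split places and at an inert
2; then only the place above q remains, the product formula gives χ_v(-1) = 1 there, and a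
computation with the units at that place finishes. A base change factors through the norm, hence is
invariant under c, which gives (II) and, applied to χη, (III).

For (I), each rational prime p has a quadratic character of ℤ_pˣ whose composition with the local
norm corrects χ above p (`exists_isCorrection`). These glue over ℚ without obstruction and are then
composed with the norm. The formula N(x) = x · c(x) on ideles is obtained from the fact that 𝔸_ℚ is
the fixed ring of c in 𝔸_K.

For (IV), the parity conditions express ∏ χ_v(-1) = 1. At an odd place allowed by (A)-(C), a
ramified χ_v has χ_v(-1) = -1 exactly if p ≡ 3 mod 4. Above 2, the exponents 2 and 4 force the value
-1, while 3 and 5 leave it free. -/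

theorem Circle.sq_eq_one_iff {z : Circle} : z ^ 2 = 1 ↔ z = 1 ∨ z = -1 := by
  rw [Circle.ext_iff, Circle.ext_iff, Circle.ext_iff]
  simp

theorem Circle.neg_one_ne_one : (-1 : Circle) ≠ 1 := by
  intro h
  rw [Circle.ext_iff] at h
  norm_num at h

/-- The isomorphism from `ℤ/2` to `{±1}`. -/
def zmodTwoCircle : Multiplicative (ZMod 2) →* Circle where
  toFun x := if x.toAdd = 0 then 1 else -1
  map_one' := by simp
  map_mul' := by
    intro x y
    have hx : x.toAdd = 0 ∨ x.toAdd = 1 := by generalize x.toAdd = a; revert a; decide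
    have hy : y.toAdd = 0 ∨ y.toAdd = 1 := by generalize y.toAdd = a; revert a; decide
    have h2 : (1 : ZMod 2) + 1 = 0 := by decide
    rcases hx with hx | hx <;> rcases hy with hy | hy <;> simp [hx, hy, toAdd_mul, h2]

/-- Characters with values `±1` separate a point from a subgroup which contains all squares. -/
theorem exists_char_of_notMem {G : Type*} [CommGroup G] (H : Subgroup G) (hH : ∀ g : G, g ^ 2 ∈ H)
    {g : G} (hg : g ∉ H) :
    ∃ ρ : G →* Circle, (∀ x, ρ x ^ 2 = 1) ∧ (∀ x ∈ H, ρ x = 1) ∧ ρ g = -1 := by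
  -- G/H has exponent 2, so it is an 𝔽₂-vector space, and a linear functional is nonzero at the
  -- class of g.
  let V := Additive (G ⧸ H)
  have h2 : ∀ x : V, 2 • x = 0 := by
    intro x
    obtain ⟨y, hy⟩ := QuotientGroup.mk_surjective (Additive.toMul x)
    apply Additive.toMul.injective
    rw [toMul_nsmul, ← hy, ← QuotientGroup.mk_pow, toMul_zero]
    exact (QuotientGroup.eq_one_iff _).2 (hH y)
  let _ : Module (ZMod 2) V := AddCommGroup.zmodModule h2
  let q : V := Additive.ofMul (QuotientGroup.mk g)
  have hq : q ≠ 0 := by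
    intro h
    apply hg
    rw [← QuotientGroup.eq_one_iff]
    exact congrArg Additive.toMul h
  obtain ⟨f, hf⟩ : ∃ f : Module.Dual (ZMod 2) V, f q ≠ 0 := by
    by_contra! h
    exact hq ((Module.forall_dual_apply_eq_zero_iff (ZMod 2) q).1 h)
  let φ : G ⧸ H →* Multiplicative (ZMod 2) := AddMonoidHom.toMultiplicativeRight f.toAddMonoidHom
  refine ⟨zmodTwoCircle.comp (φ.comp (QuotientGroup.mk' H)), fun x ↦ ?_, fun x hx ↦ ?_, ?_⟩
  · rw [← map_pow, MonoidHom.comp_apply, MonoidHom.comp_apply,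
      show QuotientGroup.mk' H (x ^ 2) = 1 from (QuotientGroup.eq_one_iff _).2 (hH x),
      map_one, map_one]
  · rw [MonoidHom.comp_apply, MonoidHom.comp_apply,
      show QuotientGroup.mk' H x = 1 from (QuotientGroup.eq_one_iff _).2 hx, map_one, map_one]
  · exact if_neg hf

/-! ### Characters of the units of a local ring -/

section LocalRing

variable {R : Type*} [CommRing R] {A : Type*} [CommGroup A]

/-- The homomorphism `ρ` is trivial on the units congruent to `1` modulo `a`. -/
def TrivialMod (ρ : Rˣ →* A) (a : R) : Prop := ∀ u : Rˣ, a ∣ (u : R) - 1 → ρ u = 1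

theorem TrivialMod.of_dvd {ρ : Rˣ →* A} {a b : R} (h : TrivialMod ρ a) (hab : a ∣ b) :
    TrivialMod ρ b := fun u hu ↦ h u (hab.trans hu)

theorem TrivialMod.map_eq {ρ : Rˣ →* A} {a : R} (h : TrivialMod ρ a) {u w : Rˣ}
    (huw : a ∣ (u : R) - w) : ρ u = ρ w := by
  have h1 : ρ (u * w⁻¹) = 1 := by
    apply h
    have : ((u * w⁻¹ : Rˣ) : R) - 1 = (u - w) * (w⁻¹ : Rˣ) := by
      rw [sub_mul, Units.mul_inv, Units.val_mul]
    rw [this]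
    exact huw.mul_right _
  rwa [map_mul, map_inv, mul_inv_eq_one] at h1

theorem TrivialMod.mul {ρ ψ : Rˣ →* A} {a : R} (h : TrivialMod ρ a) (h' : TrivialMod ψ a) :
    TrivialMod (ρ * ψ) a := fun u hu ↦ by rw [MonoidHom.mul_apply, h u hu, h' u hu, one_mul]

theorem isUnit_one_add_mul [IsLocalRing R] {ϖ : R} (hϖ : ¬ IsUnit ϖ) (z : R) :
    IsUnit (1 + ϖ * z) := by
  have h : -(ϖ * z) ∈ nonunits R := by
    intro h
    exact hϖ (isUnit_of_mul_isUnit_left ((IsUnit.neg_iff _).1 h))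
  simpa using IsLocalRing.isUnit_one_sub_self_of_mem_nonunits _ h

theorem exists_unit_eq_one_add_mul [IsLocalRing R] {ϖ : R} (hϖ : ¬ IsUnit ϖ) (z : R) :
    ∃ u : Rˣ, (u : R) = 1 + ϖ * z := isUnit_one_add_mul hϖ z

/-- A character with values `±1` of finite level is trivial modulo `4 ϖ`. -/
theorem TrivialMod.four_mul [IsLocalRing R] {ϖ : R} (hϖ : ¬ IsUnit ϖ) {ρ : Rˣ →* A}
    (h2 : ∀ u, ρ u ^ 2 = 1) {N : ℕ} (h : TrivialMod ρ (ϖ ^ N)) : TrivialMod ρ (4 * ϖ) := by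
  have key : ∀ k, TrivialMod ρ (4 * ϖ ^ (k + 2)) → TrivialMod ρ (4 * ϖ ^ (k + 1)) := by
    rintro k hk u ⟨z, hz⟩
    -- Here u = 1 + 4ϖ^(k+1)z and y = 1 + 2ϖ^(k+1)z, so u - y² = -4ϖ^(2k+2)z², and 2k + 2 ≥ k + 2:
    -- modulo 4ϖ^(k+2) the unit u is a square.
    obtain ⟨y, hy⟩ := exists_unit_eq_one_add_mul hϖ (2 * ϖ ^ k * z)
    rw [hk.map_eq (u := u) (w := y ^ 2), map_pow, h2]
    refine ⟨- ϖ ^ k * z ^ 2, ?_⟩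
    rw [Units.val_pow_eq_pow_val, hy]
    linear_combination hz
  have main : ∀ n k, TrivialMod ρ (4 * ϖ ^ (k + n + 1)) → TrivialMod ρ (4 * ϖ ^ (k + 1)) := by
    intro n
    induction n with
    | zero => exact fun k h ↦ h
    | succ n ih =>
      intro k h
      exact ih k (key (k + n) h)
  have := main N 0 (h.of_dvd ⟨4 * ϖ, by ring⟩)
  simpa using this

/-- When 2 is a unit, the bound 4ϖ of `TrivialMod.four_mul` is ϖ up to a unit: in odd residue
characteristic quadratic characters are tame. -/
theorem TrivialMod.of_isUnit_two [IsLocalRing R] {ϖ : R} (hϖ : ¬ IsUnit ϖ) (hu : IsUnit (2 : R))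
    {ρ : Rˣ →* A} (h2 : ∀ u, ρ u ^ 2 = 1) {N : ℕ} (h : TrivialMod ρ (ϖ ^ N)) :
    TrivialMod ρ ϖ := by
  refine (h.four_mul hϖ h2).of_dvd ?_
  have h4 : IsUnit (4 : R) := by
    have := hu.mul hu
    norm_num at this
    exact this
  exact (h4.mul_left_dvd).2 dvd_rfl

/-- With residue field 𝔽₂ every unit is 1 modulo ϖ, so conductor exponent 1 cannot occur. -/
theorem TrivialMod.eq_one_of_residue {ϖ : R} (hϖ : ¬ IsUnit ϖ) (hres : ∀ r : R, ϖ ∣ r ∨ ϖ ∣ r - 1)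
    {ρ : Rˣ →* A} (h : TrivialMod ρ ϖ) (u : Rˣ) : ρ u = 1 :=
  h u ((hres u).resolve_left fun hu ↦ hϖ (isUnit_of_dvd_unit hu u.isUnit))

/-- Existence of a character of given level with prescribed values. -/
theorem exists_char_trivialMod (a : R) (p q g : Rˣ)
    (h : ∀ y : Rˣ, ¬ a ∣ (g : R) - y ^ 2 ∧ ¬ a ∣ (g : R) - y ^ 2 * p ∧ ¬ a ∣ (g : R) - y ^ 2 * q ∧
      ¬ a ∣ (g : R) - y ^ 2 * (p * q)) :
    ∃ ρ : Rˣ →* Circle, (∀ u, ρ u ^ 2 = 1) ∧ TrivialMod ρ a ∧ ρ p = 1 ∧ ρ q = 1 ∧ ρ g = -1 := by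
  let U : Subgroup Rˣ := (Units.map (Ideal.Quotient.mk (Ideal.span {a})).toMonoidHom).ker
  have hU : ∀ u : Rˣ, u ∈ U ↔ a ∣ (u : R) - 1 := by
    intro u
    rw [MonoidHom.mem_ker, Units.ext_iff]
    change Ideal.Quotient.mk (Ideal.span {a}) u = 1 ↔ _
    rw [← map_one (Ideal.Quotient.mk (Ideal.span {a})), Ideal.Quotient.eq,
      Ideal.mem_span_singleton]
  let Q : Subgroup Rˣ := (powMonoidHom 2 : Rˣ →* Rˣ).range
  -- H is generated by the squares, p, q and the units that are 1 modulo a. Modulo squares only the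
  -- classes 1, p, q and pq can meet g, and `h` excludes these four.
  let H : Subgroup Rˣ := Q ⊔ Subgroup.zpowers p ⊔ Subgroup.zpowers q ⊔ U
  have hQ : Q ≤ H := (le_sup_left.trans le_sup_left).trans le_sup_left
  have hpow : ∀ (r : Rˣ) (k : ℤ), ∃ y : Rˣ, r ^ k = y ^ 2 ∨ r ^ k = y ^ 2 * r := by
    intro r k
    rcases Int.even_or_odd' k with ⟨m, rfl | rfl⟩
    · exact ⟨r ^ m, Or.inl (by rw [mul_comm, zpow_mul]; rfl)⟩
    · exact ⟨r ^ m, Or.inr (by rw [zpow_add, mul_comm 2 m, zpow_mul, zpow_one]; rfl)⟩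
  have hg : g ∉ H := by
    intro hg
    obtain ⟨x₁, hx₁, u, hu, rfl⟩ := Subgroup.mem_sup.1 hg
    obtain ⟨x₂, hx₂, _, ⟨j, rfl⟩, rfl⟩ := Subgroup.mem_sup.1 hx₁
    obtain ⟨_, ⟨x, rfl⟩, _, ⟨i, rfl⟩, rfl⟩ := Subgroup.mem_sup.1 hx₂
    beta_reduce at *
    rw [hU] at hu
    have hdvd : ∀ y : Rˣ, a ∣ ((y * u : Rˣ) : R) - y := by
      intro y
      have : ((y * u : Rˣ) : R) - y = (u - 1) * y := by rw [Units.val_mul]; ring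
      rw [this]
      exact hu.mul_right _
    have hd := hdvd ((powMonoidHom 2) x * p ^ i * q ^ j)
    obtain ⟨y, hy⟩ := hpow p i
    obtain ⟨z, hz⟩ := hpow q j
    obtain ⟨h1, h2, h3, h4⟩ := h (x * y * z)
    rcases hy with hy | hy <;> rcases hz with hz | hz
    · refine h1 (hd.trans (dvd_of_eq ?_))
      simp only [hy, hz, powMonoidHom_apply, Units.val_mul, Units.val_pow_eq_pow_val]; ring
    · refine h3 (hd.trans (dvd_of_eq ?_))
      simp only [hy, hz, powMonoidHom_apply, Units.val_mul, Units.val_pow_eq_pow_val]; ring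
    · refine h2 (hd.trans (dvd_of_eq ?_))
      simp only [hy, hz, powMonoidHom_apply, Units.val_mul, Units.val_pow_eq_pow_val]; ring
    · refine h4 (hd.trans (dvd_of_eq ?_))
      simp only [hy, hz, powMonoidHom_apply, Units.val_mul, Units.val_pow_eq_pow_val]; ring
  obtain ⟨ρ, h1, h2, h3⟩ := exists_char_of_notMem H (fun x ↦ hQ ⟨x, rfl⟩) hg
  refine ⟨ρ, h1, fun u hu ↦ h2 u ?_, h2 p ?_, h2 q ?_, h3⟩
  · exact le_sup_right (a := Q ⊔ Subgroup.zpowers p ⊔ Subgroup.zpowers q) ((hU u).2 hu)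
  · exact Subgroup.mem_sup_left (Subgroup.mem_sup_left (Subgroup.mem_sup_right
      (Subgroup.mem_zpowers p)))
  · exact Subgroup.mem_sup_left (Subgroup.mem_sup_right (Subgroup.mem_zpowers q))

/-! ### Odd residue characteristic -/

theorem isSquare_mul_of_not_isSquare {k : Type*} [Field k] [Finite k] {a b : k}
    (ha : ¬ IsSquare a) (hb : ¬ IsSquare b) : IsSquare (a * b) := by
  classical
  have := Fintype.ofFinite k
  have ha' := quadraticChar_neg_one_iff_not_isSquare.2 ha
  have hb' := quadraticChar_neg_one_iff_not_isSquare.2 hb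
  have hab : quadraticChar k (a * b) = 1 := by rw [map_mul, ha', hb']; norm_num
  have h0 : a * b ≠ 0 := by
    rintro h
    rw [h, quadraticChar_zero] at hab
    exact zero_ne_one hab
  exact (quadraticChar_one_iff_isSquare h0).1 hab

theorem isSquare_residue_iff [IsLocalRing R] {ϖ : R}
    (hmax : IsLocalRing.maximalIdeal R = Ideal.span {ϖ}) (u : Rˣ) :
    IsSquare (IsLocalRing.residue R (u : R)) ↔ ∃ y : Rˣ, ϖ ∣ (u : R) - y ^ 2 := by
  have hiff : ∀ y : R, IsLocalRing.residue R (u : R) = IsLocalRing.residue R y ^ 2 ↔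
      ϖ ∣ (u : R) - y ^ 2 := by
    intro y
    rw [← map_pow, ← sub_eq_zero, ← map_sub, IsLocalRing.residue_eq_zero_iff, hmax,
      Ideal.mem_span_singleton]
  constructor
  · rintro ⟨r, hr⟩
    obtain ⟨y, rfl⟩ := IsLocalRing.residue_surjective r
    have hy : IsUnit y := by
      by_contra hy
      have h0 : IsLocalRing.residue R y = 0 := (IsLocalRing.residue_eq_zero_iff y).2 hy
      rw [h0, zero_mul, IsLocalRing.residue_eq_zero_iff] at hr
      exact hr u.isUnit
    obtain ⟨y, rfl⟩ := hy
    exact ⟨y, (hiff y).1 (by rw [hr, sq])⟩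
  · rintro ⟨y, hy⟩
    exact ⟨_, ((hiff y).2 hy).trans (sq _)⟩

/-- In odd residue characteristic, a nontrivial quadratic character of the units is trivial exactly
at the squares modulo the maximal ideal. -/
theorem TrivialMod.eq_one_iff_of_odd [IsLocalRing R] [Finite (IsLocalRing.ResidueField R)] {ϖ : R}
    (hmax : IsLocalRing.maximalIdeal R = Ideal.span {ϖ}) {ρ : Rˣ →* Circle}
    (h2 : ∀ u, ρ u ^ 2 = 1) (h : TrivialMod ρ ϖ) {g : Rˣ} (hg : ρ g ≠ 1) (u : Rˣ) :
    ρ u = 1 ↔ ∃ y : Rˣ, ϖ ∣ (u : R) - y ^ 2 := by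
  have hsq : ∀ u : Rˣ, (∃ y : Rˣ, ϖ ∣ (u : R) - y ^ 2) → ρ u = 1 := by
    rintro u ⟨y, hy⟩
    rw [h.map_eq (w := y ^ 2) (by simpa using hy), map_pow, h2]
  refine ⟨fun hu ↦ ?_, hsq u⟩
  -- The product of two nonsquares of the residue field is a square, so ρ = 1 at a nonsquare u would
  -- force ρ g = 1.
  by_contra hns
  have hg' : ¬ ∃ y : Rˣ, ϖ ∣ (g : R) - y ^ 2 := fun h' ↦ hg (hsq g h')
  rw [← isSquare_residue_iff hmax] at hns hg'
  have := isSquare_mul_of_not_isSquare hns hg'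
  rw [← map_mul, ← Units.val_mul, isSquare_residue_iff hmax] at this
  have := hsq _ this
  rw [map_mul, hu, one_mul] at this
  exact hg this

theorem exists_not_isSquare_residue [IsLocalRing R] [Finite (IsLocalRing.ResidueField R)] {ϖ : R}
    (hmax : IsLocalRing.maximalIdeal R = Ideal.span {ϖ}) (hu : IsUnit (2 : R)) :
    ∃ g : Rˣ, ¬ ∃ y : Rˣ, ϖ ∣ (g : R) - y ^ 2 := by
  have hchar : ringChar (IsLocalRing.ResidueField R) ≠ 2 := by
    intro h
    have h0 : ((2 : ℕ) : IsLocalRing.ResidueField R) = 0 := by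
      rw [← h]; exact ringChar.Nat.cast_ringChar
    have h1 : IsLocalRing.residue R 2 = 0 := by rw [map_ofNat]; exact_mod_cast h0
    exact ((IsLocalRing.residue_eq_zero_iff _).1 h1) hu
  obtain ⟨a, ha⟩ := FiniteField.exists_nonsquare hchar
  obtain ⟨g, rfl⟩ := IsLocalRing.residue_surjective a
  have hg : IsUnit g := by
    by_contra hg
    have h0 : IsLocalRing.residue R g = 0 := (IsLocalRing.residue_eq_zero_iff g).2 hg
    rw [h0] at ha
    exact ha ⟨0, by simp⟩
  obtain ⟨g, rfl⟩ := hg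
  exact ⟨g, by rwa [← isSquare_residue_iff hmax]⟩

theorem exists_char_of_odd [IsLocalRing R] [Finite (IsLocalRing.ResidueField R)] {ϖ : R}
    (hmax : IsLocalRing.maximalIdeal R = Ideal.span {ϖ}) (hu : IsUnit (2 : R)) :
    ∃ ρ : Rˣ →* Circle, (∀ u, ρ u ^ 2 = 1) ∧ TrivialMod ρ ϖ ∧ ∃ g, ρ g = -1 := by
  obtain ⟨g, hg⟩ := exists_not_isSquare_residue hmax hu
  rw [not_exists] at hg
  obtain ⟨ρ, h1, h2, -, -, h3⟩ := exists_char_trivialMod ϖ 1 1 g (fun y ↦ by simpa using hg y)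
  exact ⟨ρ, h1, h2, g, h3⟩

end LocalRing

end IdeleClass

namespace IdeleClass

/-! ### Dyadic local rings -/

section Dyadic

theorem not_dvd_unit {R : Type*} [CommRing R] {a : R} (ha : ¬ IsUnit a) (u : Rˣ) : ¬ a ∣ (u : R) :=
  fun h ↦ ha (isUnit_of_dvd_unit h u.isUnit)

variable {R : Type*} [CommRing R] [IsDomain R] [IsLocalRing R]

/-! #### Residue field with two elements and uniformizer `2` -/

section Split

variable {A : Type*} [CommGroup A]
variable (h2 : ¬ IsUnit (2 : R)) (hres : ∀ r : R, 2 ∣ r ∨ 2 ∣ r - 1)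

theorem exists_unit_five (h2 : ¬ IsUnit (2 : R)) : ∃ u : Rˣ, (u : R) = 5 := by
  obtain ⟨u, hu⟩ := exists_unit_eq_one_add_mul h2 2
  exact ⟨u, by rw [hu]; norm_num⟩

include h2 hres

theorem exists_eq_one_add_two_mul (u : Rˣ) : ∃ t : R, (u : R) = 1 + 2 * t := by
  obtain ⟨t, ht⟩ := (hres u).resolve_left (not_dvd_unit h2 u)
  exact ⟨t, by linear_combination ht⟩

/-- With u = 1 + 2t one has u² - 1 = 4t(t + 1), and one of t, t + 1 is even because there are only
two residue classes. -/
theorem eight_dvd_sq_sub_one (u : Rˣ) : (8 : R) ∣ (u : R) ^ 2 - 1 := by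
  obtain ⟨t, ht⟩ := exists_eq_one_add_two_mul h2 hres u
  rcases hres t with ⟨z, hz⟩ | ⟨z, hz⟩
  · exact ⟨t * z + z, by rw [ht]; linear_combination (4 + 4 * t) * hz⟩
  · obtain rfl : t = 1 + 2 * z := by linear_combination hz
    exact ⟨2 * z ^ 2 + 3 * z + 1, by rw [ht]; ring⟩

/-- Squares of units are 1 modulo 8, so the four cases of `exists_char_trivialMod` with q = 1 reduce
to g ≢ 1 and g ≢ p. -/
theorem exists_char_zmod_eight_aux {p g : Rˣ} (h1 : ¬ (8 : R) ∣ (g : R) - 1)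
    (h3 : ¬ (8 : R) ∣ (g : R) - p) :
    ∃ ρ : Rˣ →* Circle, (∀ u, ρ u ^ 2 = 1) ∧ TrivialMod ρ 8 ∧ ρ p = 1 ∧ ρ g = -1 := by
  obtain ⟨ρ, a1, a2, a3, -, a4⟩ := exists_char_trivialMod (8 : R) p 1 g (fun y ↦ by
    have hy := eight_dvd_sq_sub_one h2 hres y
    have e1 : ¬ (8 : R) ∣ (g : R) - y ^ 2 := fun h ↦ h1 (by
      convert h.add hy using 1; ring)
    have e2 : ¬ (8 : R) ∣ (g : R) - y ^ 2 * p := fun h ↦ h3 (by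
      convert h.add (hy.mul_right p) using 1; ring)
    simpa using ⟨e1, e2, e1, e2⟩)
  exact ⟨ρ, a1, a2, a3, a4⟩

variable (h20 : (2 : R) ≠ 0)
include h20

theorem not_eight_dvd_four_mul {a : R} (ha : 2 ∣ a - 1) : ¬ (8 : R) ∣ 4 * a := by
  rintro ⟨z, hz⟩
  apply h2
  have h4 : (4 : R) ≠ 0 := by
    have := mul_ne_zero h20 h20
    norm_num at this
    exact this
  have : a = 2 * z := mul_left_cancel₀ h4 (by linear_combination hz)
  rw [this] at ha
  have h1 : (2 : R) ∣ 1 := by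
    have := (dvd_mul_right 2 z).sub ha
    simpa using this
  exact isUnit_of_dvd_one h1

omit hres in
theorem not_four_dvd_two_mul {a : R} (ha : IsUnit a) : ¬ (4 : R) ∣ 2 * a := by
  rintro ⟨z, hz⟩
  apply h2
  have : a = 2 * z := mul_left_cancel₀ h20 (by linear_combination hz)
  exact isUnit_of_dvd_unit ⟨z, this⟩ ha

/-- The quadratic characters of `(ℤ/8)ˣ`. -/
theorem exists_char_zmod_eight (five : Rˣ) (hfive : (five : R) = 5) (ε₁ ε₂ : Circle)
    (hε₁ : ε₁ ^ 2 = 1) (hε₂ : ε₂ ^ 2 = 1) :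
    ∃ ρ : Rˣ →* Circle, (∀ u, ρ u ^ 2 = 1) ∧ TrivialMod ρ 8 ∧ ρ (-1) = ε₁ ∧ ρ five = ε₂ := by
  have n4 : ¬ (8 : R) ∣ 4 * 1 := not_eight_dvd_four_mul h2 hres h20 (by simp)
  have n2 : ∀ a : R, IsUnit a → ¬ (8 : R) ∣ 2 * a := fun a ha h ↦
    not_four_dvd_two_mul h2 h20 ha (Dvd.dvd.trans ⟨2, by norm_num⟩ h)
  have u3 : IsUnit (-3 : R) := by
    obtain ⟨u, hu⟩ := exists_unit_eq_one_add_mul h2 (-2)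
    exact ⟨u, by rw [hu]; norm_num⟩
  obtain ⟨ρ, r1, r2, r3, r4⟩ := exists_char_zmod_eight_aux h2 hres (p := five) (g := -1)
    (fun h ↦ n2 (-1) isUnit_one.neg (by convert h using 1; simp; norm_num))
    (fun h ↦ n2 (-3) u3 (by convert h using 1; simp [hfive]; norm_num))
  obtain ⟨ψ, s1, s2, s3, s4⟩ := exists_char_zmod_eight_aux h2 hres (p := -1) (g := five)
    (fun h ↦ n4 (by convert h using 1; rw [hfive]; norm_num))
    (fun h ↦ n2 (-3) u3 (by
      have := (dvd_refl (8 : R)).mul_right (-1)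
      have := h.add (this.mul_right 1)
      have h12 : (8 : R) ∣ 12 * (-1) := by
        have := (h.neg_right).add ((dvd_refl (8 : R)).mul_right 0)
        have h6 : (8 : R) ∣ -6 := by convert h.neg_right using 1; simp [hfive]; norm_num
        convert h6.mul_right 2 using 1; norm_num
      convert h.neg_right using 1; simp [hfive]; norm_num))
  -- ρ is -1 at -1 and 1 at 5, while ψ is 1 at -1 and -1 at 5; the four sign patterns come from 1,
  -- ψ, ρ and ρψ.
  rcases Circle.sq_eq_one_iff.1 hε₁ with rfl | rfl <;> rcases Circle.sq_eq_one_iff.1 hε₂ with rfl | rfl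
  · exact ⟨1, by simp, fun _ _ ↦ rfl, rfl, rfl⟩
  · exact ⟨ψ, s1, s2, s3, s4⟩
  · exact ⟨ρ, r1, r2, r4, r3⟩
  · exact ⟨ρ * ψ, fun u ↦ by simp [mul_pow, r1, s1], r2.mul s2, by simp [r4, s3], by simp [r3, s4]⟩

omit h20 in
-- Every unit is 1 or -1 modulo 4.
theorem TrivialMod.eq_one_of_four {ρ : Rˣ →* A} (h : TrivialMod ρ 4) (h1 : ρ (-1) = 1) (u : Rˣ) :
    ρ u = 1 := by
  obtain ⟨t, ht⟩ := exists_eq_one_add_two_mul h2 hres u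
  rcases hres t with ⟨z, hz⟩ | ⟨z, hz⟩
  · exact h u ⟨z, by rw [ht]; linear_combination 2 * hz⟩
  · rw [h.map_eq (u := u) (w := -1) ⟨z + 1, by rw [ht]; push_cast; linear_combination 2 * hz⟩, h1]

omit h2 h20 in
-- A unit that is 1 modulo 4 is 1 or 5 modulo 8.
theorem TrivialMod.four_of_eight {ρ : Rˣ →* A} (h : TrivialMod ρ 8) {five : Rˣ}
    (hfive : (five : R) = 5) (h1 : ρ five = 1) : TrivialMod ρ 4 := by
  rintro u ⟨t, ht⟩
  rcases hres t with ⟨z, hz⟩ | ⟨z, hz⟩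
  · exact h u ⟨z, by linear_combination ht + 4 * hz⟩
  · rw [h.map_eq (u := u) (w := five) ⟨z, by rw [hfive]; linear_combination ht + 4 * hz⟩, h1]

end Split

/-! #### Residue field with two elements and uniformizer `√-2` -/

section Ramified

variable {A : Type*} [CommGroup A] {s π w : R} {p : Rˣ}
variable (hs : s ^ 2 = -2) (hsu : ¬ IsUnit s) (hres : ∀ r : R, s ∣ r ∨ s ∣ r - 1)
variable (hπ : π = s * w) (hw : s ∣ w - 1) (hp : (p : R) = 1 + π)

include hs hsu hres hπ hw hp

/-- The unit p = 1 + π generates the units modulo s³: it is 1 + s modulo s², and p² is 1 + s² modulo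
s³ since 2π ∈ s³R. This is why ρ(p) = 1 pushes the exponent of a nontrivial character to at least 4.
-/
theorem TrivialMod.eq_one_of_cube {ρ : Rˣ →* A} (h2 : ∀ u, ρ u ^ 2 = 1) (h : TrivialMod ρ (s ^ 3))
    (h1 : ρ p = 1) (u : Rˣ) : ρ u = 1 := by
  obtain ⟨c, hc⟩ := hw
  obtain rfl : w = 1 + s * c := by linear_combination hc
  have hsq : TrivialMod ρ (s ^ 2) := by
    rintro u ⟨t, ht⟩
    rcases hres t with ⟨z, hz⟩ | ⟨z, hz⟩
    · exact h u ⟨z, by rw [ht, hz]; ring⟩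
    · rw [h.map_eq (u := u) (w := p ^ 2) ?_, map_pow, h2]
      refine ⟨z - 2 * c - s * c ^ 2 + (1 + s * c), ?_⟩
      rw [Units.val_pow_eq_pow_val, hp, hπ]
      linear_combination ht + s ^ 2 * hz - s * (1 + s * c) * hs
  obtain ⟨t, ht⟩ := (hres u).resolve_left (not_dvd_unit hsu u)
  rcases hres t with ⟨z, hz⟩ | ⟨z, hz⟩
  · exact hsq u ⟨z, by rw [ht, hz]; ring⟩
  · rw [hsq.map_eq (u := u) (w := p) ?_, h1]
    refine ⟨z - c, ?_⟩
    rw [hp, hπ]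
    linear_combination ht + s * hz

/-- From s² = -2 one gets -(1 + s)² = 1 + s³, so ρ(-1) = 1 settles the layer between s³ and s⁴. -/
theorem TrivialMod.eq_one_of_four_ramified {ρ : Rˣ →* A} (h2 : ∀ u, ρ u ^ 2 = 1)
    (h : TrivialMod ρ (s ^ 4)) (h1 : ρ p = 1) (hn : ρ (-1) = 1) (u : Rˣ) : ρ u = 1 := by
  obtain ⟨a, ha⟩ := exists_unit_eq_one_add_mul hsu 1
  rw [mul_one] at ha
  have h3 : TrivialMod ρ (s ^ 3) := by
    rintro u ⟨t, ht⟩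
    rcases hres t with ⟨z, hz⟩ | ⟨z, hz⟩
    · exact h u ⟨z, by rw [ht, hz]; ring⟩
    · rw [h.map_eq (u := u) (w := -(a ^ 2)) ?_, ← neg_one_mul, map_mul, hn, one_mul, map_pow, h2]
      refine ⟨z, ?_⟩
      rw [Units.val_neg, Units.val_pow_eq_pow_val, ha]
      linear_combination ht + s ^ 3 * hz + (s + 1) * hs
  exact TrivialMod.eq_one_of_cube hs hsu hres hπ hw hp h2 h3 h1 u

/-- The layer between s⁴ and s⁵ is represented by -(1 + s)(1 - s) = -3 = 1 - s⁴, where ρ is 1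
because it takes the same value at the conjugate units 1 + s and 1 - s. -/
theorem TrivialMod.eq_one_of_conj {ρ : Rˣ →* A} (h2 : ∀ u, ρ u ^ 2 = 1)
    (h : TrivialMod ρ (s ^ 5)) (h1 : ρ p = 1) (hn : ρ (-1) = 1) {a b : Rˣ} (ha : (a : R) = 1 + s)
    (hb : (b : R) = 1 - s) (hab : ρ a = ρ b) (u : Rˣ) : ρ u = 1 := by
  have h3 : ρ (-(a * b)) = 1 := by
    rw [← neg_one_mul, map_mul, hn, one_mul, map_mul, ← hab, ← sq, h2]
  have h4 : TrivialMod ρ (s ^ 4) := by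
    rintro u ⟨t, ht⟩
    rcases hres t with ⟨z, hz⟩ | ⟨z, hz⟩
    · exact h u ⟨z, by rw [ht, hz]; ring⟩
    · rw [h.map_eq (u := u) (w := -(a * b)) ?_, h3]
      refine ⟨z - s, ?_⟩
      rw [Units.val_neg, Units.val_mul, ha, hb]
      linear_combination ht + s ^ 4 * hz + (s ^ 4 - s ^ 2 + 1) * hs
  exact TrivialMod.eq_one_of_four_ramified hs hsu hres hπ hw hp h2 h4 h1 hn u

variable (hs0 : s ≠ 0)
include hs0

/-- Modulo s² squares of units and -1 are 1 while p is 1 + s, so -1 is not a square times p. If -1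
were (1 + st)² modulo s⁴, then 1 - t² + st ∈ s²R; but this element is a unit if s ∣ t, and it is s
modulo s² if s ∣ t - 1. -/
theorem exists_char_ramified_four :
    ∃ ρ : Rˣ →* Circle, (∀ u, ρ u ^ 2 = 1) ∧ TrivialMod ρ (s ^ 4) ∧ ρ p = 1 ∧ ρ (-1) = -1 := by
  obtain ⟨c, hc⟩ := hw
  obtain rfl : w = 1 + s * c := by linear_combination hc
  have hy : ∀ y : Rˣ, ∃ t : R, (y : R) = 1 + s * t := fun y ↦ by
    obtain ⟨t, ht⟩ := (hres y).resolve_left (not_dvd_unit hsu y)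
    exact ⟨t, by linear_combination ht⟩
  have e1 : ∀ y : Rˣ, ¬ s ^ 4 ∣ (-1 : R) - y ^ 2 := by
    rintro y ⟨z, hz⟩
    obtain ⟨t, ht⟩ := hy y
    rw [ht] at hz
    have e : 1 - t ^ 2 + s * t = s ^ 2 * z := by
      apply mul_left_cancel₀ (pow_ne_zero 2 hs0)
      linear_combination hz + (1 + s * t) * hs
    rcases hres t with ⟨x, rfl⟩ | ⟨x, hx⟩
    · exact hsu (isUnit_of_dvd_one ⟨s * x ^ 2 + s * z - s * x, by linear_combination e⟩)
    · obtain rfl : t = 1 + s * x := by linear_combination hx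
      have e' : 1 + s * x = s * (z + x ^ 2) + 2 * x := by
        apply mul_left_cancel₀ hs0
        linear_combination e
      exact hsu (isUnit_of_dvd_one ⟨z + x ^ 2 - s * x - x, by
        linear_combination e' + x * hs⟩)
  have e2 : ∀ y : Rˣ, ¬ s ^ 4 ∣ (-1 : R) - y ^ 2 * p := by
    rintro y ⟨z, hz⟩
    obtain ⟨t, ht⟩ := hy y
    rw [ht, hp, hπ] at hz
    have e' : 1 = s * (1 - s ^ 2 * z - c + (s * t - t ^ 2) * (1 + s * (1 + s * c))) := by
      apply mul_left_cancel₀ hs0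
      linear_combination -hz - (1 + t * s * (1 + s * (1 + s * c))) * hs
    exact hsu (isUnit_of_dvd_one ⟨_, e'⟩)
  obtain ⟨ρ, a1, a2, a3, -, a4⟩ := exists_char_trivialMod (s ^ 4) p 1 (-1) (fun y ↦ by
    simpa using ⟨e1 y, e2 y, e1 y, e2 y⟩)
  exact ⟨ρ, a1, a2, a3, a4⟩

/-- 5 = 1 + s⁴ represents the layer between s⁴ and s⁵, so the value -1 there makes the exponent
exactly 5. It has to be shown that 5 is not ±1 or ±p times a square modulo s⁵; the cases with p
already fail modulo s². -/
theorem exists_char_ramified_five {five : Rˣ} (hfive : (five : R) = 5) :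
    ∃ ρ : Rˣ →* Circle, (∀ u, ρ u ^ 2 = 1) ∧ TrivialMod ρ (s ^ 5) ∧ ρ p = 1 ∧ ρ (-1) = 1 ∧
      ρ five = -1 := by
  obtain ⟨c, hc⟩ := hw
  obtain rfl : w = 1 + s * c := by linear_combination hc
  have hy : ∀ y : Rˣ, ∃ t : R, (y : R) = 1 + s * t := fun y ↦ by
    obtain ⟨t, ht⟩ := (hres y).resolve_left (not_dvd_unit hsu y)
    exact ⟨t, by linear_combination ht⟩
  have hsq : ∀ t : R, (1 + s * t) ^ 2 = 1 + s ^ 2 * (t ^ 2 - s * t) := fun t ↦ by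
    linear_combination s * t * hs
  -- Two expansions of 5: the first is compared with squares, the second with negatives of squares.
  have h5 : (5 : R) = 1 + s ^ 4 := by linear_combination (2 - s ^ 2) * hs
  have h5' : (5 : R) = -1 - 3 * s ^ 2 := by linear_combination 3 * hs
  have e1 : ∀ y : Rˣ, ¬ s ^ 5 ∣ (five : R) - y ^ 2 := by
    rintro y ⟨z, hz⟩
    obtain ⟨t, ht⟩ := hy y
    rw [ht, hfive, h5, hsq] at hz
    have e : s ^ 2 = t ^ 2 - s * t + s ^ 3 * z := by
      apply mul_left_cancel₀ (pow_ne_zero 2 hs0)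
      linear_combination hz
    rcases hres t with ⟨r, rfl⟩ | ⟨x, hx⟩
    · have e' : 1 = r ^ 2 - r + s * z := by
        apply mul_left_cancel₀ (pow_ne_zero 2 hs0)
        linear_combination e
      rcases hres r with ⟨x, rfl⟩ | ⟨x, hx⟩
      · exact hsu (isUnit_of_dvd_one ⟨s * x ^ 2 - x + z, by linear_combination e'⟩)
      · exact hsu (isUnit_of_dvd_one ⟨r * x + z, by linear_combination e' + r * hx⟩)
    · obtain rfl : t = 1 + s * x := by linear_combination hx
      exact hsu (isUnit_of_dvd_one
        ⟨s - 2 * x - s * x ^ 2 + (1 + s * x) - s ^ 2 * z, by linear_combination -e⟩)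
  have e2 : ∀ y : Rˣ, ¬ s ^ 5 ∣ (five : R) - y ^ 2 * p := by
    rintro y ⟨z, hz⟩
    obtain ⟨t, ht⟩ := hy y
    rw [ht, hfive, h5, hsq, hp, hπ] at hz
    refine hsu (isUnit_of_dvd_one
      ⟨s ^ 2 - c - (t ^ 2 - s * t) * (1 + s * (1 + s * c)) - s ^ 3 * z, ?_⟩)
    apply mul_left_cancel₀ hs0
    linear_combination -hz
  have e3 : ∀ y : Rˣ, ¬ s ^ 5 ∣ (five : R) - y ^ 2 * (-1) := by
    rintro y ⟨z, hz⟩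
    obtain ⟨t, ht⟩ := hy y
    rw [ht, hfive, h5', hsq] at hz
    have e : 3 = t ^ 2 - s * t - s ^ 3 * z := by
      apply mul_left_cancel₀ (pow_ne_zero 2 hs0)
      linear_combination -hz
    rcases hres t with ⟨r, rfl⟩ | ⟨x, hx⟩
    · exact hsu (isUnit_of_dvd_one ⟨s * r ^ 2 - s * r - s ^ 2 * z + s, by
        linear_combination e - hs⟩)
    · obtain rfl : t = 1 + s * x := by linear_combination hx
      have e' : 1 = s + 2 * x + s * x ^ 2 - s * x - s ^ 2 * z := by
        apply mul_left_cancel₀ hs0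
        linear_combination e - hs
      exact hsu (isUnit_of_dvd_one ⟨1 - s * x + x ^ 2 - x - s * z, by
        linear_combination e' + x * hs⟩)
  have e4 : ∀ y : Rˣ, ¬ s ^ 5 ∣ (five : R) - y ^ 2 * (p * (-1)) := by
    rintro y ⟨z, hz⟩
    obtain ⟨t, ht⟩ := hy y
    rw [ht, hfive, h5', hsq, hp, hπ] at hz
    refine hsu (isUnit_of_dvd_one
      ⟨3 - c - (t ^ 2 - s * t) * (1 + s * (1 + s * c)) + s ^ 3 * z, ?_⟩)
    apply mul_left_cancel₀ hs0
    linear_combination hz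
  obtain ⟨ρ, a1, a2, a3, a4, a5⟩ := exists_char_trivialMod (s ^ 5) p (-1) five (fun y ↦
    ⟨e1 y, e2 y, by simpa using e3 y, by simpa using e4 y⟩)
  exact ⟨ρ, a1, a2, a3, a4, a5⟩

end Ramified

/-! #### Residue field with four elements and uniformizer `2` -/

section Inert

variable {A : Type*} [CommGroup A] {z : R} {p f : Rˣ}
variable (hz : z ^ 2 + z + 1 = 0) (h2u : ¬ IsUnit (2 : R))
  (hres : ∀ r : R, 2 ∣ r ∨ 2 ∣ r - 1 ∨ 2 ∣ r - z ∨ 2 ∣ r - (1 + z))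
variable (hp : (p : R) = 1 + 2 * z)

include hz h2u hres hp

/-- The units are generated by the cube root of unity z, where a character of exponent 2 is trivial,
and by 1 + 2R, whose classes modulo 4 are 1, -1, p and -p. -/
theorem TrivialMod.eq_one_of_inert {ρ : Rˣ →* A} (h2 : ∀ u, ρ u ^ 2 = 1) (h : TrivialMod ρ 4)
    (h1 : ρ p = 1) (hn : TrivialMod ρ 2 ∨ ρ (-1) = 1) (u : Rˣ) : ρ u = 1 := by
  have ht : TrivialMod ρ 2 := by
    rcases hn with hn | hn
    · exact hn
    rintro u ⟨t, ht⟩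
    rcases hres t with ⟨x, hx⟩ | ⟨x, hx⟩ | ⟨x, hx⟩ | ⟨x, hx⟩
    · exact h u ⟨x, by rw [ht, hx]; ring⟩
    · rw [h.map_eq (u := u) (w := -1) ⟨x + 1, by push_cast; linear_combination ht + 2 * hx⟩, hn]
    · rw [h.map_eq (u := u) (w := p) ⟨x, by rw [hp]; linear_combination ht + 2 * hx⟩, h1]
    · rw [h.map_eq (u := u) (w := -p) ⟨x + 1 + z, by
        rw [Units.val_neg, hp]; linear_combination ht + 2 * hx⟩, ← neg_one_mul, map_mul, hn, h1,
        one_mul]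
  have hzu : IsUnit z := IsUnit.of_mul_eq_one (-(z + 1)) (by linear_combination -hz)
  obtain ⟨ζ, rfl⟩ := hzu
  have hζ3 : ζ ^ 3 = 1 := by
    ext
    push_cast
    linear_combination ((ζ : R) - 1) * hz
  have hζ : ρ ζ = 1 := by
    have := congrArg ρ hζ3
    rwa [map_pow, pow_succ, h2, one_mul, map_one] at this
  rcases hres u with h0 | h0 | ⟨x, hx⟩ | ⟨x, hx⟩
  · exact absurd h0 (not_dvd_unit h2u u)
  · exact ht u h0
  · rw [ht.map_eq (w := ζ) ⟨x, hx⟩, hζ]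
  · rw [ht.map_eq (w := ζ ^ 2) ⟨x + 1 + ζ, by push_cast; linear_combination hx - hz⟩, map_pow, h2]

omit hz h2u hres in
-- Here p' plays the conjugate of p = 1 + 2z: it is 1 + 2(1 + z) ≡ -p modulo 4, so equal values at p
-- and p' force ρ(-1) = 1.
theorem TrivialMod.map_neg_one_of_conj {ρ : Rˣ →* A} (h : TrivialMod ρ 4) {p' : Rˣ}
    (hp' : 2 ∣ (p' : R) - (1 + 2 * (1 + z)) ∧ 4 ∣ (p' : R) - (1 + 2 * (1 + z)))
    (h1 : ρ p' = ρ p) : ρ (-1) = 1 := by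
  obtain ⟨x, hx⟩ := hp'.2
  have := h.map_eq (u := p') (w := -p) ⟨x + 1 + z, by
    rw [Units.val_neg, hp]; linear_combination hx⟩
  rw [h1, ← neg_one_mul, map_mul] at this
  exact (mul_eq_right.1 this.symm)

omit h2u in
-- The classes of 1 + 4R modulo 8 are 1, p² = -3, f and fp², and ρ is trivial on all of them.
theorem TrivialMod.four_of_inert {ρ : Rˣ →* A} (h2 : ∀ u, ρ u ^ 2 = 1) (h : TrivialMod ρ 8)
    (hf : (f : R) = 1 + 4 * z) (h1 : ρ f = 1) : TrivialMod ρ 4 := by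
  rintro u ⟨t, ht⟩
  rcases hres t with ⟨x, hx⟩ | ⟨x, hx⟩ | ⟨x, hx⟩ | ⟨x, hx⟩
  · exact h u ⟨x, by rw [ht, hx]; ring⟩
  · rw [h.map_eq (u := u) (w := p ^ 2) ⟨x + 1, by
      push_cast; rw [hp]; linear_combination ht + 4 * hx - 4 * hz⟩, map_pow, h2]
  · rw [h.map_eq (u := u) (w := f) ⟨x, by rw [hf]; linear_combination ht + 4 * hx⟩, h1]
  · rw [h.map_eq (u := u) (w := f * p ^ 2) ⟨x + 1 + 2 * z, by
      push_cast; rw [hf, hp]; linear_combination ht + 4 * hx - (4 + 16 * z) * hz⟩, map_mul, h1, map_pow, h2,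
      one_mul]

/-- Squaring is injective on 𝔽₄, so a square that is 1 modulo 2 comes from a unit 1 + 2t and is 1
modulo 4. Thus -1 ≡ y² or -1 ≡ y²p modulo 4 would give 4 ∣ 2 or 4 ∣ 2(1 + z), and 1 + z is a unit.
-/
theorem exists_char_inert (h20 : (2 : R) ≠ 0) :
    ∃ ρ : Rˣ →* Circle, (∀ u, ρ u ^ 2 = 1) ∧ TrivialMod ρ 4 ∧ ρ p = 1 ∧ ρ (-1) = -1 := by
  have hz1 : IsUnit (1 + z) := IsUnit.of_mul_eq_one (-z) (by linear_combination -hz)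
  have hsq : ∀ y : Rˣ, (2 : R) ∣ (y : R) ^ 2 - 1 → (4 : R) ∣ (y : R) ^ 2 - 1 := by
    rintro y ⟨x, hx⟩
    have hy : (2 : R) ∣ (y : R) - 1 := by
      rcases hres y with h0 | h0 | ⟨t, ht⟩ | ⟨t, ht⟩
      · exact absurd h0 (not_dvd_unit h2u y)
      · exact h0
      · exfalso
        have : (y : R) = z + 2 * t := by linear_combination ht
        rw [this] at hx
        have hzu : IsUnit z := IsUnit.of_mul_eq_one (-(z + 1)) (by linear_combination -hz)
        exact h2u (isUnit_of_dvd_unit (⟨-1 - x + 2 * z * t + 2 * t ^ 2, by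
          linear_combination hz - hx⟩ : (2 : R) ∣ z) hzu)
      · exfalso
        have : (y : R) = 1 + z + 2 * t := by linear_combination ht
        rw [this] at hx
        exact h2u (isUnit_of_dvd_unit (⟨x + 1 - 2 * t * (1 + z) - 2 * t ^ 2, by
          linear_combination hx - hz⟩ : (2 : R) ∣ 1 + z) hz1)
    obtain ⟨t, ht⟩ := hy
    have : (y : R) = 1 + 2 * t := by linear_combination ht
    exact ⟨t + t ^ 2, by rw [this]; ring⟩
  have e1 : ∀ y : Rˣ, ¬ (4 : R) ∣ (-1 : R) - y ^ 2 := by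
    intro y h
    have hy := hsq y (by
      obtain ⟨x, hx⟩ := h
      exact ⟨-1 - 2 * x, by linear_combination -hx⟩)
    exact not_four_dvd_two_mul h2u h20 isUnit_one.neg (by convert h.add hy using 1; ring)
  have e2 : ∀ y : Rˣ, ¬ (4 : R) ∣ (-1 : R) - y ^ 2 * p := by
    intro y h
    have hy := hsq y (by
      obtain ⟨x, hx⟩ := h
      rw [hp] at hx
      exact ⟨-1 - 2 * x - y ^ 2 * z, by linear_combination -hx⟩)
    refine not_four_dvd_two_mul h2u h20 hz1.neg ?_
    convert h.add (hy.mul_right p) using 1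
    rw [hp]; ring
  obtain ⟨ρ, a1, a2, a3, -, a4⟩ := exists_char_trivialMod (4 : R) p 1 (-1) (fun y ↦ by
    simpa using ⟨e1 y, e2 y, e1 y, e2 y⟩)
  exact ⟨ρ, a1, a2, a3, a4⟩

end Inert

end Dyadic

end IdeleClass

namespace IdeleClass

/-! ### Completions at finite places -/

section Completions

variable {F : Type*} [Field F] [NumberField F] {v : HeightOneSpectrum (𝓞 F)}

theorem valued_algebraMap (x : F) :
    Valued.v (algebraMap F (v.adicCompletion F) x) = v.valuation F x :=
  HeightOneSpectrum.valuedAdicCompletion_eq_valuation' v x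

theorem coe_algebraMap_integers (a : 𝓞 F) :
    ((algebraMap (𝓞 F) (v.adicCompletionIntegers F) a : v.adicCompletionIntegers F) :
      v.adicCompletion F) = algebraMap F (v.adicCompletion F) (a : F) := rfl

theorem valued_integer_le_iff (a : 𝓞 F) (n : ℕ) :
    Valued.v (algebraMap F (v.adicCompletion F) (a : F)) ≤ WithZero.exp (-(n : ℤ)) ↔
      a ∈ v.asIdeal ^ n := by
  rw [valued_algebraMap, ← HeightOneSpectrum.intValuation_le_pow_iff_mem]
  exact Iff.of_eq (congrArg (· ≤ _) (HeightOneSpectrum.valuation_of_algebraMap v a))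

/-- A uniformizer of the completion at `v`. -/
def IsUniformizer (ϖ : v.adicCompletionIntegers F) : Prop :=
  Valued.v (ϖ : v.adicCompletion F) = WithZero.exp (-1 : ℤ)

variable (v) in
theorem exists_isUniformizer : ∃ ϖ : v.adicCompletionIntegers F, IsUniformizer ϖ := by
  obtain ⟨x, hx⟩ := v.valuation_exists_uniformizer F
  have h : Valued.v (algebraMap F (v.adicCompletion F) x) = WithZero.exp (-1 : ℤ) := by
    rw [valued_algebraMap, hx]
  exact ⟨⟨algebraMap F (v.adicCompletion F) x, by
    rw [HeightOneSpectrum.mem_adicCompletionIntegers, h]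
    exact WithZero.exp_le_exp.2 (by norm_num : (-1 : ℤ) ≤ 0)⟩, h⟩

theorem IsUniformizer.valued_pow {ϖ : v.adicCompletionIntegers F} (hϖ : IsUniformizer ϖ) (n : ℕ) :
    Valued.v ((ϖ ^ n : v.adicCompletionIntegers F) : v.adicCompletion F) =
      WithZero.exp (-(n : ℤ)) := by
  rw [SubmonoidClass.coe_pow, map_pow, hϖ, ← WithZero.exp_nsmul]
  simp

theorem dvd_iff_valued_le {a b : v.adicCompletionIntegers F} :
    a ∣ b ↔ Valued.v (b : v.adicCompletion F) ≤ Valued.v (a : v.adicCompletion F) :=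
  (Valuation.Integers.dvd_iff_le (HeightOneSpectrum.adicCompletionIntegers.integers F v))

theorem IsUniformizer.pow_dvd_iff {ϖ : v.adicCompletionIntegers F} (hϖ : IsUniformizer ϖ) (n : ℕ)
    {r : v.adicCompletionIntegers F} :
    ϖ ^ n ∣ r ↔ Valued.v (r : v.adicCompletion F) ≤ WithZero.exp (-(n : ℤ)) := by
  rw [dvd_iff_valued_le, hϖ.valued_pow]

theorem IsUniformizer.not_isUnit {ϖ : v.adicCompletionIntegers F} (hϖ : IsUniformizer ϖ) :
    ¬ IsUnit ϖ := by
  rw [HeightOneSpectrum.adicCompletionIntegers.isUnit_iff_valued_eq_one, hϖ, ← WithZero.exp_zero,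
    WithZero.exp_inj]
  norm_num

theorem IsUniformizer.ne_zero {ϖ : v.adicCompletionIntegers F} (hϖ : IsUniformizer ϖ) : ϖ ≠ 0 := by
  rintro rfl
  exact WithZero.exp_ne_zero (hϖ.symm.trans (map_zero _))

theorem IsUniformizer.dvd_or_isUnit {ϖ : v.adicCompletionIntegers F} (hϖ : IsUniformizer ϖ)
    (r : v.adicCompletionIntegers F) : ϖ ∣ r ∨ IsUnit r := by
  rw [HeightOneSpectrum.adicCompletionIntegers.isUnit_iff_valued_eq_one, dvd_iff_valued_le, hϖ]
  rcases (show Valued.v (r : v.adicCompletion F) ≤ 1 from r.2).lt_or_eq with h | h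
  · left
    by_cases h0 : Valued.v (r : v.adicCompletion F) = 0
    · rw [h0]; exact zero_le
    · rw [← WithZero.log_le_iff_le_exp h0]
      have := (WithZero.log_lt_log h0 one_ne_zero).2 h
      rw [WithZero.log_one] at this
      omega
  · exact Or.inr h

theorem IsUniformizer.maximalIdeal_eq {ϖ : v.adicCompletionIntegers F} (hϖ : IsUniformizer ϖ) :
    IsLocalRing.maximalIdeal (v.adicCompletionIntegers F) = Ideal.span {ϖ} := by
  ext r
  rw [IsLocalRing.mem_maximalIdeal, Ideal.mem_span_singleton]
  exact ⟨(hϖ.dvd_or_isUnit r).resolve_right, fun h hr ↦ hϖ.not_isUnit (isUnit_of_dvd_unit h hr)⟩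

theorem IsUniformizer.isUnit_iff_not_dvd {ϖ : v.adicCompletionIntegers F}
    (hϖ : IsUniformizer ϖ) : ∀ r : v.adicCompletionIntegers F, IsUnit r ↔ ¬ ϖ ∣ r := fun r ↦
  ⟨fun hr h ↦ hϖ.not_isUnit (isUnit_of_dvd_unit h hr), (hϖ.dvd_or_isUnit r).resolve_left⟩

theorem exists_exp_neg_natCast_lt {g : WithZero (Multiplicative ℤ)} (hg : g ≠ 0) :
    ∃ n : ℕ, WithZero.exp (-(n : ℤ)) < g := by
  refine ⟨(1 - WithZero.log g).toNat, ?_⟩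
  rw [← WithZero.lt_log_iff_exp_lt hg]
  omega

theorem hasBasis_nhds_adicCompletion (x : v.adicCompletion F) :
    (nhds x).HasBasis (fun _ : ℕ ↦ True)
      fun n ↦ {y | Valued.v (y - x) ≤ WithZero.exp (-(n : ℤ))} := by
  rw [Filter.hasBasis_iff]
  intro s
  rw [Valued.mem_nhds]
  constructor
  · rintro ⟨γ, hγ⟩
    obtain ⟨n, hn⟩ := exists_exp_neg_natCast_lt
      (g := MonoidWithZeroHom.ValueGroup₀.embedding γ.1) (by simp)
    refine ⟨n, trivial, fun y hy ↦ hγ ?_⟩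
    rw [Set.mem_ofPred_eq, Valuation.restrict_lt_iff_lt_embedding]
    exact lt_of_le_of_lt hy hn
  · rintro ⟨n, -, hn⟩
    obtain ⟨ϖ, hϖ⟩ := exists_isUniformizer v
    refine ⟨Units.mk0 (Valued.v.restrict ((ϖ ^ n : v.adicCompletionIntegers F) :
      v.adicCompletion F)) ?_, fun y hy ↦ hn ?_⟩
    · rw [ne_eq, Valuation.restrict_eq_zero_iff, hϖ.valued_pow]
      exact WithZero.exp_ne_zero
    · rw [Set.mem_ofPred_eq, Units.val_mk0, Valuation.restrict_lt_iff, hϖ.valued_pow] at hy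
      exact hy.le

theorem exists_algebraMap_near (x : v.adicCompletion F) (n : ℕ) :
    ∃ k : F, Valued.v (algebraMap F (v.adicCompletion F) k - x) ≤ WithZero.exp (-(n : ℤ)) := by
  have hx := (HeightOneSpectrum.denseRange_algebraMap F v) x
  rw [mem_closure_iff_nhds_basis (hasBasis_nhds_adicCompletion x)] at hx
  obtain ⟨_, ⟨k, rfl⟩, hk⟩ := hx n trivial
  exact ⟨k, hk⟩

/-- The global integers are dense in the local integers. -/
theorem IsUniformizer.exists_algebraMap {ϖ : v.adicCompletionIntegers F} (hϖ : IsUniformizer ϖ)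
    (r : v.adicCompletionIntegers F) (N : ℕ) :
    ∃ a : 𝓞 F, ϖ ^ N ∣ algebraMap (𝓞 F) (v.adicCompletionIntegers F) a - r := by
  obtain ⟨k, hk⟩ := exists_algebraMap_near (r : v.adicCompletion F) N
  have hN : WithZero.exp (-(N : ℤ)) ≤ 1 := by
    rw [← WithZero.exp_zero]; exact WithZero.exp_le_exp.2 (by simp)
  have hk1 : v.valuation F k ≤ 1 := by
    rw [← valued_algebraMap]
    have := Valued.v.map_add (algebraMap F (v.adicCompletion F) k - r) r
    rw [sub_add_cancel] at this
    exact this.trans (max_le (hk.trans hN) r.2)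
  obtain ⟨a, ha⟩ := HeightOneSpectrum.exists_valuation_sub_lt_of_integer v hk1
    (Units.mk0 (WithZero.exp (-(N : ℤ))) WithZero.exp_ne_zero)
  refine ⟨a, (hϖ.pow_dvd_iff N).2 ?_⟩
  have h1 : ((algebraMap (𝓞 F) (v.adicCompletionIntegers F) a - r : v.adicCompletionIntegers F) :
      v.adicCompletion F) = algebraMap F (v.adicCompletion F) ((a : F) - k) +
        (algebraMap F (v.adicCompletion F) k - r) := by
    rw [map_sub]
    change algebraMap F (v.adicCompletion F) (a : F) - r = _
    ring
  rw [h1]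
  refine (Valued.v.map_add _ _).trans (max_le ?_ hk)
  rw [valued_algebraMap]
  exact ha.le

theorem IsUniformizer.pow_dvd_algebraMap_iff {ϖ : v.adicCompletionIntegers F}
    (hϖ : IsUniformizer ϖ) (N : ℕ) (a : 𝓞 F) :
    ϖ ^ N ∣ algebraMap (𝓞 F) (v.adicCompletionIntegers F) a ↔ a ∈ v.asIdeal ^ N := by
  rw [hϖ.pow_dvd_iff, ← valued_integer_le_iff]
  rfl

theorem IsUniformizer.dvd_algebraMap_iff {ϖ : v.adicCompletionIntegers F}
    (hϖ : IsUniformizer ϖ) (a : 𝓞 F) :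
    ϖ ∣ algebraMap (𝓞 F) (v.adicCompletionIntegers F) a ↔ a ∈ v.asIdeal := by
  simpa using hϖ.pow_dvd_algebraMap_iff 1 a

instance : Finite (IsLocalRing.ResidueField (v.adicCompletionIntegers F)) := by
  obtain ⟨ϖ, hϖ⟩ := exists_isUniformizer v
  have hf : Finite (𝓞 F ⧸ v.asIdeal) := v.asIdeal.finiteQuotientOfFreeOfNeBot v.ne_bot
  let f : 𝓞 F ⧸ v.asIdeal →+* IsLocalRing.ResidueField (v.adicCompletionIntegers F) :=
    Ideal.Quotient.lift v.asIdeal ((IsLocalRing.residue _).comp (algebraMap (𝓞 F) _)) (by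
      intro a ha
      rw [RingHom.comp_apply, IsLocalRing.residue_eq_zero_iff, hϖ.maximalIdeal_eq,
        Ideal.mem_span_singleton, hϖ.dvd_algebraMap_iff]
      exact ha)
  refine Finite.of_surjective f fun x ↦ ?_
  obtain ⟨r, rfl⟩ := IsLocalRing.residue_surjective x
  obtain ⟨a, ha⟩ := hϖ.exists_algebraMap r 1
  refine ⟨Ideal.Quotient.mk _ a, ?_⟩
  change IsLocalRing.residue _ (algebraMap (𝓞 F) _ a) = _
  rw [← sub_eq_zero, ← map_sub, IsLocalRing.residue_eq_zero_iff, hϖ.maximalIdeal_eq,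
    Ideal.mem_span_singleton]
  simpa using ha

end Completions
end IdeleClass

namespace IdeleClass

/-! ### Components of ideles -/

section IdeleComponents

variable {F : Type*} [Field F] [NumberField F]

/-- The units of the local integers as elements of the completion. -/
def intUnits (v : HeightOneSpectrum (𝓞 F)) :
    (v.adicCompletionIntegers F)ˣ →* (v.adicCompletion F)ˣ :=
  Units.map (v.adicCompletionIntegers F).subtype.toMonoidHom

theorem coe_intUnits (v : HeightOneSpectrum (𝓞 F)) (u : (v.adicCompletionIntegers F)ˣ) :
    (intUnits v u : v.adicCompletion F) = (u : v.adicCompletionIntegers F) := rfl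

theorem valued_coe_unit {v : HeightOneSpectrum (𝓞 F)} (u : (v.adicCompletionIntegers F)ˣ) :
    Valued.v ((u : v.adicCompletionIntegers F) : v.adicCompletion F) = 1 :=
  HeightOneSpectrum.adicCompletionIntegers.isUnit_iff_valued_eq_one.1 u.isUnit

theorem exists_intUnits_eq {v : HeightOneSpectrum (𝓞 F)} {x : (v.adicCompletion F)ˣ}
    (hx : Valued.v (x : v.adicCompletion F) = 1) : ∃ u, intUnits v u = x := by
  have h : IsUnit (⟨x, hx.le⟩ : v.adicCompletionIntegers F) :=
    HeightOneSpectrum.adicCompletionIntegers.isUnit_iff_valued_eq_one.2 hx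
  obtain ⟨u, hu⟩ := h
  exact ⟨u, Units.ext (congrArg Subtype.val hu)⟩

theorem intUnits_injective (v : HeightOneSpectrum (𝓞 F)) : Function.Injective (intUnits v) :=
  Units.map_injective Subtype.val_injective

/-- The finite component of an idele. -/
def finComp (v : HeightOneSpectrum (𝓞 F)) : IdeleGroup F →* (v.adicCompletion F)ˣ :=
  Units.map (((RestrictedProduct.evalRingHom
    (fun v : HeightOneSpectrum (𝓞 F) ↦ v.adicCompletion F) v).comp
      (RingHom.snd (InfiniteAdeleRing F) (FiniteAdeleRing (𝓞 F) F)) :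
        AdeleRing (𝓞 F) F →+* v.adicCompletion F) : AdeleRing (𝓞 F) F →* v.adicCompletion F)

/-- The infinite component of an idele. -/
def infPart : IdeleGroup F →* (InfiniteAdeleRing F)ˣ :=
  Units.map (MonoidHom.fst (InfiniteAdeleRing F) (FiniteAdeleRing (𝓞 F) F))

theorem idele_ext {x y : IdeleGroup F} (h : infPart x = infPart y)
    (h' : ∀ v, finComp v x = finComp v y) : x = y := by
  apply Units.ext
  refine Prod.ext (congrArg Units.val h) (FiniteAdeleRing.ext _ fun v ↦ congrArg Units.val (h' v))

/-- The ideles which are trivial at the finite places. -/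
def infIdele : (InfiniteAdeleRing F)ˣ →* IdeleGroup F :=
  Units.map (MonoidHom.inl (InfiniteAdeleRing F) (FiniteAdeleRing (𝓞 F) F))

@[simp] theorem infPart_infIdele (z : (InfiniteAdeleRing F)ˣ) : infPart (infIdele z) = z :=
  Units.ext rfl

@[simp] theorem finComp_infIdele (v : HeightOneSpectrum (𝓞 F)) (z : (InfiniteAdeleRing F)ˣ) :
    finComp v (infIdele z) = 1 := Units.ext rfl

/-- The inclusion of the product of the local integers in the adele ring, with component `1` at
the infinite places. -/
def integralAdele : (∀ v : HeightOneSpectrum (𝓞 F), v.adicCompletionIntegers F) →*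
    AdeleRing (𝓞 F) F where
  toFun x := ((1 : InfiniteAdeleRing F), (RestrictedProduct.structureMap
    (fun v : HeightOneSpectrum (𝓞 F) ↦ v.adicCompletion F)
    (fun v ↦ (v.adicCompletionIntegers F : Set (v.adicCompletion F))) Filter.cofinite x :
      FiniteAdeleRing (𝓞 F) F))
  map_one' := rfl
  map_mul' _ _ := Prod.ext (one_mul _).symm rfl

theorem continuous_integralAdele : Continuous (integralAdele (F := F)) :=
  continuous_const.prodMk RestrictedProduct.isEmbedding_structureMap.continuous

/-- The ideles which are units at all finite places, with component `1` at the infinite places. -/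
def unitIdele : (∀ v : HeightOneSpectrum (𝓞 F), (v.adicCompletionIntegers F)ˣ) →* IdeleGroup F :=
  (Units.map integralAdele).comp MulEquiv.piUnits.symm.toMonoidHom

@[simp] theorem infPart_unitIdele (y : ∀ v : HeightOneSpectrum (𝓞 F), (v.adicCompletionIntegers F)ˣ) :
    infPart (unitIdele y) = 1 := Units.ext rfl

@[simp] theorem finComp_unitIdele (v : HeightOneSpectrum (𝓞 F))
    (y : ∀ v : HeightOneSpectrum (𝓞 F), (v.adicCompletionIntegers F)ˣ) :
    finComp v (unitIdele y) = intUnits v (y v) := Units.ext rfl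

@[simp] theorem infPart_localIdele (v : HeightOneSpectrum (𝓞 F)) (x : (v.adicCompletion F)ˣ) :
    infPart (localIdele v x) = 1 := Units.ext rfl

@[simp] theorem finComp_localIdele_same (v : HeightOneSpectrum (𝓞 F)) (x : (v.adicCompletion F)ˣ) :
    finComp v (localIdele v x) = x := by
  classical
  apply Units.ext
  change RestrictedProduct.mulSingle (fun w : HeightOneSpectrum (𝓞 F) ↦
    w.adicCompletionIntegers F) v (x : v.adicCompletion F) v = x
  rw [RestrictedProduct.mulSingle_eq_same]

theorem finComp_localIdele_of_ne {v w : HeightOneSpectrum (𝓞 F)} (h : w ≠ v)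
    (x : (v.adicCompletion F)ˣ) : finComp w (localIdele v x) = 1 := by
  classical
  apply Units.ext
  change RestrictedProduct.mulSingle (fun w : HeightOneSpectrum (𝓞 F) ↦
    w.adicCompletionIntegers F) v (x : v.adicCompletion F) w = 1
  rw [RestrictedProduct.mulSingle_eq_of_ne _ _ h]

theorem infPart_principalIdele (a : Fˣ) :
    infPart (principalIdele F a) = Units.map (algebraMap F (InfiniteAdeleRing F) : F →* _) a :=
  Units.ext rfl

theorem finComp_principalIdele (v : HeightOneSpectrum (𝓞 F)) (a : Fˣ) :
    finComp v (principalIdele F a) = Units.map (algebraMap F (v.adicCompletion F) : F →* _) a :=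
  Units.ext rfl

/-- An idele which is a unit at all finite places. -/
theorem exists_unitIdele_eq {x : IdeleGroup F}
    (hx : ∀ v, Valued.v (finComp v x : v.adicCompletion F) = 1) :
    ∃ y, x = infIdele (infPart x) * unitIdele y ∧ ∀ v, intUnits v (y v) = finComp v x := by
  choose y hy using fun v ↦ exists_intUnits_eq (hx v)
  refine ⟨y, idele_ext (by simp) fun v ↦ by simp [hy], hy⟩

theorem coe_sub_one {v : HeightOneSpectrum (𝓞 F)} (r : v.adicCompletionIntegers F) :
    ((r - 1 : v.adicCompletionIntegers F) : v.adicCompletion F) = (r : v.adicCompletion F) - 1 := by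
  push_cast
  rfl

theorem valued_inv_sub_one {v : HeightOneSpectrum (𝓞 F)} (u : (v.adicCompletionIntegers F)ˣ) :
    Valued.v ((((u⁻¹ : (v.adicCompletionIntegers F)ˣ) : v.adicCompletionIntegers F) - 1 :
      v.adicCompletionIntegers F) : v.adicCompletion F) =
      Valued.v (((u : v.adicCompletionIntegers F) - 1 : v.adicCompletionIntegers F) :
        v.adicCompletion F) := by
  have h : ((u⁻¹ : (v.adicCompletionIntegers F)ˣ) : v.adicCompletionIntegers F) - 1 =
      - ((u⁻¹ : (v.adicCompletionIntegers F)ˣ) : v.adicCompletionIntegers F) *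
        ((u : v.adicCompletionIntegers F) - 1) := by
    linear_combination Units.inv_mul u
  rw [h, MulMemClass.coe_mul, map_mul, NegMemClass.coe_neg, Valuation.map_neg, valued_coe_unit,
    one_mul]

/-- A neighbourhood of `1` in the circle without `-1`. -/
theorem Circle.compl_neg_one_mem_nhds : ({-1}ᶜ : Set Circle) ∈ nhds (1 : Circle) :=
  isOpen_compl_singleton.mem_nhds fun h ↦ Circle.neg_one_ne_one h.symm

variable (χ : IdeleClassChar F)

/-- The restriction of `χ_v` to the units of the local integers. -/
def unitComponent (v : HeightOneSpectrum (𝓞 F)) : (v.adicCompletionIntegers F)ˣ →* Circle :=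
  (localComponent χ v).comp (intUnits v)

variable {χ}

/-- Since χ takes only the values ±1, its kernel is the preimage of the open set `{-1}ᶜ`, hence
open. A neighbourhood of 1 in the product of the local integer rings restricts only finitely many
places, each to finite precision. -/
theorem exists_forall_unitIdele_eq_one (hχ : ∀ x, χ.1 x ^ 2 = 1) :
    ∃ (T : Finset (HeightOneSpectrum (𝓞 F))) (N : ℕ),
      ∀ y : ∀ v : HeightOneSpectrum (𝓞 F), (v.adicCompletionIntegers F)ˣ,
      (∀ v ∈ T, Valued.v (((y v : v.adicCompletionIntegers F) - 1 : v.adicCompletionIntegers F) :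
        v.adicCompletion F) ≤
        WithZero.exp (-(N : ℤ))) → χ.1 (unitIdele y) = 1 := by
  have hV : χ.1 ⁻¹' {-1}ᶜ ∈ nhds (1 : IdeleGroup F) :=
    χ.1.continuous_toFun.continuousAt.preimage_mem_nhds (by
      rw [show χ.1.toFun 1 = 1 from map_one χ.1]; exact Circle.compl_neg_one_mem_nhds)
  -- In the topology of the unit group both y and its inverse must be near 1; `valued_inv_sub_one`
  -- lets one bound serve for both.
  rw [Units.isInducing_embedProduct.nhds_eq_comap, Filter.mem_comap] at hV
  obtain ⟨t, ht, htV⟩ := hV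
  rw [map_one, Prod.one_eq_mk, nhds_prod_eq, Filter.mem_prod_iff] at ht
  obtain ⟨A₁, hA₁, A₂, hA₂, hA⟩ := ht
  have hA₂' : MulOpposite.op ⁻¹' A₂ ∈ nhds (1 : AdeleRing (𝓞 F) F) :=
    MulOpposite.continuous_op.continuousAt.preimage_mem_nhds hA₂
  have h1 : integralAdele ⁻¹' (A₁ ∩ MulOpposite.op ⁻¹' A₂) ∈
      nhds (1 : ∀ v : HeightOneSpectrum (𝓞 F), v.adicCompletionIntegers F) :=
    continuous_integralAdele.continuousAt.preimage_mem_nhds (by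
      rw [map_one]; exact Filter.inter_mem hA₁ hA₂')
  rw [nhds_pi, Filter.mem_pi] at h1
  obtain ⟨I, hI, s, hs, hIs⟩ := h1
  have hn : ∀ v, ∃ n : ℕ, ∀ r : v.adicCompletionIntegers F,
      Valued.v ((r - 1 : v.adicCompletionIntegers F) : v.adicCompletion F) ≤ WithZero.exp (-(n : ℤ)) → r ∈ s v := by
    intro v
    have hsv := hs v
    rw [Pi.one_apply, nhds_subtype_eq_comap, Filter.mem_comap] at hsv
    obtain ⟨t, ht, hts⟩ := hsv
    obtain ⟨n, -, hn⟩ := (hasBasis_nhds_adicCompletion _).mem_iff.1 ht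
    refine ⟨n, fun r hr ↦ hts (hn ?_)⟩
    rw [coe_sub_one] at hr
    exact hr
  choose n hn using hn
  refine ⟨hI.toFinset, hI.toFinset.sup n, fun y hy ↦ ?_⟩
  have hle : ∀ v ∈ I, Valued.v (((y v : v.adicCompletionIntegers F) - 1 :
      v.adicCompletionIntegers F) : v.adicCompletion F) ≤ WithZero.exp (-(n v : ℤ)) := fun v hv ↦ by
    refine (hy v (hI.mem_toFinset.2 hv)).trans (WithZero.exp_le_exp.2 ?_)
    have := Finset.le_sup (f := n) (hI.mem_toFinset.2 hv)
    omega
  have m1 : integralAdele (fun v ↦ (y v : v.adicCompletionIntegers F)) ∈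
      A₁ ∩ MulOpposite.op ⁻¹' A₂ := hIs fun v hv ↦ hn v _ (hle v hv)
  have m2 : integralAdele
      (fun v ↦ ((y v)⁻¹ : (v.adicCompletionIntegers F)ˣ).val) ∈
      A₁ ∩ MulOpposite.op ⁻¹' A₂ := hIs fun v hv ↦ hn v _ (by
        rw [valued_inv_sub_one]; exact hle v hv)
  have m3 : unitIdele y ∈ χ.1 ⁻¹' {-1}ᶜ := htV (hA ⟨m1.1, m2.2⟩)
  exact (Circle.sq_eq_one_iff.1 (hχ _)).resolve_right m3

theorem unitIdele_mulSingle [DecidableEq (HeightOneSpectrum (𝓞 F))] (v : HeightOneSpectrum (𝓞 F))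
    (u : (v.adicCompletionIntegers F)ˣ) :
    unitIdele (Pi.mulSingle v u) = localIdele v (intUnits v u) := by
  refine idele_ext (by simp) fun w ↦ ?_
  rw [finComp_unitIdele]
  rcases eq_or_ne w v with rfl | h
  · simp
  · rw [Pi.mulSingle_eq_of_ne h, map_one, finComp_localIdele_of_ne h]

theorem exists_trivialMod_unitComponent (hχ : ∀ x, χ.1 x ^ 2 = 1) (v : HeightOneSpectrum (𝓞 F))
    {ϖ : v.adicCompletionIntegers F} (hϖ : IsUniformizer ϖ) :
    ∃ N : ℕ, TrivialMod (unitComponent χ v) (ϖ ^ N) := by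
  classical
  obtain ⟨T, N, h⟩ := exists_forall_unitIdele_eq_one hχ
  refine ⟨N, fun u hu ↦ ?_⟩
  change χ.1 (localIdele v (intUnits v u)) = 1
  rw [← unitIdele_mulSingle]
  refine h _ fun w _ ↦ ?_
  rcases eq_or_ne w v with rfl | hw
  · rw [Pi.mulSingle_eq_same]
    exact (hϖ.pow_dvd_iff N).1 hu
  · rw [Pi.mulSingle_eq_of_ne hw]
    simp

/-- A quadratic character is unramified outside a finite set, and is the product of its local
components on the unit ideles. -/
theorem exists_finset_unitComponent (hχ : ∀ x, χ.1 x ^ 2 = 1) :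
    ∃ T : Finset (HeightOneSpectrum (𝓞 F)), (∀ v ∉ T, unitComponent χ v = 1) ∧
      ∀ T', T ⊆ T' → ∀ y, χ.1 (unitIdele y) = ∏ v ∈ T', unitComponent χ v (y v) := by
  classical
  obtain ⟨T, N, h⟩ := exists_forall_unitIdele_eq_one hχ
  refine ⟨T, fun v hv ↦ ?_, fun T' hT y ↦ ?_⟩
  · ext1 u
    change χ.1 (localIdele v (intUnits v u)) = 1
    rw [← unitIdele_mulSingle]
    refine h _ fun w hw ↦ ?_
    rw [Pi.mulSingle_eq_of_ne (by rintro rfl; exact hv hw)]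
    simp
  -- Dividing y by its components at T' leaves an idele that is 1 at the places of T, where χ is
  -- trivial.
  · have h1 : χ.1 (unitIdele (y * (∏ v ∈ T', Pi.mulSingle v (y v))⁻¹)) = 1 := by
      refine h _ fun w hw ↦ ?_
      rw [Pi.mul_apply, Pi.inv_apply, Finset.prod_apply,
        Finset.prod_eq_single_of_mem w (hT hw)
          (fun v _ hv ↦ Pi.mulSingle_eq_of_ne hv.symm _)]
      simp
    rw [map_mul, map_mul, map_inv, map_inv, mul_inv_eq_one] at h1
    rw [h1, map_prod, map_prod]
    exact Finset.prod_congr rfl fun v _ ↦ by rw [unitIdele_mulSingle]; rfl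

theorem conductorExponent_eq (v : HeightOneSpectrum (𝓞 F)) {ϖ : v.adicCompletionIntegers F}
    (hϖ : IsUniformizer ϖ) :
    conductorExponent χ v = sInf {n : ℕ | TrivialMod (unitComponent χ v) (ϖ ^ n)} := by
  unfold conductorExponent
  congr 1
  ext n
  constructor
  · intro h u hu
    refine h (intUnits v u) (valued_coe_unit u) ?_
    rw [coe_intUnits, ← coe_sub_one]
    exact (hϖ.pow_dvd_iff n).1 hu
  · intro h u hu1 hu2
    obtain ⟨u, rfl⟩ := exists_intUnits_eq hu1
    rw [coe_intUnits, ← coe_sub_one] at hu2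
    exact h u ((hϖ.pow_dvd_iff n).2 hu2)

end IdeleComponents

end IdeleClass

namespace IdeleClass

/-! ### Extension and uniqueness of quadratic characters for odd class number -/

section Extension

variable {F : Type*} [Field F] [NumberField F]

theorem isPrincipal_pow_classNumber (I : Ideal (𝓞 F)) (hI : I ≠ ⊥) :
    (I ^ classNumber F).IsPrincipal := by
  have h0 : I ^ classNumber F ≠ ⊥ := pow_ne_zero _ hI
  have h := pow_card_eq_one (G := ClassGroup (𝓞 F))
    (x := ClassGroup.mk0 ⟨I, mem_nonZeroDivisors_of_ne_zero hI⟩)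
  rw [← map_pow] at h
  exact (ClassGroup.mk0_eq_one_iff (I := I ^ classNumber F) (mem_nonZeroDivisors_of_ne_zero h0)).1 h

theorem asIdeal_eq_of_le {v w : HeightOneSpectrum (𝓞 F)} (h : v.asIdeal ≤ w.asIdeal) : v = w :=
  HeightOneSpectrum.ext (v.isMaximal.eq_of_le w.isPrime.ne_top h)

/-- The ideal v^h is principal, h being the class number, and a generator serves as a global
substitute for the h-th power of a uniformizer. -/
theorem exists_valuation_eq_exp_classNumber (v : HeightOneSpectrum (𝓞 F)) :
    ∃ g : Fˣ, v.valuation F (g : F) = WithZero.exp (-(classNumber F : ℤ)) ∧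
      ∀ w ≠ v, w.valuation F (g : F) = 1 := by
  obtain ⟨a, ha⟩ := isPrincipal_pow_classNumber v.asIdeal v.ne_bot
  have ha : v.asIdeal ^ classNumber F = Ideal.span {a} := ha
  have ha0 : a ≠ 0 := by
    rintro rfl
    rw [Ideal.span_singleton_eq_bot.2 rfl] at ha
    exact pow_ne_zero _ v.ne_bot ha
  refine ⟨Units.mk0 (a : F) (by simpa using ha0), ?_, fun w hw ↦ ?_⟩
  · rw [Units.val_mk0]
    refine (HeightOneSpectrum.valuation_of_algebraMap v a).trans ?_
    rw [v.intValuation_eq_exp_neg_multiplicity ha0, ← ha,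
      multiplicity_pow_self_of_prime v.prime]
  · refine (HeightOneSpectrum.valuation_eq_one_iff_notMem (K := F) w).2 fun h ↦ hw ?_
    refine (asIdeal_eq_of_le ?_).symm
    have h1 : v.asIdeal ^ classNumber F ≤ w.asIdeal := by
      rw [ha, Ideal.span_singleton_le_iff_mem]
      exact h
    exact w.isPrime.le_of_pow_le h1

/-- The `h`-th power of an idele is a principal idele times an idele which is a unit at all finite
places, where `h` is the class number. -/
theorem exists_principalIdele_mul (x : IdeleGroup F) :
    ∃ (a : Fˣ) (w : IdeleGroup F), x ^ classNumber F = principalIdele F a * w ∧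
      ∀ v, Valued.v (finComp v w : v.adicCompletion F) = 1 := by
  classical
  choose g hg hg' using exists_valuation_eq_exp_classNumber (F := F)
  have hfin : {v | ¬ Valued.v (finComp v x : v.adicCompletion F) = 1}.Finite := by
    have h1 : {v | ¬ (finComp v x : v.adicCompletion F) ∈ v.adicCompletionIntegers F}.Finite :=
      (x : AdeleRing (𝓞 F) F).2.2
    have h2 : {v | ¬ (finComp v x⁻¹ : v.adicCompletion F) ∈ v.adicCompletionIntegers F}.Finite :=
      ((x⁻¹ : IdeleGroup F) : AdeleRing (𝓞 F) F).2.2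
    refine (h1.union h2).subset fun v hv ↦ ?_
    by_contra hc
    rw [Set.mem_union, not_or, Set.mem_ofPred_eq, Set.mem_ofPred_eq, not_not, not_not] at hc
    refine hv (le_antisymm hc.1 ?_)
    have h3 : Valued.v (finComp v x⁻¹ : v.adicCompletion F) ≤ 1 := hc.2
    have h4 : Valued.v (finComp v x : v.adicCompletion F) *
        Valued.v (finComp v x⁻¹ : v.adicCompletion F) = 1 := by
      rw [← map_mul, ← Units.val_mul, ← map_mul, mul_inv_cancel, map_one, Units.val_one, map_one]
    rw [← h4]
    exact mul_le_of_le_one_right' h3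
  -- n v is the order of x at v, zero outside a finite set, so the product of the powers `g v ^ n v`
  -- has the same valuations as x^h.
  let n : HeightOneSpectrum (𝓞 F) → ℤ := fun v ↦ -WithZero.log (Valued.v
    (finComp v x : v.adicCompletion F))
  let a : Fˣ := ∏ v ∈ hfin.toFinset, g v ^ n v
  refine ⟨a, x ^ classNumber F * (principalIdele F a)⁻¹, by rw [mul_comm, inv_mul_cancel_right],
    fun w ↦ ?_⟩
  have hxw : Valued.v (finComp w x : w.adicCompletion F) ≠ 0 := by simp
  have hxn : Valued.v (finComp w x : w.adicCompletion F) = WithZero.exp (-n w) := by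
    rw [neg_neg, WithZero.exp_log hxw]
  have haw : w.valuation F (a : F) = WithZero.exp (-(classNumber F * n w : ℤ)) := by
    have h1 : ∀ v, w.valuation F ((g v ^ n v : Fˣ) : F) =
        if v = w then WithZero.exp (-(classNumber F * n w : ℤ)) else 1 := by
      intro v
      rw [Units.val_zpow_eq_zpow_val, map_zpow₀]
      split_ifs with h
      · subst h
        rw [hg, ← WithZero.exp_zsmul]
        congr 1
        simp [mul_comm]
      · rw [hg' v w (Ne.symm h), one_zpow]
    rw [Units.coe_prod, map_prod, Finset.prod_congr rfl fun v _ ↦ h1 v, Finset.prod_ite_eq']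
    split_ifs with h
    · rfl
    · rw [hfin.mem_toFinset, Set.mem_ofPred_eq, not_not] at h
      have : n w = 0 := by simp only [n, h, WithZero.log_one, neg_zero]
      rw [this, mul_zero, neg_zero, WithZero.exp_zero]
  rw [map_mul, map_pow, map_inv, finComp_principalIdele, Units.val_mul, map_mul,
    Units.val_pow_eq_pow_val, map_pow, hxn, Units.val_inv_eq_inv_val, map_inv₀]
  have h5 : Valued.v ((Units.map (algebraMap F (w.adicCompletion F) : F →* _) a :
      (w.adicCompletion F)ˣ) : w.adicCompletion F) =
      WithZero.exp (-(classNumber F * n w : ℤ)) := by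
    rw [← haw, ← valued_algebraMap]; rfl
  rw [h5, ← WithZero.exp_nsmul, ← WithZero.exp_neg, ← WithZero.exp_add, ← WithZero.exp_zero]
  congr 1
  simp

theorem exists_unit_of_valuation_eq_one {a : Fˣ}
    (h : ∀ v : HeightOneSpectrum (𝓞 F), v.valuation F (a : F) = 1) :
    ∃ u : (𝓞 F)ˣ, ((u : 𝓞 F) : F) = a := by
  obtain ⟨x, hx⟩ := HeightOneSpectrum.mem_integers_of_valuation_le_one F (a : F) fun v ↦ (h v).le
  obtain ⟨y, hy⟩ := HeightOneSpectrum.mem_integers_of_valuation_le_one (R := 𝓞 F) F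
    ((a⁻¹ : Fˣ) : F) fun v ↦ by
      rw [Units.val_inv_eq_inv_val, map_inv₀, h v, inv_one]
  have hxy : x * y = 1 := by
    apply FaithfulSMul.algebraMap_injective (𝓞 F) F
    rw [map_mul, hx, hy, Units.mul_inv, map_one]
  exact ⟨⟨x, y, hxy, by rw [mul_comm, hxy]⟩, hx⟩

/-- The ideles which are units at the finite places, and are `1` modulo `v ^ N` for `v` in a finite
set, form a neighbourhood of `1`. -/
theorem eventually_valued_finComp (T : Finset (HeightOneSpectrum (𝓞 F)))
    (N : HeightOneSpectrum (𝓞 F) → ℕ) :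
    ∀ᶠ x : IdeleGroup F in nhds 1, ∀ v,
      Valued.v (finComp v x : v.adicCompletion F) = 1 ∧ (v ∈ T →
        Valued.v ((finComp v x : v.adicCompletion F) - 1) ≤ WithZero.exp (-(N v : ℤ))) := by
  have hopen : ∀ v : HeightOneSpectrum (𝓞 F),
      IsOpen (v.adicCompletionIntegers F : Set (v.adicCompletion F)) :=
    fun v ↦ Valued.isOpen_valuationSubring _
  have h1 : ∀ᶠ y : AdeleRing (𝓞 F) F in nhds 1, ∀ v, y.2 v ∈ v.adicCompletionIntegers F := by
    have hU : IsOpen {y : FiniteAdeleRing (𝓞 F) F | ∀ v, y v ∈ v.adicCompletionIntegers F} :=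
      RestrictedProduct.isOpen_forall_mem hopen
    have h0 := hU.mem_nhds (x := 1) fun v ↦ one_mem _
    have hc : Continuous fun y : AdeleRing (𝓞 F) F ↦ y.2 := continuous_snd
    exact (hc.tendsto 1).eventually h0
  have h2 : ∀ᶠ y : AdeleRing (𝓞 F) F in nhds 1, ∀ v ∈ T,
      Valued.v (y.2 v - 1) ≤ WithZero.exp (-(N v : ℤ)) := by
    rw [Filter.eventually_all_finset]
    intro v _
    have hc : Continuous fun y : AdeleRing (𝓞 F) F ↦ y.2 v :=
      (RestrictedProduct.continuous_eval v).comp continuous_snd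
    exact (hc.tendsto 1).eventually ((hasBasis_nhds_adicCompletion 1).mem_of_mem (i := N v) trivial)
  have c1 : Filter.Tendsto (fun x : IdeleGroup F ↦ (x : AdeleRing (𝓞 F) F)) (nhds 1) (nhds 1) :=
    Units.continuous_val.continuousAt
  have c2 : Filter.Tendsto (fun x : IdeleGroup F ↦ ((x⁻¹ : IdeleGroup F) : AdeleRing (𝓞 F) F))
      (nhds 1) (nhds 1) := by
    have := (Units.continuous_val (M := AdeleRing (𝓞 F) F)).comp
      (continuous_inv (G := IdeleGroup F))
    have := this.tendsto 1
    rw [Function.comp_apply, inv_one, Units.val_one] at this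
    exact this
  filter_upwards [c1.eventually h1, c2.eventually h1, c1.eventually h2] with x hx1 hx2 hx3 v
  refine ⟨le_antisymm (hx1 v) ?_, hx3 v⟩
  have h3 : Valued.v (finComp v x⁻¹ : v.adicCompletion F) ≤ 1 := hx2 v
  have h4 : Valued.v (finComp v x : v.adicCompletion F) *
      Valued.v (finComp v x⁻¹ : v.adicCompletion F) = 1 := by
    rw [← map_mul, ← Units.val_mul, ← map_mul, mul_inv_cancel, map_one, Units.val_one, map_one]
  rw [← h4]
  exact mul_le_of_le_one_right' h3

/-- The projection of `F_vˣ` to the units, given by a uniformizer. -/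
theorem exists_unitProj (v : HeightOneSpectrum (𝓞 F)) :
    ∃ f : (v.adicCompletion F)ˣ →* (v.adicCompletionIntegers F)ˣ, ∀ u, f (intUnits v u) = u := by
  obtain ⟨ϖ, hϖ⟩ := exists_isUniformizer v
  let p : (v.adicCompletion F)ˣ := Units.mk0 ϖ (by simpa using hϖ.ne_zero)
  have hp : Valued.v (p : v.adicCompletion F) = WithZero.exp (-1 : ℤ) := hϖ
  let n : (v.adicCompletion F)ˣ → ℤ := fun x ↦ WithZero.log (Valued.v (x : v.adicCompletion F))
  have hn : ∀ x y, n (x * y) = n x + n y := fun x y ↦ by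
    simp only [n]
    rw [Units.val_mul, map_mul, WithZero.log_mul (by simp) (by simp)]
  have h1 : ∀ x : (v.adicCompletion F)ˣ,
      Valued.v ((x * p ^ n x : (v.adicCompletion F)ˣ) : v.adicCompletion F) = 1 := by
    intro x
    rw [Units.val_mul, map_mul, Units.val_zpow_eq_zpow_val, map_zpow₀, hp, ← WithZero.exp_zsmul,
      ← WithZero.exp_log (x := Valued.v (x : v.adicCompletion F)) (by simp), ← WithZero.exp_add,
      ← WithZero.exp_zero]
    congr 1
    simp [n]
  choose f hf using fun x ↦ exists_intUnits_eq (h1 x)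
  refine ⟨MonoidHom.mk' f fun x y ↦ intUnits_injective v ?_, fun u ↦ intUnits_injective v ?_⟩
  · rw [map_mul, hf, hf, hf, hn, zpow_add, mul_mul_mul_comm]
  · change intUnits v (f (intUnits v u)) = _
    rw [hf]
    have : n (intUnits v u) = 0 := by
      simp only [n]
      rw [coe_intUnits, valued_coe_unit, WithZero.log_one]
    rw [this, zpow_zero, mul_one]

theorem finComp_units {u : (𝓞 F)ˣ} (v : HeightOneSpectrum (𝓞 F)) :
    finComp v (principalIdele F (Units.map (algebraMap (𝓞 F) F : 𝓞 F →* F) u)) =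
      intUnits v (Units.map (algebraMap (𝓞 F) (v.adicCompletionIntegers F) : 𝓞 F →* _) u) :=
  Units.ext rfl

/-- Construction of quadratic idele class characters from local characters of the units, for
number fields of odd class number. -/
theorem exists_ideleClassChar (hodd : Odd (classNumber F))
    (T : Finset (HeightOneSpectrum (𝓞 F))) (φ₀ : (InfiniteAdeleRing F)ˣ →* Circle)
    (hφ₀ : ∀ z, φ₀ z ^ 2 = 1) (hc₀ : Continuous φ₀)
    (φ : ∀ v : HeightOneSpectrum (𝓞 F), (v.adicCompletionIntegers F)ˣ →* Circle)
    (hφ : ∀ v u, φ v u ^ 2 = 1)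
    (hlevel : ∀ v, ∃ ϖ : v.adicCompletionIntegers F, IsUniformizer ϖ ∧
      ∃ N : ℕ, TrivialMod (φ v) (ϖ ^ N))
    (hglob : ∀ u : (𝓞 F)ˣ,
      φ₀ (Units.map ((algebraMap F (InfiniteAdeleRing F)).comp (algebraMap (𝓞 F) F) :
        𝓞 F →+* InfiniteAdeleRing F).toMonoidHom u) *
      ∏ v ∈ T, φ v (Units.map (algebraMap (𝓞 F) (v.adicCompletionIntegers F) : 𝓞 F →* _) u) = 1) :
    ∃ χ : IdeleClassChar F, (∀ x, χ.1 x ^ 2 = 1) ∧ (∀ v ∈ T, unitComponent χ v = φ v) ∧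
      (∀ v ∉ T, unitComponent χ v = 1) ∧ ∀ z, χ.1 (infIdele z) = φ₀ z := by
  classical
  choose f hf using exists_unitProj (F := F)
  -- Φ depends on the chosen projections `f v`, but not on the set W of ideles that are units at all
  -- finite places, and χ is built from values on W only.
  let Φ : IdeleGroup F →* Circle :=
    φ₀.comp infPart * ∏ v ∈ T, (φ v).comp ((f v).comp (finComp v))
  have hΦ : ∀ x, Φ x = φ₀ (infPart x) * ∏ v ∈ T, φ v (f v (finComp v x)) := fun x ↦ by
    simp [Φ, MonoidHom.mul_apply]
  have hΦ2 : ∀ x, Φ x ^ 2 = 1 := fun x ↦ by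
    rw [hΦ, mul_pow, hφ₀, one_mul, ← Finset.prod_pow, Finset.prod_congr rfl fun v _ ↦ hφ v _,
      Finset.prod_const_one]
  have hΦodd : ∀ x, Φ x ^ classNumber F = Φ x := fun x ↦ by
    obtain ⟨k, hk⟩ := hodd
    rw [hk, pow_succ, pow_mul, hΦ2, one_pow, one_mul]
  let W : IdeleGroup F → Prop := fun w ↦ ∀ v, Valued.v (finComp v w : v.adicCompletion F) = 1
  have hW1 : W 1 := fun v ↦ by simp
  have hWmul : ∀ x y, W x → W y → W (x * y) := fun x y hx hy v ↦ by
    rw [map_mul, Units.val_mul, map_mul, hx v, hy v, one_mul]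
  have hWinv : ∀ x, W x → W x⁻¹ := fun x hx v ↦ by
    rw [map_inv, Units.val_inv_eq_inv_val, map_inv₀, hx v, inv_one]
  have hprin : ∀ a : Fˣ, W (principalIdele F a) → Φ (principalIdele F a) = 1 := by
    intro a ha
    obtain ⟨u, hu⟩ := exists_unit_of_valuation_eq_one (a := a) fun v ↦ by
      rw [← valued_algebraMap]; exact ha v
    obtain rfl : a = Units.map (algebraMap (𝓞 F) F : 𝓞 F →* F) u := Units.ext hu.symm
    rw [hΦ, ← hglob u]
    refine congrArg₂ (· * ·) (congrArg φ₀ (Units.ext rfl)) (Finset.prod_congr rfl fun v _ ↦ ?_)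
    rw [finComp_units, hf]
  have huniq : ∀ a b : Fˣ, ∀ w w' : IdeleGroup F, W w → W w' →
      principalIdele F a * w = principalIdele F b * w' → Φ w = Φ w' := by
    intro a b w w' hw hw' h
    have h1 : principalIdele F (a * b⁻¹) = w' * w⁻¹ := by
      rw [map_mul, map_inv, eq_mul_inv_iff_mul_eq, mul_right_comm, h, mul_right_comm,
        mul_inv_cancel, one_mul]
    have h2 := hprin (a * b⁻¹) (by rw [h1]; exact hWmul _ _ hw' (hWinv _ hw))
    rw [h1, map_mul, map_inv, mul_inv_eq_one] at h2
    exact h2.symm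
  choose a w hx hw using exists_principalIdele_mul (F := F)
  have hval : ∀ (x y : IdeleGroup F) (b : Fˣ), W y → x ^ classNumber F = principalIdele F b * y →
      Φ (w x) = Φ y := fun x y b hy h ↦ huniq (a x) b _ _ (hw x) hy ((hx x).symm.trans h)
  -- With x^h = a · w(x) and w(x) in W, the value Φ(w(x)) does not depend on the decomposition, by
  -- `huniq`. Since h is odd and Φ takes values ±1, the result agrees with Φ on W.
  let χ : IdeleGroup F →* Circle := MonoidHom.mk' (fun x ↦ Φ (w x)) fun x y ↦ by
    rw [hval (x * y) (w x * w y) (a x * a y) (hWmul _ _ (hw x) (hw y)) (by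
      rw [mul_pow, hx x, hx y, map_mul, mul_mul_mul_comm]), map_mul]
  have hχW : ∀ x, W x → χ x = Φ x := by
    intro x hx'
    have : W (x ^ classNumber F) := fun v ↦ by
      rw [map_pow, Units.val_pow_eq_pow_val, map_pow, hx' v, one_pow]
    change Φ (w x) = _
    rw [hval x (x ^ classNumber F) 1 this (by rw [map_one, one_mul]), map_pow, hΦodd]
  have hcont : Continuous χ := by
    refine continuous_of_continuousAt_one χ ?_
    choose ϖ hϖ N hN using hlevel
    have e1 := eventually_valued_finComp T N
    have e2 : ∀ᶠ x : IdeleGroup F in nhds 1, φ₀ (infPart x) ∈ ({-1}ᶜ : Set Circle) := by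
      have hc : Continuous fun x : IdeleGroup F ↦ φ₀ (infPart x) :=
        hc₀.comp (Continuous.units_map _ continuous_fst)
      refine hc.continuousAt.preimage_mem_nhds ?_
      rw [map_one, map_one]
      exact Circle.compl_neg_one_mem_nhds
    have e3 : ∀ᶠ x : IdeleGroup F in nhds 1, χ x = 1 := by
      filter_upwards [e1, e2] with x hx1 hx2
      rw [hχW x fun v ↦ (hx1 v).1, hΦ, (Circle.sq_eq_one_iff.1 (hφ₀ _)).resolve_right hx2, one_mul]
      refine Finset.prod_eq_one fun v hv ↦ ?_
      obtain ⟨u, hu⟩ := exists_intUnits_eq (hx1 v).1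
      rw [← hu, hf]
      refine hN v u (((hϖ v).pow_dvd_iff _).2 ?_)
      rw [coe_sub_one, ← coe_intUnits, hu]
      exact (hx1 v).2 hv
    rw [ContinuousAt, map_one]
    exact tendsto_const_nhds.congr' (e3.mono fun x hx ↦ hx.symm)
  let χ' : IdeleClassChar F := ⟨⟨χ, hcont⟩, fun b ↦ by
    change Φ (w (principalIdele F b)) = 1
    rw [hval _ 1 (b ^ classNumber F) hW1 (by rw [map_pow, mul_one]), map_one]⟩
  have hloc : ∀ v u, unitComponent χ' v u = Φ (localIdele v (intUnits v u)) := by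
    intro v u
    refine hχW _ fun v' ↦ ?_
    rcases eq_or_ne v' v with rfl | h
    · rw [finComp_localIdele_same, coe_intUnits, valued_coe_unit]
    · rw [finComp_localIdele_of_ne h, Units.val_one, map_one]
  refine ⟨χ', fun x ↦ hΦ2 _, fun v hv ↦ ?_, fun v hv ↦ ?_, fun z ↦ ?_⟩
  · ext1 u
    rw [hloc, hΦ, infPart_localIdele, map_one, one_mul, Finset.prod_eq_single_of_mem v hv,
      finComp_localIdele_same, hf]
    intro v' _ h
    rw [finComp_localIdele_of_ne h, map_one, map_one]
  · ext1 u
    rw [hloc, hΦ, infPart_localIdele, map_one, one_mul, MonoidHom.one_apply]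
    refine Finset.prod_eq_one fun v' hv' ↦ ?_
    rw [finComp_localIdele_of_ne (by rintro rfl; exact hv hv'), map_one, map_one]
  · refine (hχW _ fun v ↦ by simp).trans ?_
    rw [hΦ, infPart_infIdele]
    simp

/-- A quadratic character which is trivial at the infinite places and unramified is trivial if the
class number is odd. -/
theorem eq_one_of_unitComponent (hodd : Odd (classNumber F)) {χ : IdeleClassChar F}
    (hχ : ∀ x, χ.1 x ^ 2 = 1) (hinf : ∀ z, χ.1 (infIdele z) = 1)
    (hloc : ∀ v, unitComponent χ v = 1) (x : IdeleGroup F) : χ.1 x = 1 := by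
  obtain ⟨T, -, hT⟩ := exists_finset_unitComponent hχ
  obtain ⟨a, w, hx, hw⟩ := exists_principalIdele_mul x
  obtain ⟨y, hy, -⟩ := exists_unitIdele_eq hw
  have h1 : χ.1 x ^ classNumber F = 1 := by
    rw [← map_pow, hx, hy, map_mul, map_mul, χ.2, hinf, hT T subset_rfl]
    simp [hloc]
  obtain ⟨k, hk⟩ := hodd
  rwa [hk, pow_succ, pow_mul, hχ, one_pow, one_mul] at h1

end Extension

end IdeleClass

namespace IdeleClass

/-! ### Local fields: extension of embeddings, valuations and approximation -/

section LocalMaps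

variable {K L M : Type*} [Field K] [NumberField K] [Field L] [NumberField L] [Field M]
  [NumberField M]

/-- The extension by continuity `K_v → L_w` of `f : K → L`, for a place `w` above `v`. -/
def localMapOver (f : K →+* L) {v : HeightOneSpectrum (𝓞 K)} {w : HeightOneSpectrum (𝓞 L)}
    (h : placeBelow f w = v) : v.adicCompletion K →+* w.adicCompletion L := by
  subst h
  exact finiteLocalMap f w

theorem finiteLocalMap_apply_eq (f : K →+* L) {v : HeightOneSpectrum (𝓞 K)}
    {w : HeightOneSpectrum (𝓞 L)} (h : placeBelow f w = v)
    (x : ∀ v : HeightOneSpectrum (𝓞 K), v.adicCompletion K) :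
    finiteLocalMap f w (x _) = localMapOver f h (x v) := by
  subst h
  rfl

variable {f : K →+* L} {v : HeightOneSpectrum (𝓞 K)} {w : HeightOneSpectrum (𝓞 L)}

theorem localMapOver_algebraMap (h : placeBelow f w = v) (k : K) :
    localMapOver f h (algebraMap K (v.adicCompletion K) k) =
      algebraMap L (w.adicCompletion L) (f k) := by
  subst h
  exact finiteLocalMap_coe f w k

theorem continuous_localMapOver (h : placeBelow f w = v) : Continuous (localMapOver f h) := by
  subst h
  exact (HeightOneSpectrum.adicCompletion.continuous_ofCompletion L w).comp
    (UniformSpace.Completion.continuous_map.comp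
      (HeightOneSpectrum.adicCompletion.continuous_toCompletion K (placeBelow f w)))

theorem eq_localMapOver (h : placeBelow f w = v)
    {g : v.adicCompletion K →+* w.adicCompletion L} (hg : Continuous g)
    (hgk : ∀ k, g (algebraMap K (v.adicCompletion K) k) = algebraMap L (w.adicCompletion L) (f k))
    (x : v.adicCompletion K) : g x = localMapOver f h x := by
  refine congrFun ((HeightOneSpectrum.denseRange_algebraMap K v).equalizer hg
    (continuous_localMapOver h) (funext fun k ↦ ?_)) x
  rw [Function.comp_apply, Function.comp_apply, hgk, localMapOver_algebraMap]

omit [NumberField K] [NumberField L] [NumberField M] in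
theorem placeBelow_comp (f : K →+* L) (g : L →+* M) (w : HeightOneSpectrum (𝓞 M)) :
    placeBelow (g.comp f) w = placeBelow f (placeBelow g w) :=
  HeightOneSpectrum.ext rfl

theorem localMapOver_comp {f : K →+* L} {g : L →+* M} {e : K →+* M} (he : g.comp f = e)
    {v : HeightOneSpectrum (𝓞 K)} {w : HeightOneSpectrum (𝓞 L)} {u : HeightOneSpectrum (𝓞 M)}
    (h : placeBelow f w = v) (h' : placeBelow g u = w) (h'' : placeBelow e u = v)
    (x : v.adicCompletion K) :
    localMapOver g h' (localMapOver f h x) = localMapOver e h'' x := by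
  subst he
  refine eq_localMapOver h'' (g := (localMapOver g h').comp (localMapOver f h))
    ((continuous_localMapOver h').comp (continuous_localMapOver h)) (fun k ↦ ?_) x
  rw [RingHom.comp_apply, localMapOver_algebraMap, localMapOver_algebraMap, RingHom.comp_apply]

theorem exists_valuation_comp_eq (h : placeBelow f w = v) :
    ∃ e : ℕ, e ≠ 0 ∧ ∀ k : K, w.valuation L (f k) = v.valuation K k ^ e := by
  subst h
  let _ := f.toAlgebra
  have : w.asIdeal.LiesOver (placeBelow f w).asIdeal := ⟨rfl⟩
  exact ⟨_, Ideal.IsDedekindDomain.ramificationIdx'_ne_zero_of_liesOver w.asIdeal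
    (placeBelow f w).ne_bot,
    fun k ↦ (HeightOneSpectrum.valuation_liesOver L (placeBelow f w) w k).symm⟩

/-- On K this is the ramification formula. Valuations are locally constant away from 0, so it passes
from the dense subfield K to its completion. -/
theorem exists_valued_localMapOver (h : placeBelow f w = v) :
    ∃ e : ℕ, e ≠ 0 ∧ ∀ x : v.adicCompletion K,
      Valued.v (localMapOver f h x) = Valued.v x ^ e := by
  obtain ⟨e, he, hk⟩ := exists_valuation_comp_eq h
  refine ⟨e, he, fun x ↦ ?_⟩
  rcases eq_or_ne x 0 with rfl | hx
  · simp [he]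
  have hx' : localMapOver f h x ≠ 0 := by simpa using hx
  obtain ⟨n, hn⟩ := exists_exp_neg_natCast_lt (g := Valued.v x) (by simpa using hx)
  obtain ⟨m, hm⟩ := exists_exp_neg_natCast_lt (g := Valued.v (localMapOver f h x)) (by simpa using hx)
  have h1 := (hasBasis_nhds_adicCompletion x).mem_of_mem (i := n) trivial
  have h2 := ((continuous_localMapOver h).tendsto x).eventually
    ((hasBasis_nhds_adicCompletion (localMapOver f h x)).mem_of_mem (i := m) trivial)
  obtain ⟨_, ⟨⟨hy1, hy2⟩, k, rfl⟩⟩ := mem_closure_iff_nhds.1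
    (HeightOneSpectrum.denseRange_algebraMap K v x) _ (Filter.inter_mem h1 h2)
  have e1 : Valued.v (algebraMap K (v.adicCompletion K) k) = Valued.v x :=
    Valuation.map_eq_of_sub_lt _ (lt_of_le_of_lt hy1 hn)
  have e2 : Valued.v (localMapOver f h (algebraMap K (v.adicCompletion K) k)) =
      Valued.v (localMapOver f h x) :=
    Valuation.map_eq_of_sub_lt _ (lt_of_le_of_lt hy2 hm)
  rw [← e2, ← e1, localMapOver_algebraMap, valued_algebraMap, valued_algebraMap, hk]

theorem valued_localMapOver_le_one_iff (h : placeBelow f w = v) (x : v.adicCompletion K) :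
    Valued.v (localMapOver f h x) ≤ 1 ↔ Valued.v x ≤ 1 := by
  obtain ⟨e, he, hx⟩ := exists_valued_localMapOver h
  rw [hx, pow_le_one_iff_of_nonneg zero_le he]

theorem valued_localMapOver_eq_one_iff (h : placeBelow f w = v) (x : v.adicCompletion K) :
    Valued.v (localMapOver f h x) = 1 ↔ Valued.v x = 1 := by
  obtain ⟨e, he, hx⟩ := exists_valued_localMapOver h
  rw [hx, pow_eq_one_iff_of_nonneg zero_le he]

theorem isUniformInducing_of_comap_nhds_zero {G H : Type*} [AddGroup G] [UniformSpace G]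
    [IsUniformAddGroup G] [AddGroup H] [UniformSpace H] [IsUniformAddGroup H] (g : G →+ H)
    (hg : Filter.comap g (nhds 0) = nhds 0) : IsUniformInducing g := by
  constructor
  rw [uniformity_eq_comap_nhds_zero, uniformity_eq_comap_nhds_zero, ← hg, Filter.comap_comap,
    Filter.comap_comap]
  congr 1
  ext p
  simp

/-- The formula of `exists_valued_localMapOver` makes the map a uniform embedding of a complete
space. Hence a limit in L_w of elements of K lies in the image of K_v, which is how descent is
carried out below. -/
theorem isClosed_range_localMapOver (h : placeBelow f w = v) :
    IsClosed (Set.range (localMapOver f h)) := by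
  obtain ⟨e, he, hx⟩ := exists_valued_localMapOver h
  have h1 : Filter.comap (localMapOver f h) (nhds 0) = nhds 0 := by
    refine ((hasBasis_nhds_adicCompletion 0).comap _).ext (hasBasis_nhds_adicCompletion 0)
      (fun n _ ↦ ?_) fun n _ ↦ ?_
    · refine ⟨n, trivial, fun y hy ↦ ?_⟩
      rw [Set.mem_preimage, Set.mem_ofPred_eq, sub_zero, hx]
      rw [Set.mem_ofPred_eq, sub_zero] at hy
      have h1 : Valued.v y ≤ 1 := hy.trans (by rw [← WithZero.exp_zero, WithZero.exp_le_exp]; omega)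
      exact (pow_le_of_le_one zero_le h1 he).trans hy
    · refine ⟨e * n, trivial, fun y hy ↦ ?_⟩
      rw [Set.mem_preimage, Set.mem_ofPred_eq, sub_zero, hx] at hy
      rw [Set.mem_ofPred_eq, sub_zero]
      refine le_of_pow_le_pow_left₀ he zero_le (hy.trans_eq ?_)
      rw [← WithZero.exp_nsmul]
      congr 1
      simp
  have h2 := isUniformInducing_of_comap_nhds_zero (localMapOver f h).toAddMonoidHom h1
  exact h2.isComplete_range.isClosed

theorem localMapOver_injective (h : placeBelow f w = v) : Function.Injective (localMapOver f h) :=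
  (localMapOver f h).injective

omit [NumberField K] [NumberField L] in
theorem placeBelow_surjective (f : K →+* L) : Function.Surjective (placeBelow f) := by
  intro v
  let _ := f.toAlgebra
  obtain ⟨Q, hQ, hQ'⟩ := Ideal.exists_ideal_over_prime_of_isIntegral (S := 𝓞 L) v.asIdeal ⊥ (by
    rw [← RingHom.ker_eq_comap_bot, (RingHom.injective_iff_ker_eq_bot _).1
      (FaithfulSMul.algebraMap_injective (𝓞 K) (𝓞 L))]
    exact bot_le)
  refine ⟨⟨Q, hQ'.1, ?_⟩, HeightOneSpectrum.ext hQ'.2⟩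
  rintro rfl
  refine v.ne_bot ?_
  rw [← hQ'.2, ← RingHom.ker_eq_comap_bot]
  exact (RingHom.injective_iff_ker_eq_bot _).1 (FaithfulSMul.algebraMap_injective (𝓞 K) (𝓞 L))

/-- Weak approximation at finitely many finite places. -/
theorem exists_algebraMap_near_of_finite {T : Set (HeightOneSpectrum (𝓞 K))} (hT : T.Finite)
    (y : ∀ v : HeightOneSpectrum (𝓞 K), v.adicCompletion K) (N : ℕ) :
    ∃ k : K, ∀ v ∈ T, Valued.v (algebraMap K (v.adicCompletion K) k - y v) ≤
      WithZero.exp (-(N : ℤ)) := by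
  classical
  choose k hk using fun v : HeightOneSpectrum (𝓞 K) ↦ exists_algebraMap_near (y v) N
  -- A common denominator d makes the approximations integral; the Chinese remainder theorem is then
  -- used with exponent n v + N, since division by d loses at most n v at v.
  obtain ⟨d, hd⟩ := IsLocalization.exist_integer_multiples_of_finset (nonZeroDivisors (𝓞 K))
    (hT.toFinset.image k)
  have hd0 : (d : 𝓞 K) ≠ 0 := nonZeroDivisors.ne_zero d.2
  have hdF : ((d : 𝓞 K) : K) ≠ 0 := by simp
  have h1 : ∀ v : HeightOneSpectrum (𝓞 K), ∃ n : ℕ, WithZero.exp (-(n : ℤ)) ≤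
      Valued.v (algebraMap K (v.adicCompletion K) ((d : 𝓞 K) : K)) := fun v ↦ by
    obtain ⟨n, hn⟩ := exists_exp_neg_natCast_lt
      (g := Valued.v (algebraMap K (v.adicCompletion K) ((d : 𝓞 K) : K))) (by simp)
    exact ⟨n, hn.le⟩
  choose n hn using h1
  have h2 : ∀ v : hT.toFinset, ∃ a : 𝓞 K, (a : K) = (d : 𝓞 K) * k v := fun v ↦ by
    obtain ⟨a, ha⟩ := hd (k v) (Finset.mem_image_of_mem _ v.2)
    exact ⟨a, ha.trans (Algebra.smul_def _ _)⟩
  choose a ha using h2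
  obtain ⟨b, hb⟩ := IsDedekindDomain.exists_forall_sub_mem_ideal
    (s := hT.toFinset) (fun v ↦ v.asIdeal) (fun v ↦ n v + N) (fun v _ ↦ v.prime)
    (fun v _ w _ h h' ↦ h (HeightOneSpectrum.ext h')) a
  refine ⟨b / (d : 𝓞 K), fun v hv ↦ ?_⟩
  have h3 := (valued_integer_le_iff (v := v) _ _).2 (hb v (hT.mem_toFinset.2 hv))
  have h4 : ((b - a ⟨v, hT.mem_toFinset.2 hv⟩ : 𝓞 K) : K) =
      (d : 𝓞 K) * (b / (d : 𝓞 K) - k v) := by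
    rw [mul_sub, mul_div_cancel₀ _ hdF, ← ha ⟨v, hT.mem_toFinset.2 hv⟩]
    exact map_sub (algebraMap (𝓞 K) K) _ _
  rw [h4, map_mul, map_mul] at h3
  have h5 : Valued.v (algebraMap K (v.adicCompletion K) (b / (d : 𝓞 K) - k v)) ≤
      WithZero.exp (-(N : ℤ)) := by
    have h6 : WithZero.exp (-((n v + N : ℕ) : ℤ)) =
        WithZero.exp (-(n v : ℤ)) * WithZero.exp (-(N : ℤ)) := by
      rw [← WithZero.exp_add]
      congr 1
      push_cast
      ring
    rw [h6] at h3
    by_contra hc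
    rw [not_le] at hc
    refine absurd h3 (not_le.2 ?_)
    calc _ < WithZero.exp (-(n v : ℤ)) *
          Valued.v (algebraMap K (v.adicCompletion K) (b / (d : 𝓞 K) - k v)) :=
        mul_lt_mul_of_pos_left hc WithZero.exp_pos
      _ ≤ _ := mul_le_mul_left (hn v) _
  have h7 : algebraMap K (v.adicCompletion K) (b / (d : 𝓞 K)) - y v =
      algebraMap K (v.adicCompletion K) (b / (d : 𝓞 K) - k v) +
        (algebraMap K (v.adicCompletion K) (k v) - y v) := by
    rw [map_sub]; ring
  rw [h7]
  exact Valuation.map_add_le _ h5 (hk v)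

end LocalMaps

end IdeleClass

namespace IdeleClass

/-! ### The norm to the fixed ring of an involution -/

section NormAlgebra

/-- As 2 and s are invertible, B is the sum of the eigenspaces A and As of σ, so 1, s is a basis.
Multiplication by a + bs has determinant a² - b²s² = (a + bs)(a - bs) in it. -/
theorem algebraMap_norm_of_involution {A B : Type*} [CommRing A] [CommRing B] [Algebra A B]
    (hinj : Function.Injective (algebraMap A B)) (σ : B →+* B) (hσ : ∀ x, σ (σ x) = x)
    (hfix : ∀ x, σ x = x ↔ x ∈ Set.range (algebraMap A B)) {s : B} (hs : σ s = -s) (hsu : IsUnit s)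
    (h2 : IsUnit (2 : B)) (x : B) : algebraMap A B (Algebra.norm A x) = x * σ x := by
  have hA : ∀ a, σ (algebraMap A B a) = algebraMap A B a := fun a ↦ (hfix _).2 ⟨a, rfl⟩
  have hsmul : ∀ (a : A) (b : B), a • b = algebraMap A B a * b := Algebra.smul_def
  have hdec : ∀ y : B, ∃ a b : A, y = a • (1 : B) + b • s := by
    intro y
    obtain ⟨i, hi⟩ := h2.exists_right_inv
    obtain ⟨t, ht⟩ := hsu.exists_right_inv
    have hσt : σ t = -t := by
      have h := congrArg σ ht
      rw [map_mul, hs, map_one] at h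
      calc σ t = (s * t) * σ t := by rw [ht, one_mul]
        _ = -(t * (-s * σ t)) := by ring
        _ = -t := by rw [h, mul_one]
    have hσi : σ i = i := by
      have h := congrArg σ hi
      rw [map_mul, map_ofNat, map_one] at h
      calc σ i = (2 * i) * σ i := by rw [hi, one_mul]
        _ = i * (2 * σ i) := by ring
        _ = i := by rw [h, mul_one]
    obtain ⟨a, ha⟩ := (hfix (i * (y + σ y))).1 (by rw [map_mul, map_add, hσ, hσi, add_comm])
    obtain ⟨b, hb⟩ := (hfix (i * t * (y - σ y))).1 (by
      rw [map_mul, map_mul, map_sub, hσ, hσi, hσt]; ring)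
    refine ⟨a, b, ?_⟩
    rw [hsmul, hsmul, ha, hb]
    calc y = (2 * i) * y := by rw [hi, one_mul]
      _ = i * (y + σ y) * 1 + i * (y - σ y) * 1 := by ring
      _ = i * (y + σ y) * 1 + i * (y - σ y) * (s * t) := by rw [ht]
      _ = _ := by ring
  have hli : LinearIndependent A ![(1 : B), s] := by
    rw [LinearIndependent.pair_iff]
    intro a b hab
    have hab' := congrArg σ hab
    rw [hsmul, hsmul] at hab hab'
    rw [map_add, map_mul, map_mul, hA, hA, map_one, hs, map_zero] at hab'
    have h3 : algebraMap A B a = 0 := h2.mul_left_cancel (by linear_combination hab + hab')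
    have h4 : algebraMap A B b = 0 := (h2.mul hsu).mul_right_cancel (by
      linear_combination hab - hab')
    exact ⟨hinj (h3.trans (map_zero _).symm), hinj (h4.trans (map_zero _).symm)⟩
  have hsp : ⊤ ≤ Submodule.span A (Set.range ![(1 : B), s]) := by
    rintro y -
    obtain ⟨a, b, rfl⟩ := hdec y
    refine Submodule.add_mem _ (Submodule.smul_mem _ _ (Submodule.subset_span ⟨0, rfl⟩))
      (Submodule.smul_mem _ _ (Submodule.subset_span ⟨1, rfl⟩))
  let β := Module.Basis.mk hli hsp
  have hβ0 : β 0 = 1 := by simp [β]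
  have hβ1 : β 1 = s := by simp [β]
  obtain ⟨t, ht⟩ := (hfix (s * s)).1 (by rw [map_mul, hs, neg_mul_neg])
  obtain ⟨a, b, rfl⟩ := hdec x
  have e0 : (a • (1 : B) + b • s) * β 0 = a • β 0 + b • β 1 := by rw [hβ0, hβ1, mul_one]
  have e1 : (a • (1 : B) + b • s) * β 1 = (b * t) • β 0 + a • β 1 := by
    rw [hβ0, hβ1]
    simp only [hsmul, map_mul, ht]
    ring
  have hn : Algebra.norm A (a • (1 : B) + b • s) = a * a - b * t * b := by
    rw [Algebra.norm_eq_matrix_det β, Matrix.det_fin_two]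
    simp only [Algebra.leftMulMatrix_eq_repr_mul, e0, e1, map_add, map_smul, Module.Basis.repr_self]
    simp
  rw [hn]
  simp only [hsmul, map_sub, map_mul, map_add, hA, hs, ht, map_one]
  ring

end NormAlgebra

/-! ### Infinite adeles -/

section Infinite

variable {K L : Type*} [Field K] [NumberField K] [Field L] [NumberField L]

omit [NumberField K] [NumberField L] in
theorem infiniteLocalMap_algebraMap (f : K →+* L) (w : InfinitePlace L) (k : K) :
    infiniteLocalMap f w (algebraMap K _ k) = algebraMap L w.Completion (f k) := by
  let _ := f.toAlgebra
  have : w.LiesOver (w.comap f) := ⟨rfl⟩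
  exact LiesOver.completionMap_coe (v := w.comap f) (w := w) (WithAbs.toAbs _ k)

omit [NumberField K] [NumberField L] in
theorem isometry_infiniteLocalMap (f : K →+* L) (w : InfinitePlace L) :
    Isometry (infiniteLocalMap f w) := by
  let _ := f.toAlgebra
  have : w.LiesOver (w.comap f) := ⟨rfl⟩
  have h1 := (InfinitePlace.LiesOver.isometry_algebraMap w (w.comap f)).isometry_mapRingHom
  exact ((InfinitePlace.Completion.isometryEquivCompletion w).symm.isometry.comp h1).comp
    (InfinitePlace.Completion.isometry_toCompletion (w.comap f))

omit [NumberField K] [NumberField L] in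
theorem infiniteAdeleMap_algebraMap (f : K →+* L) (k : K) :
    infiniteAdeleMap f (algebraMap K _ k) = algebraMap L _ (f k) :=
  funext fun w ↦ infiniteLocalMap_algebraMap f w k

omit [NumberField K] [NumberField L] in
theorem continuous_infiniteAdeleMap (f : K →+* L) : Continuous (infiniteAdeleMap f) :=
  continuous_pi fun w ↦ (isometry_infiniteLocalMap f w).continuous.comp (continuous_apply _)

omit [NumberField K] in
-- With a single infinite place below, the range is cut out by the ranges of the local maps, which
-- are isometric embeddings of complete fields.
theorem isClosed_range_infiniteAdeleMap [Subsingleton (InfinitePlace L)]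
    [Subsingleton (InfinitePlace K)] (f : K →+* L) : IsClosed (Set.range (infiniteAdeleMap f)) := by
  have h : Set.range (infiniteAdeleMap f) =
      {y | ∀ w : InfinitePlace L, y w ∈ Set.range (infiniteLocalMap f w)} := by
    refine Set.Subset.antisymm ?_ fun y hy ↦ ?_
    · rintro _ ⟨x, rfl⟩ w
      exact ⟨x _, rfl⟩
    · have w₀ : InfinitePlace L := Classical.arbitrary _
      obtain ⟨x, hx⟩ := hy w₀
      refine ⟨fun v ↦ (Subsingleton.elim (w₀.comap f) v) ▸ x, funext fun w ↦ ?_⟩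
      obtain rfl := Subsingleton.elim w₀ w
      exact hx
  rw [h, Set.ofPred_forall]
  exact isClosed_iInter fun w ↦
    (isometry_infiniteLocalMap f w).isClosedEmbedding.isClosed_range.preimage (continuous_apply w)

end Infinite

end IdeleClass

namespace IdeleClass

/-! ### Functoriality and injectivity of the adele maps -/

section Functoriality

variable {K L M : Type*} [Field K] [NumberField K] [Field L] [NumberField L] [Field M]
  [NumberField M]

omit [NumberField L] [NumberField M] in
theorem infiniteAdeleMap_comp {f : K →+* L} {g : L →+* M} {e : K →+* M} (he : g.comp f = e)
    (x : InfiniteAdeleRing K) :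
    infiniteAdeleMap g (infiniteAdeleMap f x) = infiniteAdeleMap e x := by
  have : T2Space (InfiniteAdeleRing M) := inferInstanceAs (T2Space (∀ w : InfinitePlace M, _))
  refine congrFun ((InfiniteAdeleRing.denseRange_algebraMap K).equalizer
    ((continuous_infiniteAdeleMap g).comp (continuous_infiniteAdeleMap f))
    (continuous_infiniteAdeleMap e) (funext fun k ↦ ?_)) x
  simp only [Function.comp_apply, infiniteAdeleMap_algebraMap, ← he, RingHom.comp_apply]

theorem infiniteAdeleMap_id (x : InfiniteAdeleRing K) :
    infiniteAdeleMap (RingHom.id K) x = x := by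
  have : T2Space (InfiniteAdeleRing K) := inferInstanceAs (T2Space (∀ w : InfinitePlace K, _))
  refine congrFun ((InfiniteAdeleRing.denseRange_algebraMap K).equalizer
    (continuous_infiniteAdeleMap (RingHom.id K)) continuous_id (funext fun k ↦ ?_)) x
  simp only [Function.comp_apply, infiniteAdeleMap_algebraMap, RingHom.id_apply, id]

theorem adeleMap_fst (f : K →+* L) (x : AdeleRing (𝓞 K) K) :
    (adeleMap f x).1 = infiniteAdeleMap f x.1 := rfl

theorem adeleMap_snd (f : K →+* L) (x : AdeleRing (𝓞 K) K) {v : HeightOneSpectrum (𝓞 K)}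
    {w : HeightOneSpectrum (𝓞 L)} (h : placeBelow f w = v) :
    (adeleMap f x).2 w = localMapOver f h (x.2 v) :=
  finiteLocalMap_apply_eq f h fun v ↦ x.2 v

theorem localMapOver_id {v : HeightOneSpectrum (𝓞 K)} (h : placeBelow (RingHom.id K) v = v)
    (x : v.adicCompletion K) : localMapOver (RingHom.id K) h x = x :=
  (eq_localMapOver h (g := RingHom.id _) continuous_id (fun _ ↦ rfl) x).symm

theorem adeleMap_algebraMap (f : K →+* L) (k : K) :
    adeleMap f (algebraMap K _ k) = algebraMap L _ (f k) := by
  refine Prod.ext (infiniteAdeleMap_algebraMap f k) (FiniteAdeleRing.ext _ fun w ↦ ?_)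
  rw [adeleMap_snd f _ rfl]
  exact localMapOver_algebraMap rfl k

theorem adeleMap_comp {f : K →+* L} {g : L →+* M} {e : K →+* M} (he : g.comp f = e)
    (x : AdeleRing (𝓞 K) K) : adeleMap g (adeleMap f x) = adeleMap e x := by
  refine Prod.ext (infiniteAdeleMap_comp he x.1) (FiniteAdeleRing.ext _ fun w ↦ ?_)
  rw [adeleMap_snd g _ rfl, adeleMap_snd f _ rfl, adeleMap_snd e _ rfl]
  subst he
  exact localMapOver_comp rfl rfl rfl rfl _

theorem adeleMap_id (x : AdeleRing (𝓞 K) K) : adeleMap (RingHom.id K) x = x := by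
  have h : ∀ v, placeBelow (RingHom.id K) v = v := fun v ↦ HeightOneSpectrum.ext rfl
  refine Prod.ext (infiniteAdeleMap_id x.1) (FiniteAdeleRing.ext _ fun w ↦ ?_)
  rw [adeleMap_snd _ _ (h w), localMapOver_id]

omit [NumberField K] in
theorem infiniteAdeleMap_injective [Subsingleton (InfinitePlace K)] (f : K →+* L) :
    Function.Injective (infiniteAdeleMap f) := by
  intro x y h
  have w₀ : InfinitePlace L := Classical.arbitrary _
  funext v
  obtain rfl := Subsingleton.elim (w₀.comap f) v
  exact (isometry_infiniteLocalMap f w₀).injective (congrFun h w₀)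

theorem adeleMap_injective [Subsingleton (InfinitePlace K)] (f : K →+* L) :
    Function.Injective (adeleMap f) := by
  intro x y h
  refine Prod.ext (infiniteAdeleMap_injective f (congrArg Prod.fst h))
    (FiniteAdeleRing.ext _ fun v ↦ ?_)
  obtain ⟨w, hw⟩ := placeBelow_surjective f v
  apply localMapOver_injective hw
  rw [← adeleMap_snd, ← adeleMap_snd, h]

end Functoriality

/-- `c` is the nontrivial automorphism of a quadratic field. -/
structure IsConjugation {K : Type*} [Field K] [NumberField K] (c : K ≃ₐ[ℚ] K) : Prop where
  apply_apply : ∀ x, c (c x) = x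
  exists_rat : ∀ x, c x = x → ∃ q : ℚ, algebraMap ℚ K q = x
  exists_ne : ∃ x, c x ≠ x

theorem isConjugation_of_finrank {K : Type*} [Field K] [NumberField K]
    (hdeg : Module.finrank ℚ K = 2) {c : K ≃ₐ[ℚ] K} (hc : c ≠ 1) : IsConjugation c := by
  have h1 := IntermediateField.finrank_fixedField_eq_card (Subgroup.zpowers c)
  have h2 := Module.finrank_mul_finrank ℚ (IntermediateField.fixedField (Subgroup.zpowers c)) K
  rw [h1, Nat.card_zpowers, hdeg] at h2
  have h3 : orderOf c ≠ 1 := by rwa [ne_eq, orderOf_eq_one_iff]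
  have h4 : orderOf c = 2 := (Nat.prime_two.eq_one_or_self_of_dvd _ ⟨_, by rw [mul_comm]; exact h2.symm⟩).resolve_left h3
  rw [h4] at h2
  have h5 : Module.finrank ℚ (IntermediateField.fixedField (Subgroup.zpowers c)) = 1 := by omega
  rw [IntermediateField.finrank_eq_one_iff] at h5
  refine ⟨fun x ↦ ?_, fun x hx ↦ ?_, ?_⟩
  · have h6 : c ^ 2 = 1 := by rw [← h4, pow_orderOf_eq_one]
    rw [pow_two] at h6
    exact DFunLike.congr_fun h6 x
  · have h6 : x ∈ IntermediateField.fixedField (Subgroup.zpowers c) := by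
      rw [IntermediateField.mem_fixedField_iff]
      intro g hg
      have h7 : Subgroup.zpowers c ≤ MulAction.stabilizer (K ≃ₐ[ℚ] K) x := by
        rw [Subgroup.zpowers_le]
        exact hx
      exact h7 hg
    rw [h5] at h6
    exact IntermediateField.mem_bot.1 h6
  · by_contra! h
    exact hc (AlgEquiv.ext h)

/-! ### Descent of adeles from K to ℚ -/

section Descent

variable {K : Type*} [Field K] [NumberField K] {c : K ≃ₐ[ℚ] K}

theorem IsConjugation.comp_self (hc : IsConjugation c) :
    (c : K →+* K).comp (c : K →+* K) = RingHom.id K :=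
  RingHom.ext hc.apply_apply

theorem conj_comp_algebraMap (c : K ≃ₐ[ℚ] K) :
    (c : K →+* K).comp (algebraMap ℚ K) = algebraMap ℚ K :=
  RingHom.ext c.commutes

theorem placeBelow_conj (c : K ≃ₐ[ℚ] K) (w : HeightOneSpectrum (𝓞 K)) :
    placeBelow (algebraMap ℚ K) (placeBelow (c : K →+* K) w) = placeBelow (algebraMap ℚ K) w := by
  rw [← placeBelow_comp, conj_comp_algebraMap]

theorem IsConjugation.placeBelow_placeBelow (hc : IsConjugation c) (w : HeightOneSpectrum (𝓞 K)) :
    placeBelow (c : K →+* K) (placeBelow (c : K →+* K) w) = w := by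
  rw [← placeBelow_comp, hc.comp_self]
  exact HeightOneSpectrum.ext rfl

theorem IsConjugation.exists_rat_add (hc : IsConjugation c) (k : K) :
    ∃ q : ℚ, algebraMap ℚ K q = k + c k :=
  hc.exists_rat _ (by rw [map_add, hc.apply_apply, add_comm])

theorem finite_placeBelow_eq (f : ℚ →+* K) (P : HeightOneSpectrum (𝓞 ℚ)) :
    {w | placeBelow f w = P}.Finite := by
  have h := tendsto_placeBelow f (Set.finite_singleton P).compl_mem_cofinite
  rw [Filter.mem_map, Filter.mem_cofinite] at h
  refine h.subset fun w hw hc ↦ hc hw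

/-- Descent at the places above a place `P` of `ℚ`. -/
theorem IsConjugation.exists_localMapOver_eq (hc : IsConjugation c)
    {y : ∀ w : HeightOneSpectrum (𝓞 K), w.adicCompletion K}
    (hy : ∀ w, finiteLocalMap (c : K →+* K) w (y _) = y w) (P : HeightOneSpectrum (𝓞 ℚ)) :
    ∃ x : P.adicCompletion ℚ, ∀ w (h : placeBelow (algebraMap ℚ K) w = P),
      localMapOver (algebraMap ℚ K) h x = y w := by
  -- If k is near y at all places above P, then k + c(k) is rational and near y + c(y) = 2y at all
  -- of them.
  have happ : ∀ N : ℕ, ∃ q : ℚ, ∀ w (h : placeBelow (algebraMap ℚ K) w = P),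
      Valued.v (localMapOver (algebraMap ℚ K) h (algebraMap ℚ _ q) - 2 * y w) ≤
        WithZero.exp (-(N : ℤ)) := by
    intro N
    obtain ⟨k, hk⟩ := exists_algebraMap_near_of_finite
      (finite_placeBelow_eq (algebraMap ℚ K) P) y N
    obtain ⟨q, hq⟩ := hc.exists_rat_add k
    refine ⟨q, fun w h ↦ ?_⟩
    have h1 := hk w h
    have h2 := hk (placeBelow (c : K →+* K) w) ((placeBelow_conj c w).trans h)
    have h3 : localMapOver (algebraMap ℚ K) h (algebraMap ℚ _ q) - 2 * y w =
        (algebraMap K (w.adicCompletion K) k - y w) +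
          finiteLocalMap (c : K →+* K) w (algebraMap K _ k - y (placeBelow (c : K →+* K) w)) := by
      rw [localMapOver_algebraMap, hq, map_add, map_sub, hy]
      have : finiteLocalMap (c : K →+* K) w (algebraMap K _ k) =
        algebraMap K (w.adicCompletion K) (c k) := finiteLocalMap_coe _ w k
      rw [this]
      ring
    rw [h3]
    refine Valuation.map_add_le _ h1 ?_
    obtain ⟨e, he, hv⟩ := exists_valued_localMapOver
      (rfl : placeBelow (c : K →+* K) w = placeBelow (c : K →+* K) w)
    refine (hv _).le.trans ((pow_le_of_le_one zero_le (h2.trans ?_) he).trans h2)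
    rw [← WithZero.exp_zero, WithZero.exp_le_exp]
    omega
  -- Closedness of the image at a single place w₀ gives x with image 2y there; the other places
  -- above P are reached through common rational approximations.
  obtain ⟨w₀, h₀⟩ := placeBelow_surjective (algebraMap ℚ K) P
  obtain ⟨x, hx⟩ : 2 * y w₀ ∈ Set.range (localMapOver (algebraMap ℚ K) h₀) := by
    rw [← (isClosed_range_localMapOver h₀).closure_eq,
      mem_closure_iff_nhds_basis (hasBasis_nhds_adicCompletion _)]
    intro N _
    obtain ⟨q, hq⟩ := happ N
    exact ⟨_, ⟨_, rfl⟩, hq w₀ h₀⟩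
  refine ⟨x / 2, fun w h ↦ ?_⟩
  obtain ⟨e₀, he₀, hv₀⟩ := exists_valued_localMapOver h₀
  obtain ⟨e, he, hv⟩ := exists_valued_localMapOver h
  suffices h2 : localMapOver (algebraMap ℚ K) h x = 2 * y w by
    have h3 : (2 : w.adicCompletion K) ≠ 0 := by
      have := (algebraMap ℚ (w.adicCompletion K)).injective.ne (two_ne_zero (α := ℚ))
      simpa using this
    rw [map_div₀, h2, map_ofNat, mul_div_cancel_left₀ _ h3]
  by_contra hne
  rw [← sub_eq_zero, ← ne_eq, ← Valuation.ne_zero_iff Valued.v] at hne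
  obtain ⟨N, hN⟩ := exists_exp_neg_natCast_lt hne
  -- Valuations at w₀ are e₀-th powers of those at P, so precision e₀N at w₀ yields precision N at
  -- P.
  obtain ⟨q, hq⟩ := happ (e₀ * N)
  have h1 := hq w₀ h₀
  rw [← hx, ← map_sub, hv₀] at h1
  have h2 : Valued.v (algebraMap ℚ (P.adicCompletion ℚ) q - x) ≤ WithZero.exp (-(N : ℤ)) := by
    refine le_of_pow_le_pow_left₀ he₀ zero_le (h1.trans_eq ?_)
    rw [← WithZero.exp_nsmul]
    congr 1
    simp
  have h3 : Valued.v (localMapOver (algebraMap ℚ K) h (x - algebraMap ℚ _ q)) ≤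
      WithZero.exp (-(N : ℤ)) := by
    rw [hv, Valuation.map_sub_swap]
    refine (pow_le_of_le_one zero_le (h2.trans ?_) he).trans h2
    rw [← WithZero.exp_zero, WithZero.exp_le_exp]
    omega
  have h4 := hq w h
  refine absurd hN (not_lt.2 ?_)
  have h5 : localMapOver (algebraMap ℚ K) h x - 2 * y w =
      localMapOver (algebraMap ℚ K) h (x - algebraMap ℚ _ q) +
        (localMapOver (algebraMap ℚ K) h (algebraMap ℚ _ q) - 2 * y w) := by
    rw [map_sub]; ring
  rw [h5]
  refine Valuation.map_add_le _ h3 (h4.trans ?_)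
  rw [WithZero.exp_le_exp]
  have : N ≤ e₀ * N := Nat.le_mul_of_pos_left N (Nat.pos_of_ne_zero he₀)
  push_cast
  have : (N : ℤ) ≤ e₀ * N := by exact_mod_cast this
  omega

/-- A fixed adele y satisfies 2y = y + c(y), a limit of traces, which are rational. Closedness of
the images then descends y at P and at infinity, and integrality at almost all places is inherited
because the local maps detect it. -/
theorem IsConjugation.adeleMap_eq_iff [Subsingleton (InfinitePlace K)] (hc : IsConjugation c)
    (y : AdeleRing (𝓞 K) K) :
    adeleMap (c : K →+* K) y = y ↔ y ∈ Set.range (adeleMap (algebraMap ℚ K)) := by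
  refine ⟨fun hy ↦ ?_, ?_⟩
  · have hy2 : ∀ w, finiteLocalMap (c : K →+* K) w (y.2 _) = y.2 w := fun w ↦
      congrArg (fun z : AdeleRing (𝓞 K) K ↦ z.2 w) hy
    choose x hx using hc.exists_localMapOver_eq hy2
    have hint : ∀ᶠ P in Filter.cofinite, x P ∈ P.adicCompletionIntegers ℚ := by
      have h1 : {w | ¬ y.2 w ∈ w.adicCompletionIntegers K}.Finite := y.2.2
      refine (h1.image (placeBelow (algebraMap ℚ K))).subset fun P hP ↦ ?_
      obtain ⟨w, hw⟩ := placeBelow_surjective (algebraMap ℚ K) P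
      refine ⟨w, fun h ↦ hP ?_, hw⟩
      rw [← hx P w hw] at h
      exact (valued_localMapOver_le_one_iff hw _).1 h
    obtain ⟨z, hz⟩ : (2 : InfiniteAdeleRing K) * y.1 ∈
        Set.range (infiniteAdeleMap (algebraMap ℚ K)) := by
      rw [← (isClosed_range_infiniteAdeleMap (algebraMap ℚ K)).closure_eq]
      have h1 : (2 : InfiniteAdeleRing K) * y.1 = y.1 + infiniteAdeleMap (c : K →+* K) y.1 := by
        rw [← adeleMap_fst, hy, two_mul]
      rw [h1]
      refine map_mem_closure (f := fun z ↦ z + infiniteAdeleMap (c : K →+* K) z)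
        (continuous_id.add (continuous_infiniteAdeleMap (c : K →+* K)))
        (InfiniteAdeleRing.denseRange_algebraMap K y.1) ?_
      rintro _ ⟨k, rfl⟩
      obtain ⟨q, hq⟩ := hc.exists_rat_add k
      refine ⟨algebraMap ℚ _ q, ?_⟩
      simp only [infiniteAdeleMap_algebraMap, hq, map_add]
      rfl
    have h2 : (2 : InfiniteAdeleRing K) * algebraMap K _ (algebraMap ℚ K (1 / 2)) = 1 := by
      rw [← map_ofNat (algebraMap K (InfiniteAdeleRing K)), ← map_mul]
      norm_num
    let x' : FiniteAdeleRing (𝓞 ℚ) ℚ := ⟨x, hint⟩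
    let z' : InfiniteAdeleRing ℚ := algebraMap ℚ _ (1 / 2 : ℚ) * z
    have hz' : infiniteAdeleMap (algebraMap ℚ K) z' = y.1 := by
      rw [map_mul, hz, infiniteAdeleMap_algebraMap, ← mul_assoc, mul_comm (algebraMap K _ _) 2, h2,
        one_mul]
    have hx' : finiteAdeleMap (algebraMap ℚ K) x' = y.2 :=
      FiniteAdeleRing.ext _ fun w ↦ hx _ w rfl
    exact ⟨(z', x'), Prod.ext hz' hx'⟩
  · rintro ⟨x, rfl⟩
    exact adeleMap_comp (conj_comp_algebraMap c) x

/-- Since 𝔸_ℚ is the fixed ring of c in 𝔸_K, `algebraMap_norm_of_involution` applies with s = k -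
c(k) for an element k moved by c. -/
theorem IsConjugation.adeleMap_ideleNorm [Subsingleton (InfinitePlace K)] (hc : IsConjugation c)
    (x : IdeleGroup K) :
    adeleMap (algebraMap ℚ K) (ideleNorm K x : AdeleRing (𝓞 ℚ) ℚ) =
      (x : AdeleRing (𝓞 K) K) * adeleMap (c : K →+* K) (x : AdeleRing (𝓞 K) K) := by
  let _ := (adeleMap (algebraMap ℚ K)).toAlgebra
  obtain ⟨k, hk⟩ := hc.exists_ne
  have hs : c (k - c k) = -(k - c k) := by
    rw [map_sub, hc.apply_apply, neg_sub]
  have hs0 : k - c k ≠ 0 := sub_ne_zero.2 hk.symm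
  refine algebraMap_norm_of_involution (adeleMap_injective (algebraMap ℚ K))
    (adeleMap (c : K →+* K)) (fun y ↦ ?_) hc.adeleMap_eq_iff
    (s := algebraMap K _ (k - c k)) ?_ ?_ ?_ _
  · rw [adeleMap_comp hc.comp_self, adeleMap_id]
  · rw [adeleMap_algebraMap, ← map_neg]
    exact congrArg _ hs
  · exact (isUnit_iff_ne_zero.2 hs0).map _
  · rw [← map_ofNat (algebraMap K (AdeleRing (𝓞 K) K))]
    exact (isUnit_iff_ne_zero.2 two_ne_zero).map _

end Descent

end IdeleClass

namespace IdeleClass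

/-! ### The idele norm and base change of quadratic characters -/

section Norm

variable {K : Type*} [Field K] [NumberField K] {c : K ≃ₐ[ℚ] K}

theorem finComp_ideleConj (c : K ≃ₐ[ℚ] K) (x : IdeleGroup K) (w : HeightOneSpectrum (𝓞 K))
    {w' : HeightOneSpectrum (𝓞 K)} (h : placeBelow (c : K →+* K) w = w') :
    (finComp w (ideleConj c x) : w.adicCompletion K) =
      localMapOver (c : K →+* K) h (finComp w' x : w'.adicCompletion K) :=
  adeleMap_snd (c : K →+* K) (x : AdeleRing (𝓞 K) K) h

theorem infPart_ideleConj (c : K ≃ₐ[ℚ] K) (x : IdeleGroup K) :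
    (infPart (ideleConj c x) : InfiniteAdeleRing K) =
      infiniteAdeleMap (c : K →+* K) (infPart x : InfiniteAdeleRing K) := rfl

variable [Subsingleton (InfinitePlace K)]

theorem IsConjugation.finComp_ideleNorm (hc : IsConjugation c) (x : IdeleGroup K)
    {w w' : HeightOneSpectrum (𝓞 K)} {P : HeightOneSpectrum (𝓞 ℚ)}
    (h : placeBelow (algebraMap ℚ K) w = P) (h' : placeBelow (c : K →+* K) w = w') :
    localMapOver (algebraMap ℚ K) h (finComp P (ideleNorm K x) : P.adicCompletion ℚ) =
      (finComp w x : w.adicCompletion K) *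
        localMapOver (c : K →+* K) h' (finComp w' x : w'.adicCompletion K) := by
  have := congrArg (fun z : AdeleRing (𝓞 K) K ↦ z.2 w) (hc.adeleMap_ideleNorm x)
  rw [adeleMap_snd _ _ h] at this
  exact this.trans (congrArg (fun z ↦ (finComp w x : w.adicCompletion K) * z)
    (adeleMap_snd (c : K →+* K) (x : AdeleRing (𝓞 K) K) h'))

theorem IsConjugation.infPart_ideleNorm (hc : IsConjugation c) (x : IdeleGroup K) :
    infiniteAdeleMap (algebraMap ℚ K) (infPart (ideleNorm K x) : InfiniteAdeleRing ℚ) =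
      (infPart x : InfiniteAdeleRing K) *
        infiniteAdeleMap (c : K →+* K) (infPart x : InfiniteAdeleRing K) :=
  congrArg Prod.fst (hc.adeleMap_ideleNorm x)

/-- The norm x · c(x) is symmetric in x and c(x). This is what makes base changes invariant under c.
-/
theorem IsConjugation.ideleNorm_ideleConj (hc : IsConjugation c) (x : IdeleGroup K) :
    ideleNorm K (ideleConj c x) = ideleNorm K x := by
  apply Units.ext
  apply adeleMap_injective (algebraMap ℚ K)
  rw [hc.adeleMap_ideleNorm, hc.adeleMap_ideleNorm, mul_comm]
  congr 1
  change adeleMap (c : K →+* K) (adeleMap (c : K →+* K) _) = _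
  rw [adeleMap_comp hc.comp_self, adeleMap_id]

theorem IsConjugation.infPart_ideleNorm_eq_one (hc : IsConjugation c) {x : IdeleGroup K}
    (hx : infPart x = 1) : infPart (ideleNorm K x) = 1 := by
  apply Units.ext
  apply infiniteAdeleMap_injective (algebraMap ℚ K)
  rw [hc.infPart_ideleNorm, hx, Units.val_one, map_one, Units.val_one, map_one, one_mul]

theorem IsConjugation.finComp_ideleNorm_eq_one (hc : IsConjugation c) {x : IdeleGroup K}
    {w : HeightOneSpectrum (𝓞 K)} (hx : finComp w x = 1)
    (hx' : finComp (placeBelow (c : K →+* K) w) x = 1) :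
    finComp (placeBelow (algebraMap ℚ K) w) (ideleNorm K x) = 1 := by
  apply Units.ext
  apply localMapOver_injective (f := algebraMap ℚ K) rfl
  rw [hc.finComp_ideleNorm x rfl rfl, hx, hx']
  simp only [Units.val_one, map_one, one_mul]

theorem IsConjugation.infIdele_infPart_ideleNorm (hc : IsConjugation c) (x : IdeleGroup K) :
    infIdele (infPart (ideleNorm K x)) = ideleNorm K (infIdele (infPart x)) := by
  refine idele_ext ?_ fun P ↦ ?_
  · rw [infPart_infIdele]
    apply Units.ext
    apply infiniteAdeleMap_injective (algebraMap ℚ K)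
    rw [hc.infPart_ideleNorm, hc.infPart_ideleNorm, infPart_infIdele]
  · obtain ⟨w, rfl⟩ := placeBelow_surjective (algebraMap ℚ K) P
    rw [finComp_infIdele, hc.finComp_ideleNorm_eq_one (finComp_infIdele _ _)
      (finComp_infIdele _ _)]

/-- All components of x · c(x) away from P are 1, so a single local identity remains. The two
following lemmas treat w fixed by c and w moved by c. -/
theorem IsConjugation.ideleNorm_localIdele (hc : IsConjugation c)
    {w : HeightOneSpectrum (𝓞 K)} {P : HeightOneSpectrum (𝓞 ℚ)}
    (h : placeBelow (algebraMap ℚ K) w = P) (x : (w.adicCompletion K)ˣ) (n : (P.adicCompletion ℚ)ˣ)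
    (hn : localMapOver (algebraMap ℚ K) h n = (finComp w (localIdele w x) : w.adicCompletion K) *
      localMapOver (c : K →+* K) rfl (finComp (placeBelow (c : K →+* K) w) (localIdele w x) :
        (placeBelow (c : K →+* K) w).adicCompletion K)) :
    ideleNorm K (localIdele w x) = localIdele P n := by
  refine idele_ext ?_ fun P' ↦ ?_
  · rw [hc.infPart_ideleNorm_eq_one (infPart_localIdele _ _), infPart_localIdele]
  · rcases eq_or_ne P' P with rfl | hP
    · rw [finComp_localIdele_same]
      apply Units.ext
      apply localMapOver_injective h
      rw [hc.finComp_ideleNorm _ h rfl, hn]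
    · obtain ⟨w', rfl⟩ := placeBelow_surjective (algebraMap ℚ K) P'
      rw [finComp_localIdele_of_ne hP, hc.finComp_ideleNorm_eq_one]
      · refine finComp_localIdele_of_ne (fun h' ↦ hP ?_) _
        rw [h', h]
      · refine finComp_localIdele_of_ne (fun h' ↦ hP ?_) _
        rw [← placeBelow_conj c w', h', h]

theorem IsConjugation.ideleNorm_localIdele_of_eq (hc : IsConjugation c)
    {w : HeightOneSpectrum (𝓞 K)} {P : HeightOneSpectrum (𝓞 ℚ)}
    (h : placeBelow (algebraMap ℚ K) w = P) (h' : placeBelow (c : K →+* K) w = w)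
    (x : (w.adicCompletion K)ˣ) (n : (P.adicCompletion ℚ)ˣ)
    (hn : localMapOver (algebraMap ℚ K) h n =
      (x : w.adicCompletion K) * localMapOver (c : K →+* K) h' x) :
    ideleNorm K (localIdele w x) = localIdele P n := by
  refine hc.ideleNorm_localIdele h x n ?_
  rw [hn, finComp_localIdele_same]
  have := finiteLocalMap_apply_eq (c : K →+* K) h'
    (fun v ↦ (finComp v (localIdele w x) : v.adicCompletion K))
  rw [finComp_localIdele_same] at this
  rw [← this]
  rfl

theorem IsConjugation.ideleNorm_localIdele_of_ne (hc : IsConjugation c)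
    {w : HeightOneSpectrum (𝓞 K)} {P : HeightOneSpectrum (𝓞 ℚ)}
    (h : placeBelow (algebraMap ℚ K) w = P) (h' : placeBelow (c : K →+* K) w ≠ w)
    (x : (w.adicCompletion K)ˣ) (n : (P.adicCompletion ℚ)ˣ)
    (hn : localMapOver (algebraMap ℚ K) h n = (x : w.adicCompletion K)) :
    ideleNorm K (localIdele w x) = localIdele P n := by
  refine hc.ideleNorm_localIdele h x n ?_
  rw [hn, finComp_localIdele_same, finComp_localIdele_of_ne h', Units.val_one, map_one, mul_one]

omit [NumberField K] [Subsingleton (InfinitePlace K)] in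
-- All infinite places are complex and ℂˣ consists of squares; hence characters with values ±1 are
-- trivial at infinity.
theorem exists_sq_eq_infinite [IsTotallyComplex K] (z : (InfiniteAdeleRing K)ˣ) :
    ∃ t, t ^ 2 = z := by
  have h : ∀ w : InfinitePlace K, ∃ a : w.Completion, a ^ 2 = (z : InfiniteAdeleRing K) w := by
    intro w
    let e := InfinitePlace.Completion.ringEquivComplexOfIsComplex
      (IsTotallyComplex.isComplex w)
    obtain ⟨a, ha⟩ := IsAlgClosed.exists_pow_nat_eq (e ((z : InfiniteAdeleRing K) w))
      (Nat.succ_pos 1)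
    exact ⟨e.symm a, by rw [← map_pow, ha, e.symm_apply_apply]⟩
  choose a ha using h
  let a' : InfiniteAdeleRing K := a
  have ha2 : a' ^ 2 = (z : InfiniteAdeleRing K) := funext ha
  obtain ⟨u, hu⟩ : IsUnit a' :=
    (isUnit_pow_iff two_ne_zero).1 (ha2 ▸ z.isUnit)
  exact ⟨u, Units.ext (by rw [Units.val_pow_eq_pow_val, hu, ha2])⟩

/-- The base change of a quadratic character of `ℚ`. -/
theorem IsConjugation.exists_baseChange [IsTotallyComplex K] (hc : IsConjugation c)
    {ν : IdeleClassChar ℚ} (hν : ∀ x, ν.1 x ^ 2 = 1) :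
    ∃ μ : IdeleClassChar K, ∀ x, μ.1 x = ν.1 (ideleNorm K x) := by
  let Φ : IdeleGroup K →* Circle := (ν.1 : IdeleGroup ℚ →* Circle).comp (ideleNorm K)
  have hΦ : ∀ x, Φ x = ν.1 (ideleNorm K x) := fun x ↦ rfl
  obtain ⟨T, -, hT⟩ := exists_finset_unitComponent hν
  choose ϖ hϖ using fun P : HeightOneSpectrum (𝓞 ℚ) ↦ exists_isUniformizer P
  choose N hN using fun P ↦ exists_trivialMod_unitComponent hν P (hϖ P)
  choose g hg using placeBelow_surjective (algebraMap ℚ K)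
  choose e he hve using fun P ↦ exists_valued_localMapOver (hg P)
  classical
  let T' : Finset (HeightOneSpectrum (𝓞 K)) :=
    T.image g ∪ T.image fun P ↦ placeBelow (c : K →+* K) (g P)
  let M : ℕ := ∑ P ∈ T, e P * N P
  have hM : ∀ P ∈ T, e P * N P ≤ M := fun P hP ↦
    Finset.single_le_sum (f := fun P ↦ e P * N P) (fun _ _ ↦ Nat.zero_le _) hP
  have hcont : Continuous Φ := by
    refine continuous_of_continuousAt_one Φ ?_
    -- For x near 1 the norm is a unit at every P, close to 1 at the finitely many P in T, and a
    -- square at infinity; ν is trivial on such ideles.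
    have h1 : ∀ᶠ x : IdeleGroup K in nhds 1, Φ x = 1 := by
      filter_upwards [eventually_valued_finComp T' fun _ ↦ M] with x hx
      have h2 : ∀ P, Valued.v (finComp P (ideleNorm K x) : P.adicCompletion ℚ) = 1 := by
        intro P
        rw [← valued_localMapOver_eq_one_iff (hg P), hc.finComp_ideleNorm x (hg P) rfl, map_mul,
          (hx _).1, one_mul, valued_localMapOver_eq_one_iff, (hx _).1]
      obtain ⟨y, hy, hy'⟩ := exists_unitIdele_eq h2
      have h3 : ν.1 (infIdele (infPart (ideleNorm K x))) = 1 := by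
        obtain ⟨t, ht⟩ := exists_sq_eq_infinite (infPart x)
        rw [hc.infIdele_infPart_ideleNorm, ← ht, map_pow, map_pow, map_pow, hν]
      rw [hΦ, hy, map_mul, h3, one_mul, hT T subset_rfl]
      refine Finset.prod_eq_one fun P hP ↦ ?_
      refine hN P (y P) (((hϖ P).pow_dvd_iff _).2 ?_)
      rw [coe_sub_one, ← coe_intUnits, hy']
      have hM' := hM P hP
      have hg1 : g P ∈ T' := Finset.mem_union_left _ (Finset.mem_image_of_mem _ hP)
      have hg2 : placeBelow (c : K →+* K) (g P) ∈ T' :=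
        Finset.mem_union_right _ (Finset.mem_image_of_mem (fun P ↦ placeBelow (c : K →+* K) (g P)) hP)
      have h4 := (hx _).2 hg1
      have h5 := (hx _).2 hg2
      refine le_of_pow_le_pow_left₀ (he P) zero_le ?_
      rw [← hve, map_sub, map_one, hc.finComp_ideleNorm x (hg P) rfl, ← WithZero.exp_nsmul]
      obtain ⟨e', he', hv'⟩ := exists_valued_localMapOver
        (rfl : placeBelow (c : K →+* K) (g P) = placeBelow (c : K →+* K) (g P))
      have h6 : ∀ a b : (g P).adicCompletion K, a * b - 1 = a * (b - 1) + (a - 1) := fun a b ↦ by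
        ring
      rw [h6]
      have h7 : WithZero.exp (-(M : ℤ)) ≤ WithZero.exp (e P • (-(N P : ℤ))) := by
        rw [WithZero.exp_le_exp, nsmul_eq_mul, mul_neg, neg_le_neg_iff]
        exact_mod_cast hM'
      refine Valuation.map_add_le _ ?_ (h4.trans h7)
      rw [map_mul, (hx _).1, one_mul, ← map_one (localMapOver (c : K →+* K) rfl), ← map_sub, hv']
      refine ((pow_le_of_le_one zero_le (h5.trans ?_) he').trans h5).trans h7
      rw [← WithZero.exp_zero, WithZero.exp_le_exp]
      omega
    rw [ContinuousAt, map_one]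
    exact tendsto_const_nhds.congr' (h1.mono fun x hx ↦ hx.symm)
  refine ⟨⟨⟨Φ, hcont⟩, fun a ↦ ?_⟩, fun x ↦ rfl⟩
  change ν.1 (ideleNorm K (principalIdele K a)) = 1
  -- The norm of the principal idele of a is the principal idele of the rational number a · c(a).
  obtain ⟨q, hq⟩ := hc.exists_rat ((a : K) * c a) (by rw [map_mul, hc.apply_apply, mul_comm])
  have hq0 : q ≠ 0 := by
    rintro rfl
    rw [map_zero, eq_comm, mul_eq_zero, or_iff_right a.ne_zero] at hq
    exact a.ne_zero ((map_eq_zero c).1 hq)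
  have : ideleNorm K (principalIdele K a) = principalIdele ℚ (Units.mk0 q hq0) := by
    apply Units.ext
    apply adeleMap_injective (algebraMap ℚ K)
    rw [hc.adeleMap_ideleNorm]
    change algebraMap K _ (a : K) * adeleMap (c : K →+* K) (algebraMap K _ (a : K)) =
      adeleMap (algebraMap ℚ K) (algebraMap ℚ _ q)
    rw [adeleMap_algebraMap, adeleMap_algebraMap, hq, map_mul]
    rfl
  rw [this, ν.2]

theorem IsConjugation.unitComponent_baseChange_of_eq (hc : IsConjugation c) {ν : IdeleClassChar ℚ}
    {μ : IdeleClassChar K} (hμ : ∀ x, μ.1 x = ν.1 (ideleNorm K x))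
    {w : HeightOneSpectrum (𝓞 K)} {P : HeightOneSpectrum (𝓞 ℚ)}
    (h : placeBelow (algebraMap ℚ K) w = P) (h' : placeBelow (c : K →+* K) w = w)
    (u : (w.adicCompletionIntegers K)ˣ) (n : (P.adicCompletionIntegers ℚ)ˣ)
    (hn : localMapOver (algebraMap ℚ K) h (n : P.adicCompletionIntegers ℚ) =
      ((u : w.adicCompletionIntegers K) : w.adicCompletion K) *
        localMapOver (c : K →+* K) h' (u : w.adicCompletionIntegers K)) :
    unitComponent μ w u = unitComponent ν P n := by
  change μ.1 (localIdele w (intUnits w u)) = ν.1 (localIdele P (intUnits P n))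
  rw [hμ, hc.ideleNorm_localIdele_of_eq h h' (intUnits w u) (intUnits P n) hn]

theorem IsConjugation.unitComponent_baseChange_of_ne (hc : IsConjugation c) {ν : IdeleClassChar ℚ}
    {μ : IdeleClassChar K} (hμ : ∀ x, μ.1 x = ν.1 (ideleNorm K x))
    {w : HeightOneSpectrum (𝓞 K)} {P : HeightOneSpectrum (𝓞 ℚ)}
    (h : placeBelow (algebraMap ℚ K) w = P) (h' : placeBelow (c : K →+* K) w ≠ w)
    (u : (w.adicCompletionIntegers K)ˣ) (n : (P.adicCompletionIntegers ℚ)ˣ)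
    (hn : localMapOver (algebraMap ℚ K) h (n : P.adicCompletionIntegers ℚ) =
      ((u : w.adicCompletionIntegers K) : w.adicCompletion K)) :
    unitComponent μ w u = unitComponent ν P n := by
  change μ.1 (localIdele w (intUnits w u)) = ν.1 (localIdele P (intUnits P n))
  rw [hμ, hc.ideleNorm_localIdele_of_ne h h' (intUnits w u) (intUnits P n) hn]

theorem subsingleton_infinitePlace {K : Type*} [Field K] [NumberField K]
    (hdeg : Module.finrank ℚ K = 2) [IsTotallyComplex K] : Subsingleton (InfinitePlace K) := by
  have h1 := InfinitePlace.card_add_two_mul_card_eq_rank K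
  have h2 := IsTotallyComplex.nrRealPlaces_eq_zero K
  have h3 := InfinitePlace.card_eq_nrRealPlaces_add_nrComplexPlaces K
  rw [← Fintype.card_le_one_iff_subsingleton]
  omega

end Norm

end IdeleClass

namespace IdeleClass

/-! ### Places above rational primes -/

section Places

variable {F : Type*} [Field F] [NumberField F] {v : HeightOneSpectrum (𝓞 F)} {p : ℕ}

theorem exists_prime_isAbove (v : HeightOneSpectrum (𝓞 F)) : ∃ p : ℕ, p.Prime ∧ IsAbove v p := by
  have := v.isMaximal
  obtain ⟨p, n, -, -, hp, hn⟩ := Ideal.exists_prime_and_absNorm_eq_pow v.asIdeal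
  refine ⟨p, hp, ?_⟩
  have h := Ideal.absNorm_mem v.asIdeal
  rw [hn, Nat.cast_pow] at h
  exact v.isPrime.mem_of_pow_mem _ h

omit [NumberField F] in
theorem IsAbove.intCast_mem_iff (h : IsAbove v p) (hp : p.Prime) (n : ℤ) :
    (n : 𝓞 F) ∈ v.asIdeal ↔ (p : ℤ) ∣ n := by
  constructor
  · intro hn
    by_contra hc
    rw [← (Nat.prime_iff_prime_int.1 hp).coprime_iff_not_dvd] at hc
    obtain ⟨a, b, hab⟩ := hc
    refine v.isPrime.ne_top ((Ideal.eq_top_iff_one _).2 ?_)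
    have h1 := congrArg (fun z : ℤ ↦ (z : 𝓞 F)) hab
    push_cast at h1
    rw [← h1]
    exact Ideal.add_mem _ (Ideal.mul_mem_left _ _ h) (Ideal.mul_mem_left _ _ hn)
  · rintro ⟨m, rfl⟩
    rw [Int.cast_mul, Int.cast_natCast]
    exact Ideal.mul_mem_right _ _ h

omit [NumberField F] in
theorem IsAbove.eq {q : ℕ} (h : IsAbove v p) (h' : IsAbove v q) (hp : p.Prime) (hq : q.Prime) :
    p = q := by
  have h1 := (h.intCast_mem_iff hp q).1 (by rw [Int.cast_natCast]; exact h')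
  exact (Nat.prime_dvd_prime_iff_eq hp hq).1 (Int.natCast_dvd_natCast.1 h1)

omit [NumberField F] in
theorem isAbove_placeBelow {L : Type*} [Field L] [NumberField L] (f : F →+* L)
    (w : HeightOneSpectrum (𝓞 L)) : IsAbove (placeBelow f w) p ↔ IsAbove w p := by
  unfold IsAbove placeBelow
  rw [Ideal.mem_comap, map_natCast]

theorem IsAbove.dvd (h : IsAbove v p) : v.asIdeal ∣ Ideal.span {(p : 𝓞 F)} := by
  rw [Ideal.dvd_iff_le, Ideal.span_singleton_le_iff_mem]
  exact h

theorem isAbove_of_dvd (h : v.asIdeal ∣ Ideal.span {(p : 𝓞 F)}) : IsAbove v p := by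
  rw [Ideal.dvd_iff_le, Ideal.span_singleton_le_iff_mem] at h
  exact h

theorem eq_of_asIdeal_dvd {w : HeightOneSpectrum (𝓞 F)} (h : v.asIdeal ∣ w.asIdeal) : v = w :=
  (asIdeal_eq_of_le (Ideal.dvd_iff_le.1 h)).symm

theorem isUniformizer_algebraMap {a : 𝓞 F} (h1 : a ∈ v.asIdeal) (h2 : a ∉ v.asIdeal ^ 2) :
    IsUniformizer (algebraMap (𝓞 F) (v.adicCompletionIntegers F) a) := by
  rw [← pow_one v.asIdeal, ← valued_integer_le_iff] at h1
  rw [← valued_integer_le_iff, not_le] at h2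
  have h0 : Valued.v (algebraMap F (v.adicCompletion F) (a : F)) ≠ 0 := by
    intro h
    rw [h] at h2
    exact not_lt_zero h2
  refine le_antisymm h1 ?_
  change _ ≤ Valued.v (algebraMap F (v.adicCompletion F) (a : F))
  rw [← WithZero.le_log_iff_exp_le h0]
  rw [← WithZero.lt_log_iff_exp_lt h0] at h2
  push_cast at h2
  omega

theorem not_dvd_sq_of_mul {I J : Ideal (𝓞 F)} (h : I = v.asIdeal * J) (hJ : ¬ v.asIdeal ∣ J) :
    ¬ v.asIdeal ^ 2 ∣ I := by
  rw [h, pow_two]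
  exact fun h' ↦ hJ ((mul_dvd_mul_iff_left v.ne_bot).1 h')

theorem isUniformizer_natCast {J : Ideal (𝓞 F)} (h : Ideal.span {(p : 𝓞 F)} = v.asIdeal * J)
    (hJ : ¬ v.asIdeal ∣ J) : IsUniformizer (p : v.adicCompletionIntegers F) := by
  have h1 := not_dvd_sq_of_mul h hJ
  rw [Ideal.dvd_iff_le, Ideal.span_singleton_le_iff_mem] at h1
  rw [← map_natCast (algebraMap (𝓞 F) (v.adicCompletionIntegers F))]
  exact isUniformizer_algebraMap (isAbove_of_dvd ⟨J, h⟩) h1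

theorem not_asIdeal_dvd_one : ¬ v.asIdeal ∣ 1 := fun h ↦
  v.isPrime.ne_top (by rwa [Ideal.dvd_iff_le, Ideal.one_eq_top, top_le_iff] at h)

end Places

/-! ### Decomposition of primes in a quadratic field -/

section Quadratic

variable {K : Type*} [Field K] [NumberField K] {v w : HeightOneSpectrum (𝓞 K)} {p : ℕ}

theorem absNorm_span_prime (hdeg : Module.finrank ℚ K = 2) :
    Ideal.absNorm (Ideal.span {(p : 𝓞 K)}) = p ^ 2 := by
  rw [Ideal.absNorm_span_natCast, RingOfIntegers.rank, hdeg]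

theorem IsAbove.absNorm_eq (hdeg : Module.finrank ℚ K = 2) (h : IsAbove v p)
    (hp : p.Prime) :
    Ideal.absNorm v.asIdeal = p ∨ Ideal.absNorm v.asIdeal = p ^ 2 := by
  have h1 := Ideal.absNorm_dvd_absNorm_of_le (Ideal.dvd_iff_le.1 h.dvd)
  rw [absNorm_span_prime hdeg, Nat.dvd_prime_pow hp] at h1
  obtain ⟨k, hk, h2⟩ := h1
  interval_cases k
  · rw [pow_zero, Ideal.absNorm_eq_one_iff] at h2
    exact absurd h2 v.isPrime.ne_top
  · rw [pow_one] at h2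
    exact Or.inl h2
  · exact Or.inr h2

theorem IsAbove.prime_dvd_absNorm (hdeg : Module.finrank ℚ K = 2) (h : IsAbove v p)
    (hp : p.Prime) : p ∣ Ideal.absNorm v.asIdeal := by
  rcases h.absNorm_eq hdeg hp with h | h <;> rw [h]
  exact dvd_pow_self _ two_ne_zero

/-- The ideal (p) has norm p² and every prime above p has norm divisible by p, so two prime factors
exhaust (p). -/
theorem eq_mul_of_dvd (hdeg : Module.finrank ℚ K = 2) (hp : p.Prime)
    (hv : IsAbove v p) (hw : IsAbove w p) (h : v.asIdeal * w.asIdeal ∣ Ideal.span {(p : 𝓞 K)}) :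
    Ideal.span {(p : 𝓞 K)} = v.asIdeal * w.asIdeal ∧ Ideal.absNorm v.asIdeal = p := by
  obtain ⟨J, hJ⟩ := h
  have h1 := congrArg Ideal.absNorm hJ
  rw [absNorm_span_prime hdeg, map_mul, map_mul] at h1
  obtain ⟨a, ha⟩ := hv.prime_dvd_absNorm hdeg hp
  obtain ⟨b, hb⟩ := hw.prime_dvd_absNorm hdeg hp
  have h2 : a * b * Ideal.absNorm J = 1 := by
    apply Nat.eq_of_mul_eq_mul_left (pow_pos hp.pos 2)
    rw [mul_one]
    refine Eq.trans ?_ h1.symm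
    rw [ha, hb]
    ring
  have h3 : Ideal.absNorm J = 1 := Nat.eq_one_of_mul_eq_one_left h2
  rw [h3, mul_one] at h2
  rw [Ideal.absNorm_eq_one_iff] at h3
  rw [h3, ← Ideal.one_eq_top, mul_one] at hJ
  exact ⟨hJ, by rw [ha, Nat.eq_one_of_mul_eq_one_right h2, mul_one]⟩

/-- The decomposition of a rational prime in a quadratic field. -/
theorem IsAbove.trichotomy (hdeg : Module.finrank ℚ K = 2) (h : IsAbove v p)
    (hp : p.Prime) :
    Ideal.span {(p : 𝓞 K)} = v.asIdeal ∨ Ideal.span {(p : 𝓞 K)} = v.asIdeal ^ 2 ∨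
      ∃ w ≠ v, Ideal.span {(p : 𝓞 K)} = v.asIdeal * w.asIdeal := by
  obtain ⟨J, hJ⟩ := h.dvd
  by_cases hJ1 : J = ⊤
  · left
    rw [hJ, hJ1, ← Ideal.one_eq_top, mul_one]
  · right
    obtain ⟨M, hM, hJM⟩ := Ideal.exists_le_maximal J hJ1
    have hJ0 : J ≠ ⊥ := by
      rintro rfl
      rw [Ideal.mul_bot, Ideal.span_singleton_eq_bot] at hJ
      exact hp.ne_zero (by exact_mod_cast hJ)
    let w : HeightOneSpectrum (𝓞 K) := ⟨M, hM.isPrime, fun hb ↦ hJ0 (le_bot_iff.1 (hb ▸ hJM))⟩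
    have h1 : v.asIdeal * w.asIdeal ∣ Ideal.span {(p : 𝓞 K)} := by
      rw [hJ]
      exact mul_dvd_mul_left _ (Ideal.dvd_iff_le.2 hJM)
    have h2 := (eq_mul_of_dvd hdeg hp h (isAbove_of_dvd ((dvd_mul_left _ _).trans h1)) h1).1
    by_cases hw : w = v
    · left
      rw [h2, hw, pow_two]
    · right
      exact ⟨w, hw, h2⟩

theorem IsAbove.isInert_iff (h : IsAbove v p) (hp : p.Prime) :
    IsInert K p ↔ Ideal.span {(p : 𝓞 K)} = v.asIdeal := by
  constructor
  · intro hi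
    have h0 : Ideal.span {(p : 𝓞 K)} ≠ ⊥ := by
      rw [ne_eq, Ideal.span_singleton_eq_bot]
      exact_mod_cast hp.ne_zero
    exact congrArg HeightOneSpectrum.asIdeal
      (asIdeal_eq_of_le (v := ⟨_, hi, h0⟩) (w := v) (Ideal.dvd_iff_le.1 h.dvd))
  · intro hi
    unfold IsInert
    rw [hi]
    exact v.isPrime

theorem IsAbove.ramifies_iff (hdeg : Module.finrank ℚ K = 2) (h : IsAbove v p)
    (hp : p.Prime) :
    Ramifies K p ↔ Ideal.span {(p : 𝓞 K)} = v.asIdeal ^ 2 := by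
  constructor
  · rintro ⟨w, hw⟩
    have hwp : IsAbove w p := isAbove_of_dvd ((dvd_pow_self _ two_ne_zero).trans hw)
    rw [pow_two] at hw
    have h1 := (eq_mul_of_dvd hdeg hp hwp hwp hw).1
    have h2 := h.dvd
    rw [h1] at h2
    obtain rfl : v = w := (v.prime.dvd_or_dvd h2).elim eq_of_asIdeal_dvd eq_of_asIdeal_dvd
    rw [h1, pow_two]
  · intro h'
    exact ⟨v, dvd_of_eq h'.symm⟩

variable {c : K ≃ₐ[ℚ] K}

theorem IsConjugation.exists_int (hc : IsConjugation c) {a : 𝓞 K} (ha : c a = a) :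
    ∃ n : ℤ, a = n := by
  obtain ⟨q, hq⟩ := hc.exists_rat (a : K) ha
  have h1 : IsIntegral ℤ q := by
    refine (isIntegral_algebraMap_iff (algebraMap ℚ K).injective).1 ?_
    rw [hq]
    exact a.isIntegral_coe
  obtain ⟨n, hn⟩ := IsIntegrallyClosed.isIntegral_iff.1 h1
  refine ⟨n, RingOfIntegers.coe_injective ?_⟩
  refine hq.symm.trans ?_
  rw [← hn]
  simp

theorem IsConjugation.exists_int_norm (hc : IsConjugation c) (a : 𝓞 K) :
    ∃ n : ℤ, a * RingOfIntegers.mapRingHom (c : K →+* K) a = n := by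
  refine hc.exists_int ?_
  change c ((a : K) * c a) = (a : K) * c a
  rw [map_mul, hc.apply_apply, mul_comm]

/-- Take a in v but not in w. Its norm a · c(a) is a rational integer in v, hence divisible by p,
hence in w, so c(a) ∈ w. The conjugate of w is v or w and contains a, so it is v. -/
theorem IsConjugation.placeBelow_eq_of_span (hc : IsConjugation c) {w : HeightOneSpectrum (𝓞 K)}
    (hp : p.Prime) (hw : w ≠ v) (h : Ideal.span {(p : 𝓞 K)} = v.asIdeal * w.asIdeal) :
    placeBelow (c : K →+* K) v = w := by
  have hv : IsAbove v p := isAbove_of_dvd ⟨_, h⟩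
  have hwp : IsAbove w p := isAbove_of_dvd ⟨_, h.trans (mul_comm _ _)⟩
  obtain ⟨a, ha, ha'⟩ : ∃ a ∈ v.asIdeal, a ∉ w.asIdeal := by
    by_contra! hcon
    exact hw (asIdeal_eq_of_le (v := v) (w := w) hcon).symm
  obtain ⟨n, hn⟩ := hc.exists_int_norm a
  have h1 : (n : 𝓞 K) ∈ v.asIdeal := by
    rw [← hn]
    exact Ideal.mul_mem_right _ _ ha
  rw [hv.intCast_mem_iff hp, ← hwp.intCast_mem_iff hp, ← hn] at h1
  have h2 : a ∈ (placeBelow (c : K →+* K) w).asIdeal := (w.isPrime.mem_or_mem h1).resolve_left ha'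
  have h3 : IsAbove (placeBelow (c : K →+* K) w) p := (isAbove_placeBelow _ _).2 hwp
  have h4 := h3.dvd
  rw [h] at h4
  rcases (placeBelow (c : K →+* K) w).prime.dvd_or_dvd h4 with h5 | h5
  · rw [← eq_of_asIdeal_dvd h5, hc.placeBelow_placeBelow]
  · rw [eq_of_asIdeal_dvd h5] at h2
    exact absurd h2 ha'

theorem IsAbove.span_eq_of_placeBelow_ne (hdeg : Module.finrank ℚ K = 2) (h : IsAbove v p)
    (hp : p.Prime)
    (hv : placeBelow (c : K →+* K) v ≠ v) :
    Ideal.span {(p : 𝓞 K)} = v.asIdeal * (placeBelow (c : K →+* K) v).asIdeal ∧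
      Ideal.absNorm v.asIdeal = p := by
  have h' : IsAbove (placeBelow (c : K →+* K) v) p := (isAbove_placeBelow _ _).2 h
  refine eq_mul_of_dvd hdeg hp h h' ?_
  obtain ⟨J, hJ⟩ := h.dvd
  have h2 := h'.dvd
  rw [hJ] at h2 ⊢
  refine mul_dvd_mul_left _ ?_
  exact ((placeBelow (c : K →+* K) v).prime.dvd_or_dvd h2).resolve_left
    fun h3 ↦ hv (eq_of_asIdeal_dvd h3)

theorem IsConjugation.splits_iff (hc : IsConjugation c) (hdeg : Module.finrank ℚ K = 2)
    (h : IsAbove v p) (hp : p.Prime) :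
    Splits K p ↔ placeBelow (c : K →+* K) v ≠ v := by
  constructor
  · rintro ⟨w, w', hw, h1⟩
    have h2 := h.dvd
    rw [h1] at h2
    rcases v.prime.dvd_or_dvd h2 with h3 | h3
    · obtain rfl := eq_of_asIdeal_dvd h3
      rw [hc.placeBelow_eq_of_span hp hw.symm h1]
      exact hw.symm
    · obtain rfl := eq_of_asIdeal_dvd h3
      rw [hc.placeBelow_eq_of_span hp hw (h1.trans (mul_comm _ _))]
      exact hw
  · intro h1
    exact ⟨v, _, h1.symm, (h.span_eq_of_placeBelow_ne hdeg hp h1).1⟩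

/-- Each place is inert, ramified or split. -/
theorem IsAbove.inert_or_ramifies_or_splits (hdeg : Module.finrank ℚ K = 2) (h : IsAbove v p)
    (hp : p.Prime) :
    IsInert K p ∨ Ramifies K p ∨ Splits K p := by
  rcases h.trichotomy hdeg hp with h1 | h1 | ⟨w, hw, h1⟩
  · exact Or.inl ((h.isInert_iff hp).2 h1)
  · exact Or.inr (Or.inl ((h.ramifies_iff hdeg hp).2 h1))
  · exact Or.inr (Or.inr ⟨v, w, hw.symm, h1⟩)

theorem IsAbove.not_ramifies_of_isInert (hdeg : Module.finrank ℚ K = 2) (h : IsAbove v p)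
    (hp : p.Prime) (hi : IsInert K p) : ¬ Ramifies K p := by
  rw [h.ramifies_iff hdeg hp, (h.isInert_iff hp).1 hi]
  intro h1
  have h2 : v.asIdeal * v.asIdeal ∣ v.asIdeal * 1 := by rw [mul_one, ← pow_two]; exact dvd_of_eq h1.symm
  exact not_asIdeal_dvd_one ((mul_dvd_mul_iff_left v.ne_bot).1 h2)

theorem IsAbove.placeBelow_eq_of_isInert (hdeg : Module.finrank ℚ K = 2) (h : IsAbove v p)
    (hp : p.Prime) (hi : IsInert K p) :
    placeBelow (c : K →+* K) v = v := by
  by_contra hne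
  have h1 := (h.span_eq_of_placeBelow_ne hdeg hp hne).1
  rw [(h.isInert_iff hp).1 hi] at h1
  have h2 : v.asIdeal * (placeBelow (c : K →+* K) v).asIdeal ∣ v.asIdeal * 1 := by
    rw [mul_one, ← h1]
  have h3 := (mul_dvd_mul_iff_left v.ne_bot).1 h2
  exact not_asIdeal_dvd_one h3

theorem IsAbove.placeBelow_eq_of_ramifies (hdeg : Module.finrank ℚ K = 2) (h : IsAbove v p)
    (hp : p.Prime) (hi : Ramifies K p) :
    placeBelow (c : K →+* K) v = v := by
  have h' : IsAbove (placeBelow (c : K →+* K) v) p := (isAbove_placeBelow _ _).2 h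
  have h1 := h'.dvd
  rw [(h.ramifies_iff hdeg hp).1 hi] at h1
  exact eq_of_asIdeal_dvd ((placeBelow (c : K →+* K) v).prime.dvd_of_dvd_pow h1)

end Quadratic

end IdeleClass

namespace IdeleClass

/-! ### K is generated by √-q, with q = 2 or q ≡ 3 mod 4 -/

section Structure

variable {K : Type*} [Field K] [NumberField K] {c : K ≃ₐ[ℚ] K}

omit [NumberField K] in
-- Both admissible unit groups have exponent dividing 6. The form u³ = ±1 is what is used: a
-- character with values ±1 agrees at u and u³, and a square root of -1 is excluded.
theorem unit_cube {u : (𝓞 K)ˣ}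
    (hunits : (∀ u : (𝓞 K)ˣ, u = 1 ∨ u = -1) ∨
      ∃ u : (𝓞 K)ˣ, IsPrimitiveRoot u 6 ∧ Subgroup.zpowers u = ⊤) : u ^ 3 = 1 ∨ u ^ 3 = -1 := by
  rcases hunits with h | ⟨g, hg, htop⟩
  · rcases h u with rfl | rfl
    · exact Or.inl (one_pow 3)
    · exact Or.inr (Odd.neg_one_pow (by decide))
  · obtain ⟨k, rfl⟩ := Subgroup.mem_zpowers_iff.1 (htop ▸ Subgroup.mem_top u)
    have h1 : (g ^ k) ^ 6 = 1 := by
      rw [← zpow_natCast, ← zpow_mul, mul_comm, zpow_mul, zpow_natCast, hg.pow_eq_one, one_zpow]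
    have h2 : ((((g ^ k) ^ 3 : (𝓞 K)ˣ) : 𝓞 K)) ^ 2 = 1 := by
      rw [← Units.val_pow_eq_pow_val, ← pow_mul, h1, Units.val_one]
    rcases sq_eq_one_iff.1 h2 with h3 | h3
    · exact Or.inl (Units.ext h3)
    · exact Or.inr (Units.ext h3)

theorem IsConjugation.exists_rat_mul (hc : IsConjugation c) {x t : K} (ht0 : t ≠ 0)
    (ht : c t = -t) (hx : c x = -x) : ∃ r : ℚ, x = algebraMap ℚ K r * t := by
  obtain ⟨r, hr⟩ := hc.exists_rat (x / t) (by rw [map_div₀, ht, hx, neg_div_neg_eq])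
  exact ⟨r, by rw [hr, div_mul_cancel₀ _ ht0]⟩

theorem IsConjugation.exists_conj_eq_neg (hc : IsConjugation c) :
    ∃ t : 𝓞 K, t ≠ 0 ∧ c t = -(t : K) := by
  obtain ⟨k, hk⟩ := hc.exists_ne
  obtain ⟨a, ha⟩ : ∃ a : 𝓞 K, c a ≠ a := by
    by_contra! h
    obtain ⟨a, b, -, rfl⟩ := IsFractionRing.div_surjective (A := 𝓞 K) k
    exact hk (by rw [map_div₀, h, h])
  refine ⟨a - RingOfIntegers.mapRingHom (c : K →+* K) a, fun h ↦ ha ?_, ?_⟩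
  · rw [sub_eq_zero] at h
    exact (congrArg (algebraMap (𝓞 K) K) h).symm
  · change c ((a : K) - c a) = -((a : K) - c a)
    rw [map_sub, hc.apply_apply, neg_sub]

/-- If n ≥ 0, a complex embedding sends t to a real number, hence is real on K = ℚ + ℚt, although K
is totally complex. -/
theorem IsConjugation.neg_of_sq_eq [IsTotallyComplex K] (hc : IsConjugation c) {t : 𝓞 K}
    (ht0 : t ≠ 0) (ht : c t = -(t : K)) {n : ℤ} (hn : t ^ 2 = n) : n < 0 := by
  by_contra! hn0
  have ht0' : (t : K) ≠ 0 := by simpa using ht0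
  obtain ⟨w⟩ : Nonempty (InfinitePlace K) := inferInstance
  refine InfinitePlace.not_isReal_iff_isComplex.2 (IsTotallyComplex.isComplex w) ?_
  rw [InfinitePlace.isReal_iff, ComplexEmbedding.isReal_iff]
  have h1 : w.embedding (t : K) ^ 2 = (((n : ℝ) : ℂ)) := by
    have := congrArg (fun z : 𝓞 K ↦ w.embedding (z : K)) hn
    simpa using this
  have h2 : (starRingEnd ℂ) (w.embedding (t : K)) = w.embedding (t : K) := by
    have h3 : (w.embedding (t : K)) ^ 2 = ((Real.sqrt n : ℝ) : ℂ) ^ 2 := by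
      rw [h1, ← Complex.ofReal_pow, Real.sq_sqrt (by exact_mod_cast hn0)]
    rcases sq_eq_sq_iff_eq_or_eq_neg.1 h3 with h4 | h4 <;> simp [h4]
  ext x
  obtain ⟨r, hr⟩ := hc.exists_rat_mul (x := x - c x) ht0' ht (by
    rw [map_sub, hc.apply_apply, neg_sub])
  obtain ⟨r', hr'⟩ := hc.exists_rat_add x
  obtain ⟨a, b, h3⟩ : ∃ a b : ℚ, x = algebraMap ℚ K a + algebraMap ℚ K b * t := by
    refine ⟨r' / 2, r / 2, ?_⟩
    have : algebraMap ℚ K r * t = algebraMap ℚ K (r / 2) * t * 2 := by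
      rw [map_div₀, map_ofNat]; field_simp
    rw [this] at hr
    rw [map_div₀, hr', map_ofNat]
    field_simp
    linear_combination hr
  rw [h3]
  simp [ComplexEmbedding.conjugate_coe_eq, h2]

/-- With class number 2k + 1, the ideal I^(2k+1) = p^k I is principal, so I = (a) and a²u = p for a
unit u. Then (au²)² = pu³ = ±p. -/
theorem exists_sq_eq_or_neg (hodd : Odd (classNumber K))
    (hu : ∀ u : (𝓞 K)ˣ, u ^ 3 = 1 ∨ u ^ 3 = -1) {p : ℕ} (hp : p.Prime) {I : Ideal (𝓞 K)}
    (hI : I ^ 2 = Ideal.span {(p : 𝓞 K)}) : ∃ β : 𝓞 K, β ^ 2 = p ∨ β ^ 2 = -p := by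
  have hp0 : (p : 𝓞 K) ≠ 0 := by exact_mod_cast hp.ne_zero
  have hI0 : I ≠ ⊥ := by
    rintro rfl
    rw [← Ideal.zero_eq_bot, zero_pow two_ne_zero, Ideal.zero_eq_bot, eq_comm,
      Ideal.span_singleton_eq_bot] at hI
    exact hp0 hI
  obtain ⟨k, hk⟩ := hodd
  obtain ⟨b, hb⟩ := isPrincipal_pow_classNumber I hI0
  have hb : I ^ classNumber K = Ideal.span {b} := hb
  rw [hk, pow_succ, pow_mul, hI, Ideal.span_singleton_pow] at hb
  obtain ⟨a, -, ha⟩ : ∃ z ∈ I, (p : 𝓞 K) ^ k * z = b := by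
    rw [← Ideal.mem_span_singleton_mul, hb]
    exact Ideal.mem_span_singleton_self b
  have hIa : I = Ideal.span {a} := by
    rw [← ha, ← Ideal.span_singleton_mul_span_singleton] at hb
    refine mul_left_cancel₀ ?_ hb
    rw [Ideal.zero_eq_bot, ne_eq, Ideal.span_singleton_eq_bot]
    exact pow_ne_zero _ hp0
  rw [hIa, Ideal.span_singleton_pow, Ideal.span_singleton_eq_span_singleton] at hI
  obtain ⟨u, hu'⟩ := hI
  refine ⟨a * u ^ 2, ?_⟩
  have h1 : (a * (u : 𝓞 K) ^ 2) ^ 2 = p * (u ^ 3 : (𝓞 K)ˣ) := by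
    rw [← hu', Units.val_pow_eq_pow_val]; ring
  rcases hu u with h | h <;> simp [h1, h]

/-- The data describing an imaginary quadratic field of odd class number with unit group `{±1}` or
`μ₆`: it is generated by a square root `s` of `-q`, with `q = 2` or a prime `q ≡ 3 mod 4`. -/
structure IsQuadraticData (c : K ≃ₐ[ℚ] K) (s : 𝓞 K) (q : ℕ) : Prop where
  finrank : Module.finrank ℚ K = 2
  conj : IsConjugation c
  odd : Odd (classNumber K)
  units : ∀ u : (𝓞 K)ˣ, u ^ 3 = 1 ∨ u ^ 3 = -1
  prime : q.Prime
  mod_four : q = 2 ∨ q % 4 = 3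
  sq : s ^ 2 = -q
  conj_sqrt : c s = -(s : K)
  eq_of_ramifies : ∀ p : ℕ, p.Prime → Ramifies K p → p = q

/-- Let m be least such that -m is the square of a nonzero integer s with c(s) = -s. Minimality
makes m squarefree, and m ≠ 1 because a square root i of -1 is a unit with i³ ≠ ±1. If (p) is the
square of an ideal, `exists_sq_eq_or_neg` puts a square root of -p in K, whence m ≤ p. This applies
to (p, s) for a prime p ∣ m, so m = p, and to (2, 1 + s) if m ≡ 1 mod 4, which would give m ≤ 2. -/
theorem exists_isQuadraticData [IsTotallyComplex K] (hdeg : Module.finrank ℚ K = 2)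
    (hodd : Odd (classNumber K))
    (hunits : (∀ u : (𝓞 K)ˣ, u = 1 ∨ u = -1) ∨
      ∃ u : (𝓞 K)ˣ, IsPrimitiveRoot u 6 ∧ Subgroup.zpowers u = ⊤)
    (hc1 : c ≠ 1) : ∃ (s : 𝓞 K) (q : ℕ), IsQuadraticData c s q := by
  classical
  have hc := isConjugation_of_finrank hdeg hc1
  have hu : ∀ u : (𝓞 K)ˣ, u ^ 3 = 1 ∨ u ^ 3 = -1 := fun u ↦ unit_cube hunits
  have hex : ∃ m : ℕ, ∃ t : 𝓞 K, t ≠ 0 ∧ c t = -(t : K) ∧ t ^ 2 = -m := by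
    obtain ⟨t, ht0, ht⟩ := hc.exists_conj_eq_neg
    obtain ⟨n, hn⟩ := hc.exists_int (a := t ^ 2) (by
      change c ((t : K) ^ 2) = (t : K) ^ 2
      rw [map_pow, ht, neg_sq])
    have := hc.neg_of_sq_eq ht0 ht hn
    obtain ⟨m, rfl⟩ : ∃ m : ℕ, n = -m := ⟨n.natAbs, by omega⟩
    exact ⟨m, t, ht0, ht, by rw [hn]; simp⟩
  obtain ⟨s, hs0, hs, hsq⟩ := Nat.find_spec hex
  set m := Nat.find hex with hm
  have hmin : ∀ n : ℕ, (∃ t : 𝓞 K, t ≠ 0 ∧ c t = -(t : K) ∧ t ^ 2 = -n) → m ≤ n :=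
    fun n hn ↦ Nat.find_min' hex hn
  have hs0' : (s : K) ≠ 0 := by simpa using hs0
  have hsqK : (s : K) ^ 2 = -m := by
    have := congrArg (algebraMap (𝓞 K) K) hsq
    simpa using this
  have hm0 : m ≠ 0 := by
    intro h
    rw [h] at hsq
    simp [hs0] at hsq
  -- a square root of `±p` for a prime `p` is a square root of `-p`
  have hroot : ∀ (p : ℕ), p.Prime → (∃ I : Ideal (𝓞 K), I ^ 2 = Ideal.span {(p : 𝓞 K)}) →
      ∃ β : 𝓞 K, β ≠ 0 ∧ c β = -(β : K) ∧ β ^ 2 = -p := by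
    rintro p hp ⟨I, hI⟩
    obtain ⟨β, hβ⟩ := exists_sq_eq_or_neg hodd hu hp hI
    have hβ0 : β ≠ 0 := by
      rintro rfl
      have := hp.ne_zero
      rcases hβ with h | h <;> simp [this, eq_comm] at h
    have hβc : c β = -(β : K) := by
      have h1 : (c (β : K)) ^ 2 = (β : K) ^ 2 := by
        rw [← map_pow]
        rcases hβ with h | h <;>
        · have := congrArg (algebraMap (𝓞 K) K) h
          rw [map_pow] at this
          rw [this]
          simp
      refine (sq_eq_sq_iff_eq_or_eq_neg.1 h1).resolve_left fun h2 ↦ ?_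
      obtain ⟨n, rfl⟩ := hc.exists_int h2
      have h3 : n * n = p ∨ n * n = -p := by
        rw [pow_two] at hβ
        refine hβ.imp (fun h ↦ by exact_mod_cast h) fun h ↦ ?_
        rw [← Int.cast_natCast p] at h
        exact_mod_cast h
      rcases h3 with h3 | h3
      · exact (Nat.prime_iff_prime_int.1 hp).not_isSquare ⟨n, h3.symm⟩
      · have := hp.pos
        nlinarith [mul_self_nonneg n]
    refine ⟨β, hβ0, hβc, hβ.resolve_left fun h ↦ ?_⟩
    have := hc.neg_of_sq_eq hβ0 hβc (n := p) (by rw [h]; simp)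
    omega
  have hle : ∀ (p : ℕ), p.Prime → (∃ I : Ideal (𝓞 K), I ^ 2 = Ideal.span {(p : 𝓞 K)}) → m ≤ p :=
    fun p hp hI ↦ hmin p (hroot p hp hI)
  have hsf : ∀ p : ℕ, p.Prime → ¬ p * p ∣ m := by
    rintro p hp ⟨k, hk⟩
    have hp0 : (p : K) ≠ 0 := by exact_mod_cast hp.ne_zero
    have h1 : ((s : K) / p) ^ 2 = -k := by
      rw [div_pow, hsqK, hk]
      push_cast
      field_simp
    have h2 : IsIntegral ℤ ((s : K) / p) := by
      refine IsIntegral.of_pow (n := 2) two_pos ?_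
      rw [h1]
      have := isIntegral_algebraMap (R := ℤ) (A := K) (x := -k)
      simpa using this
    let t : 𝓞 K := ⟨_, h2⟩
    have h3 := hmin k ⟨t, fun h ↦ div_ne_zero hs0' hp0 (congrArg (algebraMap (𝓞 K) K) h), by
      change c ((s : K) / p) = -((s : K) / p)
      rw [map_div₀, hs, map_natCast, neg_div], RingOfIntegers.coe_injective (by
        rw [map_pow]
        exact h1.trans (by simp))⟩
    have h4 : 4 ≤ p * p := Nat.mul_le_mul hp.two_le hp.two_le
    have h5 : k ≠ 0 := by rintro rfl; exact hm0 (by rw [hk, mul_zero])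
    have h6 : 4 * k ≤ m := by rw [hk]; exact Nat.mul_le_mul_right k h4
    omega
  have hm1 : m ≠ 1 := by
    intro h
    rw [h, Nat.cast_one] at hsq
    let u : (𝓞 K)ˣ := ⟨s, -s, by rw [mul_neg, ← pow_two, hsq, neg_neg], by
      rw [neg_mul, ← pow_two, hsq, neg_neg]⟩
    have h1 : (s ^ 3) ^ 2 = 1 := by
      rcases hu u with h2 | h2
      · have : s ^ 3 = 1 := congrArg Units.val h2
        rw [this, one_pow]
      · have : s ^ 3 = -1 := congrArg Units.val h2
        rw [this, neg_sq, one_pow]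
    rw [← pow_mul, mul_comm, pow_mul, hsq] at h1
    norm_num at h1
  obtain ⟨p, hp, k, hk⟩ := Nat.exists_prime_and_dvd hm1
  have hpm : m = p := by
    refine le_antisymm (hle p hp ⟨Ideal.span {(p : 𝓞 K), s}, ?_⟩)
      (Nat.le_of_dvd (Nat.pos_of_ne_zero hm0) ⟨k, hk⟩)
    -- As m = pk is squarefree, k is prime to p, so p is a combination of p² and s² = -pk.
    have hcop : IsCoprime (p : ℤ) (k : ℤ) := by
      rw [Nat.isCoprime_iff_coprime, hp.coprime_iff_not_dvd]
      rintro ⟨l, rfl⟩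
      exact hsf p hp ⟨l, by rw [hk, mul_assoc]⟩
    obtain ⟨a, b, hab⟩ := hcop
    have hab' := congrArg (fun z : ℤ ↦ (z : 𝓞 K)) hab
    push_cast at hab'
    have hkO : s ^ 2 = -(p * k) := by rw [hsq, hk]; push_cast; ring
    rw [pow_two, Ideal.span_pair_mul_span_pair]
    apply le_antisymm
    · rw [Ideal.span_le]
      rintro x (rfl | rfl | rfl | rfl) <;> rw [SetLike.mem_coe, Ideal.mem_span_singleton]
      · exact dvd_mul_right _ _
      · exact dvd_mul_right _ _
      · exact dvd_mul_left _ _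
      · exact ⟨-k, by rw [← pow_two, hkO]; ring⟩
    · rw [Ideal.span_singleton_le_iff_mem]
      have e : (p : 𝓞 K) = a * (p * p) + -b * (s * s) := by
        rw [← pow_two s, hkO]
        linear_combination -(p : 𝓞 K) * hab'
      refine (congrArg (· ∈ _) e).mpr ?_
      exact Ideal.add_mem _ (Ideal.mul_mem_left _ _ (Ideal.subset_span (by simp)))
        (Ideal.mul_mem_left _ _ (Ideal.subset_span (by simp)))
  have hmp : m.Prime := hpm ▸ hp
  refine ⟨s, m, hdeg, hc, hodd, hu, hmp, ?_, hsq, hs, fun p hp hr ↦ ?_⟩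
  · rcases hmp.eq_two_or_odd with h2 | h2
    · exact Or.inl h2
    · right
      by_contra h3
      obtain ⟨k, hk⟩ : ∃ k : ℕ, m = 4 * k + 1 := ⟨m / 4, by omega⟩
      have h4 := hle 2 Nat.prime_two ⟨Ideal.span {(2 : 𝓞 K), 1 + s}, ?_⟩
      · have := hmp.two_le
        omega
      have hkO : s ^ 2 = -(4 * k + 1) := by rw [hsq, hk]; push_cast; ring
      rw [pow_two, Ideal.span_pair_mul_span_pair, Nat.cast_ofNat]
      apply le_antisymm
      · rw [Ideal.span_le]
        rintro x (rfl | rfl | rfl | rfl) <;> rw [SetLike.mem_coe, Ideal.mem_span_singleton]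
        · exact dvd_mul_right _ _
        · exact dvd_mul_right _ _
        · exact dvd_mul_left _ _
        · exact ⟨s - 2 * k, by linear_combination hkO⟩
      · rw [Ideal.span_singleton_le_iff_mem]
        have e : (2 : 𝓞 K) = -k * (2 * 2) + (2 * (1 + s) + -1 * ((1 + s) * (1 + s))) := by
          linear_combination hkO
        refine (congrArg (· ∈ _) e).mpr ?_
        exact Ideal.add_mem _ (Ideal.mul_mem_left _ _ (Ideal.subset_span (by simp)))
          (Ideal.add_mem _ (Ideal.subset_span (by simp))
            (Ideal.mul_mem_left _ _ (Ideal.subset_span (by simp))))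
  · obtain ⟨v, hv⟩ := hr
    have hvp : IsAbove v p := isAbove_of_dvd ((dvd_pow_self _ two_ne_zero).trans hv)
    -- Now β² = -p and βs is fixed by c, so it is a rational integer with square pm; two primes
    -- whose product is a square are equal.
    obtain ⟨β, -, hβc, hβ⟩ := hroot p hp
      ⟨v.asIdeal, ((hvp.ramifies_iff hdeg hp).1 ⟨v, hv⟩).symm⟩
    obtain ⟨n, hn⟩ := hc.exists_int (a := β * s) (by
      change c ((β : K) * s) = (β : K) * s
      rw [map_mul, hβc, hs, neg_mul_neg])
    have h1 : (n * n : 𝓞 K) = p * m := by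
      rw [← hn]
      linear_combination s ^ 2 * hβ - p * hsq
    have h2 : n * n = p * m := by exact_mod_cast h1
    have hpi := Nat.prime_iff_prime_int.1 hp
    have h3 : (p : ℤ) ∣ n := (hpi.dvd_or_dvd ⟨_, h2⟩).elim id id
    obtain ⟨l, rfl⟩ := h3
    have h4 : (p : ℤ) ∣ m := ⟨l * l, by
      apply mul_left_cancel₀ hpi.ne_zero
      linear_combination -h2⟩
    exact (Nat.prime_dvd_prime_iff_eq hp hmp).1 (by exact_mod_cast h4)

end Structure

end IdeleClass

namespace IdeleClass

/-! ### Maps of local integers -/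

section IntegerMaps

variable {K L : Type*} [Field K] [NumberField K] [Field L] [NumberField L]
  {f : K →+* L} {v : HeightOneSpectrum (𝓞 K)} {w : HeightOneSpectrum (𝓞 L)}

theorem localMapOver_mem (h : placeBelow f w = v) (x : v.adicCompletionIntegers K) :
    localMapOver f h x ∈ w.adicCompletionIntegers L :=
  (valued_localMapOver_le_one_iff h _).2 x.2

/-- The map of local rings of integers `O_v → O_w` induced by `f : K → L`. -/
def integerMapOver (f : K →+* L) {v : HeightOneSpectrum (𝓞 K)} {w : HeightOneSpectrum (𝓞 L)}
    (h : placeBelow f w = v) : v.adicCompletionIntegers K →+* w.adicCompletionIntegers L :=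
  ((localMapOver f h).comp (v.adicCompletionIntegers K).subtype).codRestrict
    (w.adicCompletionIntegers L).toSubring (localMapOver_mem h)

theorem coe_integerMapOver (h : placeBelow f w = v) (x : v.adicCompletionIntegers K) :
    (integerMapOver f h x : w.adicCompletion L) = localMapOver f h x := rfl

theorem integerMapOver_algebraMap (h : placeBelow f w = v) (a : 𝓞 K) :
    integerMapOver f h (algebraMap (𝓞 K) _ a) =
      algebraMap (𝓞 L) _ (RingOfIntegers.mapRingHom f a) := by
  apply Subtype.ext
  rw [coe_integerMapOver, coe_algebraMap_integers, localMapOver_algebraMap,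
    coe_algebraMap_integers]
  rfl

theorem isUnit_integerMapOver_iff (h : placeBelow f w = v) (x : v.adicCompletionIntegers K) :
    IsUnit (integerMapOver f h x) ↔ IsUnit x := by
  rw [HeightOneSpectrum.adicCompletionIntegers.isUnit_iff_valued_eq_one,
    HeightOneSpectrum.adicCompletionIntegers.isUnit_iff_valued_eq_one, coe_integerMapOver,
    valued_localMapOver_eq_one_iff]

end IntegerMaps

/-! ### Local components under conjugation and norm, and the product formula at -1 -/

section Components

variable {K : Type*} [Field K] [NumberField K] {c : K ≃ₐ[ℚ] K} {v w : HeightOneSpectrum (𝓞 K)}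

theorem IsConjugation.ideleConj_localIdele (hc : IsConjugation c)
    (h : placeBelow (c : K →+* K) w = v) (x : (v.adicCompletion K)ˣ) :
    ideleConj c (localIdele v x) =
      localIdele w (Units.map (localMapOver (c : K →+* K) h).toMonoidHom x) := by
  refine idele_ext ?_ fun w' ↦ ?_
  · apply Units.ext
    rw [infPart_ideleConj, infPart_localIdele, infPart_localIdele, Units.val_one, map_one]
  · apply Units.ext
    rcases eq_or_ne w' w with rfl | hw
    · rw [finComp_ideleConj _ _ _ h, finComp_localIdele_same, finComp_localIdele_same]
      rfl
    · rw [finComp_localIdele_of_ne hw, finComp_ideleConj _ _ _ rfl, finComp_localIdele_of_ne]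
      · simp
      · rintro h'
        apply hw
        rw [← hc.placeBelow_placeBelow w', h', ← h, hc.placeBelow_placeBelow]

/-- The local components of a character invariant under conjugation. -/
theorem IsConjugation.unitComponent_conj (hc : IsConjugation c) {χ : IdeleClassChar K}
    (hχ : ∀ x, χ.1 (ideleConj c x) = χ.1 x) (h : placeBelow (c : K →+* K) w = v)
    (u : (v.adicCompletionIntegers K)ˣ) :
    unitComponent χ w (Units.map (integerMapOver (c : K →+* K) h).toMonoidHom u) =
      unitComponent χ v u := by
  change χ.1 (localIdele w _) = χ.1 (localIdele v (intUnits v u))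
  rw [← hχ (localIdele v _), hc.ideleConj_localIdele h]
  rfl

theorem IsConjugation.unitComponent_norm [Subsingleton (InfinitePlace K)] (hc : IsConjugation c)
    {ν : IdeleClassChar ℚ} {μ : IdeleClassChar K} (hμ : ∀ x, μ.1 x = ν.1 (ideleNorm K x))
    {P : HeightOneSpectrum (𝓞 ℚ)}
    (h : placeBelow (algebraMap ℚ K) w = P) (h' : placeBelow (c : K →+* K) w = w)
    (u : (w.adicCompletionIntegers K)ˣ) (n : (P.adicCompletionIntegers ℚ)ˣ)
    (hn : integerMapOver (algebraMap ℚ K) h n = u * integerMapOver (c : K →+* K) h' u) :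
    unitComponent μ w u = unitComponent ν P n :=
  hc.unitComponent_baseChange_of_eq hμ h h' u n (congrArg Subtype.val hn)

theorem IsConjugation.unitComponent_norm_of_ne [Subsingleton (InfinitePlace K)]
    (hc : IsConjugation c)
    {ν : IdeleClassChar ℚ} {μ : IdeleClassChar K} (hμ : ∀ x, μ.1 x = ν.1 (ideleNorm K x))
    {P : HeightOneSpectrum (𝓞 ℚ)}
    (h : placeBelow (algebraMap ℚ K) w = P) (h' : placeBelow (c : K →+* K) w ≠ w)
    (n : (P.adicCompletionIntegers ℚ)ˣ) :
    unitComponent μ w (Units.map (integerMapOver (algebraMap ℚ K) h).toMonoidHom n) =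
      unitComponent ν P n :=
  hc.unitComponent_baseChange_of_ne hμ h h' _ n rfl

variable {χ : IdeleClassChar K}

/-- The product formula for the local components of a quadratic character at a global unit. -/
theorem exists_finset_forall_prod_eq_one (hχ : ∀ x, χ.1 x ^ 2 = 1)
    (hinf : ∀ z, χ.1 (infIdele z) = 1) :
    ∃ T : Finset (HeightOneSpectrum (𝓞 K)), (∀ v ∉ T, unitComponent χ v = 1) ∧
      ∏ v ∈ T, unitComponent χ v (-1) = 1 := by
  obtain ⟨T, hT, hT'⟩ := exists_finset_unitComponent hχ
  refine ⟨T, hT, ?_⟩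
  have h1 := hT' T subset_rfl (-1)
  have h2 : principalIdele K (-1) = infIdele (-1) * unitIdele (-1) := by
    refine idele_ext ?_ fun v ↦ ?_
    · apply Units.ext
      rw [map_mul, infPart_infIdele, infPart_unitIdele, infPart_principalIdele]
      simp
    · apply Units.ext
      rw [map_mul, finComp_infIdele, finComp_unitIdele, finComp_principalIdele]
      simp [coe_intUnits]
  have h3 := χ.2 (-1)
  rw [h2, map_mul, hinf, one_mul, h1] at h3
  exact h3

theorem map_infIdele_eq_one [IsTotallyComplex K] (hχ : ∀ x, χ.1 x ^ 2 = 1)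
    (z : (InfiniteAdeleRing K)ˣ) : χ.1 (infIdele z) = 1 := by
  obtain ⟨t, rfl⟩ := exists_sq_eq_infinite z
  rw [map_pow, map_pow, hχ]

/-- If only one local component is possibly nontrivial, it is trivial at `-1`. -/
theorem unitComponent_neg_one_eq_one [IsTotallyComplex K] (hχ : ∀ x, χ.1 x ^ 2 = 1)
    (h : ∀ w ≠ v, unitComponent χ w = 1) : unitComponent χ v (-1) = 1 := by
  classical
  obtain ⟨T, hT, h1⟩ := exists_finset_forall_prod_eq_one hχ (map_infIdele_eq_one hχ)
  by_cases hv : v ∈ T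
  · rwa [Finset.prod_eq_single_of_mem v hv fun w _ hw ↦ by rw [h w hw]; rfl] at h1
  · rw [hT v hv]
    rfl

theorem unitComponent_sq (hχ : ∀ x, χ.1 x ^ 2 = 1) (u : (v.adicCompletionIntegers K)ˣ) :
    unitComponent χ v u ^ 2 = 1 := hχ _

end Components

/-! ### Residue fields at places of degree one -/

section Residue

variable {F : Type*} [Field F] [NumberField F] {v : HeightOneSpectrum (𝓞 F)} {p : ℕ}

theorem exists_int_sub_mem (hp : p.Prime) (h : Ideal.absNorm v.asIdeal = p) (a : 𝓞 F) :
    ∃ n : ℤ, a - n ∈ v.asIdeal := by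
  have : Fact p.Prime := ⟨hp⟩
  have hcard : Nat.card (𝓞 F ⧸ v.asIdeal) = p := h
  have hne : (1 : 𝓞 F ⧸ v.asIdeal) ≠ 0 := by
    have : Nontrivial (𝓞 F ⧸ v.asIdeal) := Ideal.Quotient.nontrivial_iff.2 v.isPrime.ne_top
    exact one_ne_zero
  obtain ⟨n, hn⟩ := mem_zmultiples_of_prime_card hcard hne (g' := Ideal.Quotient.mk v.asIdeal a)
  refine ⟨n, Ideal.Quotient.eq_zero_iff_mem.1 ?_⟩
  rw [map_sub, ← hn]
  simp

variable {ϖ : v.adicCompletionIntegers F}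

theorem IsUniformizer.exists_int (hϖ : IsUniformizer ϖ) (hp : p.Prime)
    (h : Ideal.absNorm v.asIdeal = p) (r : v.adicCompletionIntegers F) : ∃ n : ℤ, ϖ ∣ r - n := by
  obtain ⟨a, ha⟩ := hϖ.exists_algebraMap r 1
  rw [pow_one] at ha
  obtain ⟨n, hn⟩ := exists_int_sub_mem hp h a
  rw [← hϖ.dvd_algebraMap_iff, map_sub, map_intCast] at hn
  refine ⟨n, ?_⟩
  convert hn.sub ha using 1
  ring

theorem IsUniformizer.dvd_or_dvd_sub_one (hϖ : IsUniformizer ϖ)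
    (h : Ideal.absNorm v.asIdeal = 2) (r : v.adicCompletionIntegers F) : ϖ ∣ r ∨ ϖ ∣ r - 1 := by
  have h2 : ϖ ∣ 2 := by
    have := hϖ.dvd_algebraMap_iff 2
    rw [map_ofNat] at this
    refine this.2 ?_
    have h3 := Ideal.absNorm_mem v.asIdeal
    rwa [h] at h3
  obtain ⟨n, hn⟩ := hϖ.exists_int Nat.prime_two h r
  rcases Int.even_or_odd' n with ⟨k, rfl | rfl⟩
  · left
    convert hn.add (h2.mul_right k) using 1
    push_cast
    ring
  · right
    convert hn.add (h2.mul_right k) using 1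
    push_cast
    ring

theorem IsUniformizer.dvd_intCast_iff (hϖ : IsUniformizer ϖ) (hv : IsAbove v p) (hp : p.Prime)
    (n : ℤ) : ϖ ∣ (n : v.adicCompletionIntegers F) ↔ (p : ℤ) ∣ n := by
  rw [← hv.intCast_mem_iff hp, ← hϖ.dvd_algebraMap_iff, map_intCast]

theorem IsUniformizer.isUnit_two (hϖ : IsUniformizer ϖ) (hv : IsAbove v p) (hp : p.Prime)
    (hp2 : p ≠ 2) : IsUnit (2 : v.adicCompletionIntegers F) := by
  rw [hϖ.isUnit_iff_not_dvd]
  have h := hϖ.dvd_intCast_iff hv hp 2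
  rw [Int.cast_ofNat] at h
  rw [h]
  intro h1
  have h2 : p ∣ 2 := by exact_mod_cast h1
  exact hp2 ((Nat.prime_dvd_prime_iff_eq hp Nat.prime_two).1 h2)

/-- `-1` is a square modulo `v` if and only if the residue field has characteristic `1` mod `4`,
for a place of degree one. -/
theorem IsUniformizer.exists_dvd_neg_one_sub_sq_iff (hϖ : IsUniformizer ϖ) (hv : IsAbove v p)
    (hp : p.Prime) (h : Ideal.absNorm v.asIdeal = p) :
    (∃ y : (v.adicCompletionIntegers F)ˣ, ϖ ∣ (-1 : v.adicCompletionIntegers F) - y ^ 2) ↔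
      p % 4 ≠ 3 := by
  have : Fact p.Prime := ⟨hp⟩
  rw [← ZMod.exists_sq_eq_neg_one_iff]
  have key : ∀ n : ℤ, ϖ ∣ (-1 : v.adicCompletionIntegers F) - n ^ 2 ↔ (-1 : ZMod p) = n ^ 2 := by
    intro n
    rw [← sub_eq_zero]
    have h1 := hϖ.dvd_intCast_iff hv hp (-1 - n ^ 2)
    rw [← ZMod.intCast_zmod_eq_zero_iff_dvd] at h1
    push_cast at h1
    exact h1
  constructor
  · rintro ⟨y, hy⟩
    obtain ⟨n, hn⟩ := hϖ.exists_int hp h y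
    refine ⟨n, ?_⟩
    rw [← pow_two, ← key]
    convert hy.add (hn.mul_right ((y : v.adicCompletionIntegers F) + n)) using 1
    ring
  · rintro ⟨x, hx⟩
    obtain ⟨n, rfl⟩ := ZMod.intCast_surjective x
    rw [← pow_two, ← key] at hx
    have hu : IsUnit (n : v.adicCompletionIntegers F) := by
      rw [hϖ.isUnit_iff_not_dvd]
      intro hd
      refine hϖ.not_isUnit (isUnit_of_dvd_unit ?_ isUnit_one.neg)
      convert hx.add (hd.mul_right (n : v.adicCompletionIntegers F)) using 1
      ring
    obtain ⟨y, hy⟩ := hu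
    exact ⟨y, by rwa [hy]⟩

end Residue

end IdeleClass

namespace IdeleClass

/-! ### The conductor of a quadratic character -/

section Conductor

variable {F : Type*} [Field F] [NumberField F] {v : HeightOneSpectrum (𝓞 F)} {χ : IdeleClassChar F}

/-- A quadratic character has finite level at v, so the infimum defining the exponent is attained
and the value 0 of `sInf ∅` does not intervene. -/
theorem conductorExponent_le_iff (hχ : ∀ x, χ.1 x ^ 2 = 1) {ϖ : v.adicCompletionIntegers F}
    (hϖ : IsUniformizer ϖ) (n : ℕ) :
    conductorExponent χ v ≤ n ↔ TrivialMod (unitComponent χ v) (ϖ ^ n) := by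
  rw [conductorExponent_eq v hϖ]
  constructor
  · intro h
    have h1 : sInf {n : ℕ | TrivialMod (unitComponent χ v) (ϖ ^ n)} ∈
        {n : ℕ | TrivialMod (unitComponent χ v) (ϖ ^ n)} :=
      Nat.sInf_mem (exists_trivialMod_unitComponent hχ v hϖ)
    exact TrivialMod.of_dvd h1 (pow_dvd_pow _ h)
  · exact fun h ↦ Nat.sInf_le h

theorem conductorExponent_eq_zero_iff (hχ : ∀ x, χ.1 x ^ 2 = 1) :
    conductorExponent χ v = 0 ↔ unitComponent χ v = 1 := by
  obtain ⟨ϖ, hϖ⟩ := exists_isUniformizer v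
  rw [← Nat.le_zero, conductorExponent_le_iff hχ hϖ, pow_zero]
  exact ⟨fun h ↦ MonoidHom.ext fun u ↦ h u (one_dvd _), fun h u _ ↦ by rw [h]; rfl⟩

theorem exists_finset_conductor_eq (hχ : ∀ x, χ.1 x ^ 2 = 1) :
    ∃ T : Finset (HeightOneSpectrum (𝓞 F)), (∀ v ∉ T, conductorExponent χ v = 0) ∧
      conductor χ = ∏ v ∈ T, v.asIdeal ^ conductorExponent χ v := by
  obtain ⟨T, hT, -⟩ := exists_finset_unitComponent hχ
  have h1 : ∀ v ∉ T, conductorExponent χ v = 0 := fun v hv ↦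
    (conductorExponent_eq_zero_iff hχ).2 (hT v hv)
  refine ⟨T, h1, finprod_eq_prod_of_mulSupport_subset _ fun v hv ↦ ?_⟩
  by_contra hc
  refine hv ?_
  change v.asIdeal ^ _ = 1
  rw [h1 v hc, pow_zero]

theorem emultiplicity_prod_pow (T : Finset (HeightOneSpectrum (𝓞 F)))
    (e : HeightOneSpectrum (𝓞 F) → ℕ) (he : ∀ v ∉ T, e v = 0) (v : HeightOneSpectrum (𝓞 F)) :
    emultiplicity v.asIdeal (∏ w ∈ T, w.asIdeal ^ e w) = e v := by
  classical
  have h1 : ∀ w : HeightOneSpectrum (𝓞 F), emultiplicity v.asIdeal (w.asIdeal ^ e w) =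
      if w = v then (e v : ℕ∞) else 0 := by
    intro w
    split_ifs with h
    · subst h
      exact emultiplicity_pow_self_of_prime w.prime _
    · rw [emultiplicity_eq_zero]
      exact fun hd ↦ h (eq_of_asIdeal_dvd (v.prime.dvd_of_dvd_pow hd)).symm
  rw [Finset.emultiplicity_prod v.prime, Finset.sum_congr rfl fun w _ ↦ h1 w, Finset.sum_ite_eq']
  split_ifs with h
  · rfl
  · rw [he v h, Nat.cast_zero]

theorem emultiplicity_conductor (hχ : ∀ x, χ.1 x ^ 2 = 1) (v : HeightOneSpectrum (𝓞 F)) :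
    emultiplicity v.asIdeal (conductor χ) = conductorExponent χ v := by
  obtain ⟨T, hT, h⟩ := exists_finset_conductor_eq hχ
  rw [h, emultiplicity_prod_pow T _ hT]

theorem dvd_conductor_iff (hχ : ∀ x, χ.1 x ^ 2 = 1) :
    v.asIdeal ∣ conductor χ ↔ unitComponent χ v ≠ 1 := by
  rw [ne_eq, ← conductorExponent_eq_zero_iff hχ, ← not_iff_not, not_not, ← emultiplicity_eq_zero,
    emultiplicity_conductor hχ, Nat.cast_eq_zero]

end Conductor

/-! ### Residue field with four elements -/

section Residue

variable {F : Type*} [Field F] [NumberField F] {v : HeightOneSpectrum (𝓞 F)}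

theorem IsUniformizer.dvd_or_dvd {ϖ : v.adicCompletionIntegers F} (hϖ : IsUniformizer ϖ)
    {a b : v.adicCompletionIntegers F} (h : ϖ ∣ a * b) : ϖ ∣ a ∨ ϖ ∣ b := by
  rcases hϖ.dvd_or_isUnit a with ha | ha
  · exact Or.inl ha
  · exact Or.inr ((ha.dvd_mul_left).1 h)

/-- In a field of four elements x⁴ = x, and modulo 2 the polynomial x⁴ - x is x(x - 1)(x - z)(x - (1
+ z)). -/
theorem IsUniformizer.residue_four (h2 : IsUniformizer (2 : v.adicCompletionIntegers F))
    (h : Ideal.absNorm v.asIdeal = 4) {z : v.adicCompletionIntegers F} (hz : z ^ 2 + z + 1 = 0)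
    (r : v.adicCompletionIntegers F) : 2 ∣ r ∨ 2 ∣ r - 1 ∨ 2 ∣ r - z ∨ 2 ∣ r - (1 + z) := by
  obtain ⟨a, ha⟩ := h2.exists_algebraMap r 1
  rw [pow_one] at ha
  have h4 : a ^ 4 - a ∈ v.asIdeal := by
    have := v.isMaximal
    let _ := Ideal.Quotient.field v.asIdeal
    have hf : Finite (𝓞 F ⧸ v.asIdeal) := v.asIdeal.finiteQuotientOfFreeOfNeBot v.ne_bot
    let _ := Fintype.ofFinite (𝓞 F ⧸ v.asIdeal)
    have h5 := FiniteField.pow_card (Ideal.Quotient.mk v.asIdeal a)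
    rw [← Nat.card_eq_fintype_card] at h5
    have h6 : Nat.card (𝓞 F ⧸ v.asIdeal) = 4 := h
    rw [h6, ← map_pow] at h5
    exact Ideal.Quotient.eq.1 h5
  rw [← h2.dvd_algebraMap_iff, map_sub, map_pow] at h4
  set x := algebraMap (𝓞 F) (v.adicCompletionIntegers F) a
  have h5 : (2 : v.adicCompletionIntegers F) ∣ x * ((x - 1) * ((x - z) * (x - (1 + z)))) := by
    convert h4.sub (Dvd.intro (x * (x - 1) * (1 + x + x * z)) rfl) using 1
    linear_combination (x * (x - 1)) * hz
  rcases h2.dvd_or_dvd h5 with h6 | h6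
  · exact Or.inl (by convert h6.sub ha using 1; ring)
  rcases h2.dvd_or_dvd h6 with h6 | h6
  · exact Or.inr (Or.inl (by convert h6.sub ha using 1; ring))
  rcases h2.dvd_or_dvd h6 with h6 | h6
  · exact Or.inr (Or.inr (Or.inl (by convert h6.sub ha using 1; ring)))
  · exact Or.inr (Or.inr (Or.inr (by convert h6.sub ha using 1; ring)))

end Residue

/-! ### Local data at q and at an inert 2 -/

section Data

variable {K : Type*} [Field K] [NumberField K] {c : K ≃ₐ[ℚ] K} {s : 𝓞 K} {q : ℕ}
  {v : HeightOneSpectrum (𝓞 K)} {p : ℕ}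

theorem IsQuadraticData.mem_of_isAbove (D : IsQuadraticData c s q) (h : IsAbove v q) :
    s ∈ v.asIdeal := by
  refine v.isPrime.mem_of_pow_mem 2 ?_
  rw [D.sq]
  exact neg_mem h

theorem IsQuadraticData.span_eq (D : IsQuadraticData c s q) (h : IsAbove v q) :
    Ideal.span {(q : 𝓞 K)} = v.asIdeal ^ 2 := by
  refine (h.ramifies_iff D.finrank D.prime).1 ⟨v, ?_⟩
  rw [← Ideal.span_singleton_neg, ← D.sq, ← Ideal.span_singleton_pow]
  refine pow_dvd_pow_of_dvd ?_ 2
  rw [Ideal.dvd_iff_le, Ideal.span_singleton_le_iff_mem]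
  exact D.mem_of_isAbove h

theorem IsQuadraticData.ramifies (D : IsQuadraticData c s q) (h : IsAbove v q) : Ramifies K q :=
  (h.ramifies_iff D.finrank D.prime).2 (D.span_eq h)

theorem IsQuadraticData.absNorm_eq (D : IsQuadraticData c s q) (h : IsAbove v q) :
    Ideal.absNorm v.asIdeal = q :=
  (eq_mul_of_dvd D.finrank D.prime h h (by rw [← pow_two]; exact dvd_of_eq (D.span_eq h).symm)).2

/-- Since (s)² = (q) = v², divisibility of s by v² would give v⁴ ∣ v². -/
theorem IsQuadraticData.isUniformizer (D : IsQuadraticData c s q) (h : IsAbove v q) :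
    IsUniformizer (algebraMap (𝓞 K) (v.adicCompletionIntegers K) s) := by
  refine isUniformizer_algebraMap (D.mem_of_isAbove h) fun h1 ↦ ?_
  have h2 : v.asIdeal ^ 2 * v.asIdeal ^ 2 ∣ v.asIdeal ^ 2 * 1 := by
    rw [mul_one, ← pow_two (v.asIdeal ^ 2)]
    nth_rewrite 2 [← D.span_eq h]
    rw [← Ideal.span_singleton_neg, ← D.sq, ← Ideal.span_singleton_pow]
    refine pow_dvd_pow_of_dvd ?_ 2
    rwa [Ideal.dvd_iff_le, Ideal.span_singleton_le_iff_mem]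
  have h3 := (mul_dvd_mul_iff_left (pow_ne_zero 2 v.ne_bot)).1 h2
  exact not_asIdeal_dvd_one ((dvd_pow_self _ two_ne_zero).trans h3)

theorem IsQuadraticData.algebraMap_sq (D : IsQuadraticData c s q) (v : HeightOneSpectrum (𝓞 K)) :
    (algebraMap (𝓞 K) (v.adicCompletionIntegers K) s) ^ 2 = -q := by
  rw [← map_pow, D.sq, map_neg, map_natCast]

theorem IsQuadraticData.mapRingHom_sqrt (D : IsQuadraticData c s q) :
    RingOfIntegers.mapRingHom (c : K →+* K) s = -s :=
  RingOfIntegers.coe_injective (by rw [map_neg]; exact D.conj_sqrt)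

/-- The element (1 + s)/2 is integral, having trace 1 and norm (1 + q)/4. An element of odd trace
shows that conjugation is nontrivial on the residue field at an inert 2. -/
theorem IsQuadraticData.exists_trace_eq_one (D : IsQuadraticData c s q) (h : q % 4 = 3) :
    ∃ θ : 𝓞 K, θ + RingOfIntegers.mapRingHom (c : K →+* K) θ = 1 := by
  obtain ⟨k, hk⟩ : ∃ k : ℕ, q = 4 * k + 3 := ⟨q / 4, by omega⟩
  have hsK : (s : K) ^ 2 = -(4 * k + 3) := by
    have := congrArg (algebraMap (𝓞 K) K) D.sq
    rw [hk, map_pow, map_neg, map_natCast] at this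
    rw [this]
    push_cast
    rfl
  have hint : IsIntegral ℤ ((1 + (s : K)) / 2) := by
    refine ⟨Polynomial.X ^ 2 + (-Polynomial.X + Polynomial.C (k + 1 : ℤ)),
      Polynomial.monic_X_pow_add ?_, ?_⟩
    · compute_degree!
    · simp only [Polynomial.eval₂_add, Polynomial.eval₂_neg, Polynomial.eval₂_pow,
        Polynomial.eval₂_X, Polynomial.eval₂_C]
      push_cast
      linear_combination (1 / 4 : K) * hsK
  let θ : 𝓞 K := ⟨_, hint⟩
  refine ⟨θ, RingOfIntegers.coe_injective ?_⟩
  rw [map_add, map_one]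
  change (1 + (s : K)) / 2 + c ((1 + (s : K)) / 2) = 1
  rw [map_div₀, map_add, map_one, D.conj_sqrt, map_ofNat]
  ring

theorem IsQuadraticData.mod_four_of_isInert (D : IsQuadraticData c s q) (h : IsAbove v 2)
    (hi : IsInert K 2) : q % 4 = 3 := by
  refine D.mod_four.resolve_left ?_
  rintro rfl
  exact h.not_ramifies_of_isInert D.finrank Nat.prime_two hi (D.ramifies h)

theorem IsAbove.isUniformizer_of_isInert (h : IsAbove v p) (hp : p.Prime) (hi : IsInert K p) :
    IsUniformizer (p : v.adicCompletionIntegers K) :=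
  isUniformizer_natCast (J := 1) (by rw [(h.isInert_iff hp).1 hi, mul_one]) not_asIdeal_dvd_one

theorem IsAbove.isUniformizer_of_ne (hdeg : Module.finrank ℚ K = 2) (h : IsAbove v p)
    (hp : p.Prime) (hv : placeBelow (c : K →+* K) v ≠ v) :
    IsUniformizer (p : v.adicCompletionIntegers K) :=
  isUniformizer_natCast (h.span_eq_of_placeBelow_ne hdeg hp hv).1
    fun h' ↦ hv (eq_of_asIdeal_dvd h').symm

theorem IsAbove.absNorm_of_isInert (hdeg : Module.finrank ℚ K = 2) (h : IsAbove v p)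
    (hp : p.Prime) (hi : IsInert K p) : Ideal.absNorm v.asIdeal = p ^ 2 := by
  rw [← (h.isInert_iff hp).1 hi, absNorm_span_prime hdeg]

theorem two_ne_zero_integers : (2 : v.adicCompletionIntegers K) ≠ 0 := by
  intro h
  have h1 := congrArg (Subtype.val) h
  have h2 : (algebraMap K (v.adicCompletion K)) 2 = 0 := by
    rw [map_ofNat]
    exact h1
  rw [map_eq_zero] at h2
  exact two_ne_zero h2

theorem cubeRoot_of_isPrimitiveRoot {L : Type*} [Field L] {ζ : L} (hζ : IsPrimitiveRoot ζ 3) :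
    ζ ^ 2 + ζ + 1 = 0 := by
  have h := hζ.isRoot_cyclotomic (by norm_num)
  simpa [Polynomial.cyclotomic_three, Polynomial.IsRoot] using h

/-- A primitive cube root of unity is moved by conjugation at an inert place above `2`. -/
theorem IsQuadraticData.dvd_conj_sub (D : IsQuadraticData c s q) (h : IsAbove v 2)
    (hi : IsInert K 2) (hcv : placeBelow (c : K →+* K) v = v) {z : v.adicCompletionIntegers K}
    (hz : z ^ 2 + z + 1 = 0) : 2 ∣ integerMapOver (c : K →+* K) hcv z - (1 + z) := by
  have h2 : IsUniformizer (2 : v.adicCompletionIntegers K) := by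
    exact_mod_cast h.isUniformizer_of_isInert Nat.prime_two hi
  have hcard : Ideal.absNorm v.asIdeal = 4 := h.absNorm_of_isInert D.finrank Nat.prime_two hi
  set γ := integerMapOver (c : K →+* K) hcv
  have hz' : γ z ^ 2 + γ z + 1 = 0 := by
    rw [← map_pow, ← map_add, ← map_one γ, ← map_add, hz, map_zero]
  -- c(z) is a root of the same quadratic, so modulo 2 it is z or 1 + z. In the first case c would
  -- be trivial modulo 2, and θ + c(θ) = 1 would be even.
  have h3 : (2 : v.adicCompletionIntegers K) ∣ (γ z - z) * (γ z - (1 + z)) := by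
    refine ⟨-1 - γ z * (1 + z), ?_⟩
    linear_combination hz' + hz
  refine (h2.dvd_or_dvd h3).resolve_left fun h4 ↦ ?_
  obtain ⟨θ, hθ⟩ := D.exists_trace_eq_one (D.mod_four_of_isInert h hi)
  have hθ' := congrArg (algebraMap (𝓞 K) (v.adicCompletionIntegers K)) hθ
  rw [map_add, map_one, ← integerMapOver_algebraMap hcv] at hθ'
  have h5 : ∀ r, 2 ∣ γ r - r := by
    intro r
    have hd : ∀ a, (2 : v.adicCompletionIntegers K) ∣ a → 2 ∣ γ a := fun a ha ↦ by
      have := map_dvd γ ha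
      rwa [map_ofNat] at this
    rcases h2.residue_four hcard hz r with h6 | h6 | h6 | h6
    · exact (hd _ h6).sub h6
    · convert (hd _ h6).sub h6 using 1
      simp
    · convert ((hd _ h6).sub h6).add h4 using 1
      rw [map_sub]; ring
    · convert ((hd _ h6).sub h6).add h4 using 1
      rw [map_sub, map_add, map_one]; ring
  refine h2.not_isUnit (isUnit_of_dvd_one ?_)
  convert (h5 (algebraMap (𝓞 K) _ θ)).add (dvd_mul_right 2 (algebraMap (𝓞 K) _ θ)) using 1
  rw [← hθ']; ring

end Data

end IdeleClass

namespace IdeleClass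

/-! ### Local conditions stable under products, and rigidity -/

section LocalConditions

variable {K : Type*} [Field K] [NumberField K] {c : K ≃ₐ[ℚ] K} {s : 𝓞 K} {q : ℕ}
  {S : Set (HeightOneSpectrum (𝓞 K))} {π ζ : ∀ v : HeightOneSpectrum (𝓞 K), v.adicCompletion K}
  {v w : HeightOneSpectrum (𝓞 K)} {p : ℕ} {χ η : IdeleClassChar K}

/-- The local conditions equivalent to (A)-(D) for quadratic characters. -/
structure LocalGood (S : Set (HeightOneSpectrum (𝓞 K)))
    (π ζ : ∀ v : HeightOneSpectrum (𝓞 K), v.adicCompletion K) (v : HeightOneSpectrum (𝓞 K))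
    (ρ : (v.adicCompletionIntegers K)ˣ →* Circle) : Prop where
  inert : ∀ p : ℕ, p.Prime → p ≠ 2 → IsInert K p → IsAbove v p → ρ = 1
  split : ∀ p : ℕ, p.Prime → Splits K p → IsAbove v p → v ∉ S → ρ = 1
  two_ramified : Ramifies K 2 → IsAbove v 2 → ∀ u : (v.adicCompletionIntegers K)ˣ,
    ((u : v.adicCompletionIntegers K) : v.adicCompletion K) = 1 + π v → ρ u = 1
  two_inert : IsInert K 2 → IsAbove v 2 → TrivialMod ρ 4 ∧
    ∀ u : (v.adicCompletionIntegers K)ˣ,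
      ((u : v.adicCompletionIntegers K) : v.adicCompletion K) = 1 + 2 * ζ v → ρ u = 1

theorem LocalGood.one : LocalGood S π ζ v 1 :=
  ⟨fun _ _ _ _ _ ↦ rfl, fun _ _ _ _ _ ↦ rfl, fun _ _ _ _ ↦ rfl,
    fun _ _ ↦ ⟨fun _ _ ↦ rfl, fun _ _ ↦ rfl⟩⟩

/-- Stability under products lets the conditions pass from χ and η to χη. It is the reason why exact
exponents and the value -1 at -1 are not part of `LocalGood`. -/
theorem LocalGood.mul {ρ ψ : (v.adicCompletionIntegers K)ˣ →* Circle} (h : LocalGood S π ζ v ρ)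
    (h' : LocalGood S π ζ v ψ) : LocalGood S π ζ v (ρ * ψ) where
  inert p hp hp2 hi hv := by rw [h.inert p hp hp2 hi hv, h'.inert p hp hp2 hi hv, one_mul]
  split p hp hs hv hS := by rw [h.split p hp hs hv hS, h'.split p hp hs hv hS, one_mul]
  two_ramified hr hv u hu := by
    rw [MonoidHom.mul_apply, h.two_ramified hr hv u hu, h'.two_ramified hr hv u hu, one_mul]
  two_inert hi hv := ⟨(h.two_inert hi hv).1.mul (h'.two_inert hi hv).1, fun u hu ↦ by
    rw [MonoidHom.mul_apply, (h.two_inert hi hv).2 u hu, (h'.two_inert hi hv).2 u hu, one_mul]⟩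

/-- The data at a place above `2` if `2` ramifies. -/
theorem IsQuadraticData.ramified_two (D : IsQuadraticData c s 2) (h : IsAbove v 2)
    (hπ : Valued.v (π v) = WithZero.exp (-1 : ℤ)) {σ : v.adicCompletionIntegers K}
    (hσ : σ = algebraMap (𝓞 K) (v.adicCompletionIntegers K) s) :
    σ ^ 2 = -2 ∧ IsUniformizer σ ∧ (∀ r, σ ∣ r ∨ σ ∣ r - 1) ∧
      ∃ (π' a : v.adicCompletionIntegers K) (p : (v.adicCompletionIntegers K)ˣ),
        π' = σ * a ∧ σ ∣ a - 1 ∧ (p : v.adicCompletionIntegers K) = 1 + π' ∧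
        (π' : v.adicCompletion K) = π v := by
  subst hσ
  have hσ := D.isUniformizer h
  have hsq := D.algebraMap_sq v
  have hres := hσ.dvd_or_dvd_sub_one (D.absNorm_eq h)
  have hmem : π v ∈ v.adicCompletionIntegers K := by
    rw [HeightOneSpectrum.mem_adicCompletionIntegers, hπ, ← WithZero.exp_zero, WithZero.exp_le_exp]
    norm_num
  let π' : v.adicCompletionIntegers K := ⟨π v, hmem⟩
  have hπ' : IsUniformizer π' := hπ
  obtain ⟨a, ha⟩ := (dvd_iff_valued_le (b := π')).2 (hπ.trans hσ.symm).le
  obtain ⟨p, hp⟩ := exists_unit_eq_one_add_mul hπ'.not_isUnit 1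
  refine ⟨by exact_mod_cast hsq, hσ, hres, π', a, p, ha, (hres a).resolve_left ?_,
    by rw [hp, mul_one], rfl⟩
  rintro ⟨b, rfl⟩
  have h1 := (hπ'.pow_dvd_iff 1 (r := algebraMap (𝓞 K) _ s)).2 (by rw [hσ]; simp)
  rw [pow_one, ha] at h1
  obtain ⟨d, hd⟩ := h1
  refine hσ.not_isUnit (isUnit_of_dvd_one ⟨b * d, ?_⟩)
  apply mul_left_cancel₀ hσ.ne_zero
  linear_combination hd

/-- The data at a place above `2` if `2` is inert. -/
theorem IsAbove.inert_two (hdeg : Module.finrank ℚ K = 2) (h : IsAbove v 2) (hi : IsInert K 2)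
    (hζ : IsPrimitiveRoot (ζ v) 3) :
    IsUniformizer (2 : v.adicCompletionIntegers K) ∧
      ∃ (z : v.adicCompletionIntegers K) (p : (v.adicCompletionIntegers K)ˣ),
        z ^ 2 + z + 1 = 0 ∧ (∀ r, 2 ∣ r ∨ 2 ∣ r - 1 ∨ 2 ∣ r - z ∨ 2 ∣ r - (1 + z)) ∧
        (p : v.adicCompletionIntegers K) = 1 + 2 * z ∧ (z : v.adicCompletion K) = ζ v := by
  have h2 : IsUniformizer (2 : v.adicCompletionIntegers K) := by
    exact_mod_cast h.isUniformizer_of_isInert Nat.prime_two hi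
  have hmem : ζ v ∈ v.adicCompletionIntegers K := by
    have h3 : Valued.v (ζ v) ^ 3 = 1 := by rw [← map_pow, hζ.pow_eq_one, map_one]
    exact ((pow_eq_one_iff_of_nonneg zero_le three_ne_zero).1 h3).le
  let z : v.adicCompletionIntegers K := ⟨ζ v, hmem⟩
  have hz : z ^ 2 + z + 1 = 0 := Subtype.ext (cubeRoot_of_isPrimitiveRoot hζ)
  obtain ⟨p, hp⟩ := exists_unit_eq_one_add_mul h2.not_isUnit z
  exact ⟨h2, z, p, hz, h2.residue_four (h.absNorm_of_isInert hdeg Nat.prime_two hi) hz, hp, rfl⟩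

theorem exists_trivialMod_pow (hχ : ∀ x, χ.1 x ^ 2 = 1) {ϖ : v.adicCompletionIntegers K}
    (hϖ : IsUniformizer ϖ) : TrivialMod (unitComponent χ v) (4 * ϖ) := by
  obtain ⟨N, hN⟩ := exists_trivialMod_unitComponent hχ v hϖ
  exact TrivialMod.four_mul hϖ.not_isUnit (unitComponent_sq hχ) hN

theorem trivialMod_of_odd (hχ : ∀ x, χ.1 x ^ 2 = 1) {ϖ : v.adicCompletionIntegers K}
    (hϖ : IsUniformizer ϖ) (hv : IsAbove v p) (hp : p.Prime) (hp2 : p ≠ 2) :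
    TrivialMod (unitComponent χ v) ϖ := by
  obtain ⟨N, hN⟩ := exists_trivialMod_unitComponent hχ v hϖ
  exact TrivialMod.of_isUnit_two hϖ.not_isUnit (hϖ.isUnit_two hv hp hp2) (unitComponent_sq hχ) hN

/-- The value at `-1` of a nontrivial quadratic character of the units at a place of degree one. -/
theorem map_neg_one_eq_one_iff {ρ : (v.adicCompletionIntegers K)ˣ →* Circle}
    (hρ : ∀ u, ρ u ^ 2 = 1) {ϖ : v.adicCompletionIntegers K}
    (hϖ : IsUniformizer ϖ) (h : TrivialMod ρ ϖ) (hv : IsAbove v p) (hp : p.Prime)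
    (hN : Ideal.absNorm v.asIdeal = p) (hne : ρ ≠ 1) : ρ (-1) = 1 ↔ p % 4 ≠ 3 := by
  obtain ⟨g, hg⟩ : ∃ g, ρ g ≠ 1 := by
    by_contra! hc
    exact hne (MonoidHom.ext hc)
  rw [h.eq_one_iff_of_odd hϖ.maximalIdeal_eq hρ hg, ← hϖ.exists_dvd_neg_one_sub_sq_iff hv hp hN]
  simp

/-- A quadratic character invariant under conjugation which satisfies the local conditions is
trivial. -/
theorem IsQuadraticData.eq_one_of_conj_invariant [IsTotallyComplex K] (D : IsQuadraticData c s q)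
    (hS : IsChoiceAboveSplit S)
    (hπ : ∀ v : HeightOneSpectrum (𝓞 K), IsAbove v 2 → Valued.v (π v) = WithZero.exp (-1 : ℤ))
    (hζ : ∀ v : HeightOneSpectrum (𝓞 K), IsInert K 2 → IsAbove v 2 → IsPrimitiveRoot (ζ v) 3)
    (hχ : ∀ x, χ.1 x ^ 2 = 1) (hcχ : ∀ x, χ.1 (ideleConj c x) = χ.1 x)
    (hloc : ∀ v, LocalGood S π ζ v (unitComponent χ v)) (x : IdeleGroup K) : χ.1 x = 1 := by
  have hdeg := D.finrank
  -- Away from q invariance and the local conditions suffice: at a split prime the component at v ∈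
  -- S is conjugate to the trivial one outside S, and at an inert 2 the conjugate of 1 + 2ζ is -(1 +
  -- 2ζ) modulo 4.
  have hunram : ∀ v : HeightOneSpectrum (𝓞 K), ¬ IsAbove v q → unitComponent χ v = 1 := by
    intro v hvq
    obtain ⟨p, hp, hv⟩ := exists_prime_isAbove v
    rcases hv.inert_or_ramifies_or_splits hdeg hp with hi | hr | hs
    · by_cases hp2 : p = 2
      · subst hp2
        obtain ⟨h2, z, P, hz, hres, hP, hzζ⟩ := hv.inert_two hdeg hi (hζ v hi hv)
        have hcv := hv.placeBelow_eq_of_isInert (c := c) hdeg hp hi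
        obtain ⟨h4, h5⟩ := (hloc v).two_inert hi hv
        have hρP : unitComponent χ v P = 1 := h5 P (by rw [hP, ← hzζ]; rfl)
        refine MonoidHom.ext fun u ↦ TrivialMod.eq_one_of_inert hz h2.not_isUnit hres hP
          (unitComponent_sq hχ) h4 hρP (Or.inr ?_) u
        have hd := D.dvd_conj_sub hv hi hcv hz
        refine TrivialMod.map_neg_one_of_conj hP h4
          (p' := Units.map (integerMapOver (c : K →+* K) hcv).toMonoidHom P) ?_
          (D.conj.unitComponent_conj hcχ hcv P)
        have e : ((Units.map (integerMapOver (c : K →+* K) hcv).toMonoidHom P :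
            (v.adicCompletionIntegers K)ˣ) : v.adicCompletionIntegers K) - (1 + 2 * (1 + z)) =
            2 * (integerMapOver (c : K →+* K) hcv z - (1 + z)) := by
          change integerMapOver (c : K →+* K) hcv P - _ = _
          rw [hP, map_add, map_mul, map_one, map_ofNat]
          ring
        rw [e]
        refine ⟨dvd_mul_right _ _, ?_⟩
        rw [show (4 : v.adicCompletionIntegers K) = 2 * 2 by norm_num]
        exact mul_dvd_mul_left 2 hd
      · exact (hloc v).inert p hp hp2 hi hv
    · obtain rfl := D.eq_of_ramifies p hp hr
      exact absurd hv hvq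
    · by_cases hvS : v ∈ S
      · have hne := (D.conj.splits_iff hdeg hv hp).1 hs
        have hw : IsAbove (placeBelow (c : K →+* K) v) p := (isAbove_placeBelow _ _).2 hv
        have hwS : placeBelow (c : K →+* K) v ∉ S := fun h ↦
          hne ((hS.existsUnique p hp hs).unique ⟨h, hw⟩ ⟨hvS, hv⟩)
        have h1 := (hloc _).split p hp hs hw hwS
        ext1 u
        rw [← D.conj.unitComponent_conj hcχ (D.conj.placeBelow_placeBelow v) u, h1]
        rfl
      · exact (hloc v).split p hp hs hv hvS
  refine eq_one_of_unitComponent D.odd hχ (map_infIdele_eq_one hχ) (fun v ↦ ?_) x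
  by_cases hvq : IsAbove v q
  swap
  · exact hunram v hvq
  -- Only the place above q is left, so the product formula at -1 has a single factor.
  have hneg : unitComponent χ v (-1) = 1 := unitComponent_neg_one_eq_one hχ fun w hw ↦
    hunram w fun h ↦ hw (by
      have h1 := h.dvd
      rw [D.span_eq hvq] at h1
      exact eq_of_asIdeal_dvd (w.prime.dvd_of_dvd_pow h1))
  have hcv := hvq.placeBelow_eq_of_ramifies (c := c) hdeg D.prime (D.ramifies hvq)
  rcases D.mod_four with rfl | hq3
  · obtain ⟨hsq, hσ, hres, π', a, P, hπ', ha, hP, hπv⟩ := D.ramified_two hvq (hπ v hvq) rfl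
    have hρP := (hloc v).two_ramified (D.ramifies hvq) hvq P (by rw [hP, ← hπv]; rfl)
    set σ := algebraMap (𝓞 K) (v.adicCompletionIntegers K) s with hσ'
    obtain ⟨A, hA⟩ := exists_unit_eq_one_add_mul hσ.not_isUnit 1
    obtain ⟨B, hB⟩ := exists_unit_eq_one_add_mul hσ.not_isUnit (-1)
    have h5 : TrivialMod (unitComponent χ v) (σ ^ 5) := by
      convert exists_trivialMod_pow hχ hσ using 1
      linear_combination (σ ^ 3 - 2 * σ) * hsq
    -- Conjugation exchanges 1 + s and 1 - s, which supplies the last relation required by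
    -- `TrivialMod.eq_one_of_conj`.
    have hAB : Units.map (integerMapOver (c : K →+* K) hcv).toMonoidHom A = B := by
      apply Units.ext
      change integerMapOver (c : K →+* K) hcv A = B
      rw [hA, hB, mul_one, map_add, map_one, integerMapOver_algebraMap, D.mapRingHom_sqrt, map_neg]
      ring
    refine MonoidHom.ext fun u ↦ TrivialMod.eq_one_of_conj hsq hσ.not_isUnit hres hπ' ha hP
      (unitComponent_sq hχ) h5 hρP hneg (a := A) (b := B) (by rw [hA, mul_one])
      (by rw [hB]; ring) ?_ u
    rw [← hAB, D.conj.unitComponent_conj hcχ hcv]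
  -- For q ≡ 3 mod 4, -1 is not a square modulo q, so a nontrivial component would be -1 at -1.
  · by_contra hne
    have hσ := D.isUniformizer hvq
    have hq2 : q ≠ 2 := by rintro rfl; omega
    exact (map_neg_one_eq_one_iff (unitComponent_sq hχ) hσ
      (trivialMod_of_odd hχ hσ hvq D.prime hq2) hvq D.prime (D.absNorm_eq hvq) hne).1 hneg hq3

end LocalConditions

end IdeleClass

namespace IdeleClass

/-! ### Equivalence of (A)-(D) with the local conditions; conjugate characters -/

section Equivalence

variable {K : Type*} [Field K] [NumberField K] {c : K ≃ₐ[ℚ] K} {s : 𝓞 K} {q : ℕ}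
  {S : Set (HeightOneSpectrum (𝓞 K))} {π ζ : ∀ v : HeightOneSpectrum (𝓞 K), v.adicCompletion K}
  {v w : HeightOneSpectrum (𝓞 K)} {p : ℕ} {χ η : IdeleClassChar K}

theorem unitComponent_eq_of_localValueEq {u : (v.adicCompletionIntegers K)ˣ}
    {x : v.adicCompletion K} {z : Circle} (h : LocalValueEq χ v x z)
    (hu : ((u : v.adicCompletionIntegers K) : v.adicCompletion K) = x) :
    unitComponent χ v u = z := by
  obtain ⟨y, hy, rfl⟩ := h
  exact congrArg (localComponent χ v) (Units.ext (hu.trans hy.symm))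

theorem localValueEq_of_unitComponent {u : (v.adicCompletionIntegers K)ˣ}
    {x : v.adicCompletion K} {z : Circle} (h : unitComponent χ v u = z)
    (hu : ((u : v.adicCompletionIntegers K) : v.adicCompletion K) = x) : LocalValueEq χ v x z :=
  ⟨intUnits v u, hu, h⟩

theorem localGood_of_charConditions
    (hχ : ∀ x, χ.1 x ^ 2 = 1) (h : CharConditions S π ζ χ) (v : HeightOneSpectrum (𝓞 K)) :
    LocalGood S π ζ v (unitComponent χ v) where
  inert p hp hp2 hi hv := by
    by_contra hne
    exact h.ideal.inert p v hp hp2 hi hv ((dvd_conductor_iff hχ).2 hne)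
  split p hp hs hv hS := by
    by_contra hne
    exact hS (h.ideal.split p v hp hs hv ((dvd_conductor_iff hχ).2 hne)).1
  two_ramified hr hv u hu := by
    by_cases hne : unitComponent χ v = 1
    · rw [hne]; rfl
    · exact unitComponent_eq_of_localValueEq
        (h.value_ramified v hr hv ((dvd_conductor_iff hχ).2 hne)) hu
  two_inert hi hv := by
    by_cases hne : unitComponent χ v = 1
    · rw [hne]
      exact ⟨fun _ _ ↦ rfl, fun _ _ ↦ rfl⟩
    · have hd := (dvd_conductor_iff hχ).2 hne
      refine ⟨?_, fun u hu ↦ unitComponent_eq_of_localValueEq (h.value_inert v hi hv hd).2 hu⟩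
      have h2 : IsUniformizer (2 : v.adicCompletionIntegers K) := by
        exact_mod_cast hv.isUniformizer_of_isInert Nat.prime_two hi
      have h3 := h.ideal.two_inert v hi hv hd
      rw [emultiplicity_conductor hχ] at h3
      have h4 : conductorExponent χ v = 2 := by exact_mod_cast h3
      have h5 := (conductorExponent_le_iff hχ h2 2).1 h4.le
      convert h5 using 1
      norm_num

theorem conductorExponent_eq_succ (hχ : ∀ x, χ.1 x ^ 2 = 1) {ϖ : v.adicCompletionIntegers K}
    (hϖ : IsUniformizer ϖ) {n : ℕ} (h : TrivialMod (unitComponent χ v) (ϖ ^ (n + 1)))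
    (h' : ¬ TrivialMod (unitComponent χ v) (ϖ ^ n)) : conductorExponent χ v = n + 1 := by
  rw [← conductorExponent_le_iff hχ hϖ] at h h'
  omega

/-- The conductor exponent at a place above an odd prime. -/
theorem conductorExponent_of_odd (hχ : ∀ x, χ.1 x ^ 2 = 1) (hv : IsAbove v p) (hp : p.Prime)
    (hp2 : p ≠ 2) (hne : unitComponent χ v ≠ 1) : conductorExponent χ v = 1 := by
  obtain ⟨ϖ, hϖ⟩ := exists_isUniformizer v
  have h1 := trivialMod_of_odd hχ hϖ hv hp hp2
  rw [← pow_one ϖ, ← conductorExponent_le_iff hχ hϖ] at h1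
  rw [ne_eq, ← conductorExponent_eq_zero_iff hχ] at hne
  omega

/-- The conductor exponent at a split place above `2`. -/
theorem IsAbove.conductorExponent_of_split_two (hdeg : Module.finrank ℚ K = 2)
    (hχ : ∀ x, χ.1 x ^ 2 = 1) (hv : IsAbove v 2) (hcv : placeBelow (c : K →+* K) v ≠ v)
    (hne : unitComponent χ v ≠ 1) : conductorExponent χ v = 2 ∨ conductorExponent χ v = 3 := by
  have h2 : IsUniformizer (2 : v.adicCompletionIntegers K) := by
    exact_mod_cast hv.isUniformizer_of_ne hdeg Nat.prime_two hcv
  have hN := (hv.span_eq_of_placeBelow_ne hdeg Nat.prime_two hcv).2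
  have h3 : conductorExponent χ v ≤ 3 := by
    rw [conductorExponent_le_iff hχ h2]
    convert exists_trivialMod_pow hχ h2 using 1
    norm_num
  have h4 : ¬ conductorExponent χ v ≤ 1 := by
    rw [conductorExponent_le_iff hχ h2, pow_one]
    exact fun h ↦ hne (MonoidHom.ext fun u ↦
      TrivialMod.eq_one_of_residue h2.not_isUnit (h2.dvd_or_dvd_sub_one hN) h u)
  omega

/-- The conductor exponent at a ramified place above `2`. -/
theorem IsQuadraticData.conductorExponent_of_ramified_two (D : IsQuadraticData c s 2)
    (hπ : Valued.v (π v) = WithZero.exp (-1 : ℤ)) (hχ : ∀ x, χ.1 x ^ 2 = 1) (hv : IsAbove v 2)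
    (hgood : LocalGood S π ζ v (unitComponent χ v)) (hne : unitComponent χ v ≠ 1) :
    conductorExponent χ v = 4 ∨ conductorExponent χ v = 5 := by
  obtain ⟨hsq, hσ, hres, π', a, P, hπ', ha, hP, hπv⟩ := D.ramified_two hv hπ rfl
  set σ := algebraMap (𝓞 K) (v.adicCompletionIntegers K) s
  have hρP := hgood.two_ramified (D.ramifies hv) hv P (by rw [hP, ← hπv]; rfl)
  have h3 : conductorExponent χ v ≤ 5 := by
    rw [conductorExponent_le_iff hχ hσ]
    convert exists_trivialMod_pow hχ hσ using 1
    linear_combination (σ ^ 3 - 2 * σ) * hsq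
  have h4 : ¬ conductorExponent χ v ≤ 3 := by
    rw [conductorExponent_le_iff hχ hσ]
    exact fun h ↦ hne (MonoidHom.ext fun u ↦ TrivialMod.eq_one_of_cube hsq hσ.not_isUnit hres hπ'
      ha hP (unitComponent_sq hχ) h hρP u)
  omega

/-- The conductor exponent at an inert place above `2`. -/
theorem IsAbove.conductorExponent_of_inert_two (hdeg : Module.finrank ℚ K = 2)
    (hi : IsInert K 2) (hζ : IsPrimitiveRoot (ζ v) 3) (hχ : ∀ x, χ.1 x ^ 2 = 1) (hv : IsAbove v 2)
    (hgood : LocalGood S π ζ v (unitComponent χ v)) (hne : unitComponent χ v ≠ 1) :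
    conductorExponent χ v = 2 ∧ unitComponent χ v (-1) = -1 ∧
      ∃ u : (v.adicCompletionIntegers K)ˣ, ((u : v.adicCompletionIntegers K) : v.adicCompletion K) = 1 + 2 * ζ v ∧
        unitComponent χ v u = 1 := by
  obtain ⟨h2, z, P, hz, hres, hP, hzζ⟩ := hv.inert_two hdeg hi hζ
  obtain ⟨h4, h5⟩ := hgood.two_inert hi hv
  have hP' : ((P : v.adicCompletionIntegers K) : v.adicCompletion K) = 1 + 2 * ζ v := by
    rw [hP, ← hzζ]; rfl
  have hρP := h5 P hP'
  have key : ¬ (TrivialMod (unitComponent χ v) 2 ∨ unitComponent χ v (-1) = 1) := fun h ↦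
    hne (MonoidHom.ext fun u ↦ TrivialMod.eq_one_of_inert hz h2.not_isUnit hres hP
      (unitComponent_sq hχ) h4 hρP h u)
  rw [not_or] at key
  refine ⟨conductorExponent_eq_succ hχ h2 (n := 1) ?_ (by rw [pow_one]; exact key.1),
    (Circle.sq_eq_one_iff.1 (unitComponent_sq hχ _)).resolve_left key.2, P, hP', hρP⟩
  convert h4 using 1
  norm_num

/-- For a ramified quadratic component the exponents come for free: 1 at odd primes, 2 or 3 at a
split 2, and, given `LocalGood`, 4 or 5 at a ramified 2 and 2 at an inert 2, with value -1 at -1.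
Uniqueness in (B) holds because q is the only ramified prime. -/
theorem IsQuadraticData.charConditions_of_localGood (D : IsQuadraticData c s q)
    (hπ : ∀ v : HeightOneSpectrum (𝓞 K), IsAbove v 2 → Valued.v (π v) = WithZero.exp (-1 : ℤ))
    (hζ : ∀ v : HeightOneSpectrum (𝓞 K), IsInert K 2 → IsAbove v 2 → IsPrimitiveRoot (ζ v) 3)
    (hχ : ∀ x, χ.1 x ^ 2 = 1) (h : ∀ v, LocalGood S π ζ v (unitComponent χ v)) :
    CharConditions S π ζ χ where
  ideal :=
    { inert := fun p v hp hp2 hi hv hd ↦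
        (dvd_conductor_iff hχ).1 hd ((h v).inert p hp hp2 hi hv)
      ramified_unique := fun p p' v w hp _ hr hv _ hp' _ hr' hw _ ↦ by
        obtain rfl := D.eq_of_ramifies p hp hr
        obtain rfl := D.eq_of_ramifies p' hp' hr'
        have h1 := hw.dvd
        rw [D.span_eq hv] at h1
        exact (eq_of_asIdeal_dvd (w.prime.dvd_of_dvd_pow h1)).symm
      ramified_exponent := fun p v hp hp3 _ hv hd ↦ by
        rw [emultiplicity_conductor hχ, conductorExponent_of_odd hχ hv hp
          (by rintro rfl; omega) ((dvd_conductor_iff hχ).1 hd)]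
        rfl
      split := fun p v hp hs hv hd ↦ by
        have hne := (dvd_conductor_iff hχ).1 hd
        refine ⟨?_, fun hp2 ↦ ?_, ?_⟩
        · by_contra hvS
          exact hne ((h v).split p hp hs hv hvS)
        · rw [emultiplicity_conductor hχ, conductorExponent_of_odd hχ hv hp hp2 hne]
          rfl
        · rintro rfl
          rw [emultiplicity_conductor hχ]
          have := hv.conductorExponent_of_split_two D.finrank hχ
            ((D.conj.splits_iff D.finrank hv hp).1 hs) hne
          exact_mod_cast this
      two_ramified := fun v hr hv hd ↦ by
        obtain rfl := D.eq_of_ramifies 2 Nat.prime_two hr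
        rw [emultiplicity_conductor hχ]
        have := D.conductorExponent_of_ramified_two (hπ v hv) hχ hv (h v)
          ((dvd_conductor_iff hχ).1 hd)
        exact_mod_cast this
      two_inert := fun v hi hv hd ↦ by
        rw [emultiplicity_conductor hχ, (hv.conductorExponent_of_inert_two D.finrank hi
          (hζ v hi hv) hχ (h v) ((dvd_conductor_iff hχ).1 hd)).1]
        rfl }
  value_ramified v hr hv _ := by
    obtain rfl := D.eq_of_ramifies 2 Nat.prime_two hr
    obtain ⟨-, -, -, π', a, P, -, -, hP, hπv⟩ := D.ramified_two hv (hπ v hv) rfl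
    have hP' : ((P : v.adicCompletionIntegers K) : v.adicCompletion K) = 1 + π v := by
      rw [hP, ← hπv]; rfl
    exact localValueEq_of_unitComponent ((h v).two_ramified hr hv P hP') hP'
  value_inert v hi hv hd := by
    obtain ⟨-, h1, u, hu, h2⟩ := hv.conductorExponent_of_inert_two D.finrank hi
      (hζ v hi hv) hχ (h v) ((dvd_conductor_iff hχ).1 hd)
    exact ⟨localValueEq_of_unitComponent h1 (by push_cast; rfl),
      localValueEq_of_unitComponent h2 hu⟩

theorem sq_eq_one_of_isQuadratic (h : IsQuadratic χ) (x : IdeleGroup K) : χ.1 x ^ 2 = 1 := by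
  have h1 : χ ^ 2 = 1 := by rw [← h, pow_orderOf_eq_one]
  have h2 := congrArg (fun ψ : IdeleClassChar K ↦ ψ.1 x) h1
  rw [pow_two] at h2 ⊢
  exact h2

theorem ideleClassChar_ext {χ η : IdeleClassChar K} (h : ∀ x, χ.1 x = η.1 x) : χ = η :=
  Subtype.ext (ContinuousMonoidHom.ext h)

theorem isQuadratic_of_sq_eq_one (h : ∀ x, χ.1 x ^ 2 = 1) (h1 : χ ≠ 1) : IsQuadratic χ := by
  refine orderOf_eq_prime (ideleClassChar_ext fun x ↦ ?_) h1
  have := h x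
  rw [pow_two] at this ⊢
  exact this

theorem ne_one_of_isQuadratic (h : IsQuadratic χ) : ∃ x, χ.1 x ≠ 1 := by
  by_contra! hc
  have h1 : χ = 1 := ideleClassChar_ext hc
  unfold IsQuadratic at h
  rw [h1, orderOf_one] at h
  omega

theorem unitComponent_mul (v : HeightOneSpectrum (𝓞 K)) :
    unitComponent (χ * η) v = unitComponent χ v * unitComponent η v := rfl

theorem continuous_finiteAdeleMap (f : K →+* K) : Continuous (finiteAdeleMap f) :=
  RestrictedProduct.mapAlong_continuous
    (fun v : HeightOneSpectrum (𝓞 K) ↦ v.adicCompletion K)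
    (fun w : HeightOneSpectrum (𝓞 K) ↦ w.adicCompletion K)
    (placeBelow f) (tendsto_placeBelow f) (fun w ↦ finiteLocalMap f w)
    (Filter.Eventually.of_forall (finiteLocalMap_mapsTo f))
    fun w ↦ continuous_localMapOver (f := f) (w := w) rfl

theorem continuous_ideleConj (c : K ≃ₐ[ℚ] K) : Continuous (ideleConj c) := by
  have h : Continuous (adeleMap (c : K →+* K)) :=
    ((continuous_infiniteAdeleMap (c : K →+* K)).comp continuous_fst).prodMk
      ((continuous_finiteAdeleMap (c : K →+* K)).comp continuous_snd)
  exact Continuous.units_map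
    (adeleMap (c : K →+* K) : AdeleRing (𝓞 K) K →* AdeleRing (𝓞 K) K) h

theorem conj_principalIdele (c : K ≃ₐ[ℚ] K) (a : Kˣ) :
    ideleConj c (principalIdele K a) = principalIdele K (Units.map (c : K →* K) a) :=
  Units.ext (adeleMap_algebraMap (c : K →+* K) (a : K))

/-- The conjugate of an idele class character. -/
def conjChar (c : K ≃ₐ[ℚ] K) (χ : IdeleClassChar K) : IdeleClassChar K :=
  ⟨⟨(χ.1 : IdeleGroup K →* Circle).comp (ideleConj c),
    χ.1.continuous_toFun.comp (continuous_ideleConj c)⟩, fun a ↦ by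
    change χ.1 (ideleConj c (principalIdele K a)) = 1
    rw [conj_principalIdele, χ.2]⟩

theorem IsConjugation.conj_of_isBaseChange [Subsingleton (InfinitePlace K)]
    (hc : IsConjugation c) (h : IsBaseChange χ) (x : IdeleGroup K) :
    χ.1 (ideleConj c x) = χ.1 x := by
  obtain ⟨ν, hν⟩ := h
  rw [hν, hν, hc.ideleNorm_ideleConj]

end Equivalence

end IdeleClass

namespace IdeleClass

/-! ### Characters satisfying (A)-(D) and base change -/

section Conjugate

variable {K : Type*} [Field K] [NumberField K] [IsTotallyComplex K] {c : K ≃ₐ[ℚ] K} {s : 𝓞 K}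
  {q : ℕ} {S : Set (HeightOneSpectrum (𝓞 K))}
  {π ζ : ∀ v : HeightOneSpectrum (𝓞 K), v.adicCompletion K} {χ η : IdeleClassChar K}

theorem IsQuadraticData.not_conj_invariant (D : IsQuadraticData c s q)
    (hS : IsChoiceAboveSplit S)
    (hπ : ∀ v : HeightOneSpectrum (𝓞 K), IsAbove v 2 → Valued.v (π v) = WithZero.exp (-1 : ℤ))
    (hζ : ∀ v : HeightOneSpectrum (𝓞 K), IsInert K 2 → IsAbove v 2 → IsPrimitiveRoot (ζ v) 3)
    (hχ : IsQuadratic χ) (h : CharConditions S π ζ χ) :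
    ¬ ∀ x, χ.1 (ideleConj c x) = χ.1 x := by
  intro hinv
  have hχ2 := sq_eq_one_of_isQuadratic hχ
  obtain ⟨x, hx⟩ := ne_one_of_isQuadratic hχ
  exact hx (D.eq_one_of_conj_invariant hS hπ hζ hχ2 hinv (localGood_of_charConditions hχ2 h) x)

theorem IsQuadraticData.not_isBaseChange (D : IsQuadraticData c s q)
    (hS : IsChoiceAboveSplit S)
    (hπ : ∀ v : HeightOneSpectrum (𝓞 K), IsAbove v 2 → Valued.v (π v) = WithZero.exp (-1 : ℤ))
    (hζ : ∀ v : HeightOneSpectrum (𝓞 K), IsInert K 2 → IsAbove v 2 → IsPrimitiveRoot (ζ v) 3)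
    (hχ : IsQuadratic χ) (h : CharConditions S π ζ χ) : ¬ IsBaseChange χ := by
  have := subsingleton_infinitePlace D.finrank
  exact fun hb ↦ D.not_conj_invariant hS hπ hζ hχ h (D.conj.conj_of_isBaseChange hb)

theorem IsQuadraticData.exists_conj_eq_mul (D : IsQuadraticData c s q)
    (hS : IsChoiceAboveSplit S)
    (hπ : ∀ v : HeightOneSpectrum (𝓞 K), IsAbove v 2 → Valued.v (π v) = WithZero.exp (-1 : ℤ))
    (hζ : ∀ v : HeightOneSpectrum (𝓞 K), IsInert K 2 → IsAbove v 2 → IsPrimitiveRoot (ζ v) 3)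
    (hχ : IsQuadratic χ) (h : CharConditions S π ζ χ) :
    ∃ δ : IdeleClassChar K, IsQuadratic δ ∧
      ∀ x : IdeleGroup K, χ.1 (ideleConj c x) = χ.1 x * δ.1 x := by
  have hχ2 := sq_eq_one_of_isQuadratic hχ
  -- Since χ² = 1, the character δ = χ · χ^c satisfies χ^c = χδ; it is trivial only if χ is
  -- invariant under c.
  have key : ∀ x, χ.1 (ideleConj c x) = χ.1 x * (χ * conjChar c χ).1 x := fun x ↦ by
    change _ = χ.1 x * (χ.1 x * χ.1 (ideleConj c x))
    rw [← mul_assoc, ← pow_two, hχ2, one_mul]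
  refine ⟨χ * conjChar c χ, isQuadratic_of_sq_eq_one (fun x ↦ ?_) fun h1 ↦ ?_, key⟩
  · change (χ.1 x * χ.1 (ideleConj c x)) ^ 2 = 1
    rw [mul_pow, hχ2, hχ2, one_mul]
  · refine D.not_conj_invariant hS hπ hζ hχ h fun x ↦ ?_
    rw [key x, h1]
    exact mul_one _

theorem IsQuadraticData.not_exists_isBaseChange_mul (D : IsQuadraticData c s q)
    (hS : IsChoiceAboveSplit S)
    (hπ : ∀ v : HeightOneSpectrum (𝓞 K), IsAbove v 2 → Valued.v (π v) = WithZero.exp (-1 : ℤ))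
    (hζ : ∀ v : HeightOneSpectrum (𝓞 K), IsInert K 2 → IsAbove v 2 → IsPrimitiveRoot (ζ v) 3)
    (hχ : IsQuadratic χ) (hη : IsQuadratic η) (h : CharConditions S π ζ χ)
    (h' : CharConditions S π ζ η) (hne : χ ≠ η) :
    ¬ ∃ μ : IdeleClassChar K, IsBaseChange μ ∧ χ = η * μ := by
  have := subsingleton_infinitePlace D.finrank
  rintro ⟨μ, hμ, rfl⟩
  have hχ2 := sq_eq_one_of_isQuadratic hχ
  have hη2 := sq_eq_one_of_isQuadratic hη
  -- As η² = 1, μ is the product of η * μ and η, both of which satisfy the local conditions.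
  have hμη : μ = η * μ * η := ideleClassChar_ext fun x ↦ by
    change _ = η.1 x * μ.1 x * η.1 x
    rw [mul_right_comm, ← pow_two, hη2, one_mul]
  have hμ2 : ∀ x, μ.1 x ^ 2 = 1 := fun x ↦ by
    have : (η.1 x * μ.1 x) ^ 2 = 1 := hχ2 x
    rwa [mul_pow, hη2, one_mul] at this
  apply hne
  have hloc : ∀ v, LocalGood S π ζ v (unitComponent μ v) := fun v ↦ by
    rw [hμη]
    exact (localGood_of_charConditions hχ2 h v).mul (localGood_of_charConditions hη2 h' v)
  refine ideleClassChar_ext fun x ↦ ?_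
  change η.1 x * μ.1 x = η.1 x
  rw [D.eq_one_of_conj_invariant hS hπ hζ hμ2 (D.conj.conj_of_isBaseChange hμ) hloc, mul_one]

end Conjugate

end IdeleClass

namespace IdeleClass

/-! ### Local norms -/

section LocalNorm

theorem integerMapOver_dvd_iff {K L : Type*} [Field K] [NumberField K] [Field L] [NumberField L]
    {f : K →+* L} {v : HeightOneSpectrum (𝓞 K)} {w : HeightOneSpectrum (𝓞 L)}
    (h : placeBelow f w = v) (a b : v.adicCompletionIntegers K) :
    integerMapOver f h a ∣ integerMapOver f h b ↔ a ∣ b := by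
  obtain ⟨e, he, hx⟩ := exists_valued_localMapOver h
  rw [dvd_iff_valued_le, dvd_iff_valued_le, coe_integerMapOver, coe_integerMapOver, hx, hx]
  exact pow_le_pow_iff_left₀ zero_le zero_le he

theorem integerMapOver_injective {K L : Type*} [Field K] [NumberField K] [Field L] [NumberField L]
    {f : K →+* L} {v : HeightOneSpectrum (𝓞 K)} {w : HeightOneSpectrum (𝓞 L)}
    (h : placeBelow f w = v) : Function.Injective (integerMapOver f h) := fun a b hab ↦ by
  have h1 := (integerMapOver_dvd_iff h 0 (a - b)).1 (by rw [map_sub, hab, sub_self]; exact dvd_zero _)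
  exact sub_eq_zero.1 (zero_dvd_iff.1 h1)

variable {K : Type*} [Field K] [NumberField K] {c : K ≃ₐ[ℚ] K} {v w : HeightOneSpectrum (𝓞 K)}
  {P : HeightOneSpectrum (𝓞 ℚ)} {p : ℕ}

theorem IsAbove.absNorm_rat (h : IsAbove P p) (hp : p.Prime) :
    Ideal.absNorm P.asIdeal = p := by
  have h1 := Ideal.absNorm_dvd_absNorm_of_le (Ideal.dvd_iff_le.1 h.dvd)
  rw [Ideal.absNorm_span_natCast, RingOfIntegers.rank, Module.finrank_self, pow_one] at h1
  refine ((Nat.dvd_prime hp).1 h1).resolve_left fun h2 ↦ ?_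
  exact P.isPrime.ne_top (Ideal.absNorm_eq_one_iff.1 h2)

theorem IsAbove.isUniformizer_rat (h : IsAbove P p) (hp : p.Prime) :
    IsUniformizer (p : P.adicCompletionIntegers ℚ) := by
  obtain ⟨J, hJ⟩ := h.dvd
  refine isUniformizer_natCast hJ ?_
  have h1 := congrArg Ideal.absNorm hJ
  rw [map_mul, h.absNorm_rat hp, Ideal.absNorm_span_natCast, RingOfIntegers.rank,
    Module.finrank_self, pow_one] at h1
  have h2 : Ideal.absNorm J = 1 := Nat.eq_of_mul_eq_mul_left hp.pos (by rw [← h1, mul_one])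
  rw [Ideal.absNorm_eq_one_iff.1 h2, ← Ideal.one_eq_top]
  exact not_asIdeal_dvd_one

/-- Two places of a quadratic field above the same prime are conjugate. -/
theorem IsConjugation.eq_or_eq_placeBelow (hc : IsConjugation c) (hdeg : Module.finrank ℚ K = 2)
    (hp : p.Prime) (hv : IsAbove v p) (hw : IsAbove w p) :
    w = v ∨ w = placeBelow (c : K →+* K) v := by
  have hd := hw.dvd
  rcases hv.trichotomy hdeg hp with h | h | ⟨v', hv', h⟩ <;> rw [h] at hd
  · exact Or.inl (eq_of_asIdeal_dvd hd)
  · exact Or.inl (eq_of_asIdeal_dvd (w.prime.dvd_of_dvd_pow hd))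
  · rw [hc.placeBelow_eq_of_span hp hv' h]
    exact (w.prime.dvd_or_dvd hd).imp eq_of_asIdeal_dvd eq_of_asIdeal_dvd

variable [Subsingleton (InfinitePlace K)]

theorem IsConjugation.exists_norm (hc : IsConjugation c)
    (h : placeBelow (algebraMap ℚ K) w = P) (h' : placeBelow (c : K →+* K) w = w)
    (u : (w.adicCompletionIntegers K)ˣ) : ∃ n : (P.adicCompletionIntegers ℚ)ˣ,
      integerMapOver (algebraMap ℚ K) h n = u * integerMapOver (c : K →+* K) h' u := by
  have e := hc.finComp_ideleNorm (localIdele w (intUnits w u)) h h'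
  rw [finComp_localIdele_same] at e
  obtain ⟨n, hn⟩ := exists_intUnits_eq (x := finComp P (ideleNorm K (localIdele w (intUnits w u))))
    (by
      rw [← valued_localMapOver_eq_one_iff h, e, map_mul, coe_intUnits, valued_coe_unit, one_mul,
        valued_localMapOver_eq_one_iff h', valued_coe_unit])
  refine ⟨n, Subtype.ext ?_⟩
  rw [← hn] at e
  exact e

theorem IsConjugation.exists_integerMapOver_eq (hc : IsConjugation c)
    (h : placeBelow (algebraMap ℚ K) w = P) (h' : placeBelow (c : K →+* K) w ≠ w)
    (u : (w.adicCompletionIntegers K)ˣ) : ∃ n : (P.adicCompletionIntegers ℚ)ˣ,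
      Units.map (integerMapOver (algebraMap ℚ K) h).toMonoidHom n = u := by
  have e := hc.finComp_ideleNorm (localIdele w (intUnits w u)) h rfl
  rw [finComp_localIdele_same, finComp_localIdele_of_ne h', Units.val_one, map_one, mul_one] at e
  obtain ⟨n, hn⟩ := exists_intUnits_eq (x := finComp P (ideleNorm K (localIdele w (intUnits w u))))
    (by rw [← valued_localMapOver_eq_one_iff h, e, coe_intUnits, valued_coe_unit])
  refine ⟨n, Units.ext (Subtype.ext ?_)⟩
  rw [← hn] at e
  exact e

theorem IsConjugation.unitComponent_eq_one_of_placeBelow (hc : IsConjugation c)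
    {ν : IdeleClassChar ℚ} {μ : IdeleClassChar K} (hμ : ∀ x, μ.1 x = ν.1 (ideleNorm K x))
    (h : placeBelow (algebraMap ℚ K) w = P) (hν : unitComponent ν P = 1) :
    unitComponent μ w = 1 := by
  ext1 u
  by_cases h' : placeBelow (c : K →+* K) w = w
  · obtain ⟨n, hn⟩ := hc.exists_norm h h' u
    rw [hc.unitComponent_norm hμ h h' u n hn, hν]
    rfl
  · obtain ⟨n, rfl⟩ := hc.exists_integerMapOver_eq h h' u
    rw [hc.unitComponent_norm_of_ne hμ h h', hν]
    rfl

end LocalNorm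

/-- By counting, the values of x² and of g - qy² modulo p overlap. Thus norms from ℤ[√-q] reach
every class modulo p, nonresidues included. -/
theorem exists_dvd_sq_add_mul_sq_sub {p q : ℕ} (hp : p.Prime) (hp2 : p ≠ 2) (hq : ¬ p ∣ q) (g : ℤ) :
    ∃ x y : ℤ, (p : ℤ) ∣ x ^ 2 + q * y ^ 2 - g := by
  have := Fact.mk hp
  have hq0 : (q : ZMod p) ≠ 0 := by rwa [ne_eq, ZMod.natCast_eq_zero_iff]
  obtain ⟨a, b, hab⟩ := FiniteField.exists_root_sum_quadratic (R := ZMod p)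
    (f := Polynomial.X ^ 2) (g := Polynomial.C (q : ZMod p) * Polynomial.X ^ 2 +
      Polynomial.C 0 * Polynomial.X + Polynomial.C (-(g : ZMod p)))
    (Polynomial.degree_X_pow 2) (Polynomial.degree_quadratic hq0)
    (by rw [ZMod.card]; exact Nat.odd_iff.1 (hp.odd_of_ne_two hp2))
  obtain ⟨x, rfl⟩ := ZMod.intCast_surjective a
  obtain ⟨y, rfl⟩ := ZMod.intCast_surjective b
  refine ⟨x, y, (ZMod.intCast_zmod_eq_zero_iff_dvd _ p).1 ?_⟩
  simp at hab
  push_cast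
  linear_combination hab

/-! ### Local corrections -/

section Correction

variable {K : Type*} [Field K] [NumberField K] [IsTotallyComplex K] {c : K ≃ₐ[ℚ] K} {s : 𝓞 K}
  {q : ℕ} {v : HeightOneSpectrum (𝓞 K)} {P : HeightOneSpectrum (𝓞 ℚ)} {p : ℕ}
  {χ μ : IdeleClassChar K} {ν : IdeleClassChar ℚ}
  {π ζ : ∀ v : HeightOneSpectrum (𝓞 K), v.adicCompletion K}

/-- At an odd inert prime, all ramified quadratic characters of the local units agree, and one of
them is a base change. -/
theorem IsQuadraticData.unitComponent_eq_of_inert (D : IsQuadraticData c s q)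
    (hχ : ∀ x, χ.1 x ^ 2 = 1) (hμ2 : ∀ x, μ.1 x ^ 2 = 1)
    (hμ : ∀ x, μ.1 x = ν.1 (ideleNorm K x)) (hP : placeBelow (algebraMap ℚ K) v = P)
    (hv : IsAbove v p) (hp : p.Prime) (hp2 : p ≠ 2) (hi : IsInert K p)
    (hne : unitComponent χ v ≠ 1) (ht : TrivialMod (unitComponent ν P) p)
    {g : (P.adicCompletionIntegers ℚ)ˣ} (hg : unitComponent ν P g ≠ 1) :
    unitComponent χ v = unitComponent μ v := by
  have := subsingleton_infinitePlace D.finrank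
  have hPp : IsAbove P p := by rw [← hP]; exact (isAbove_placeBelow _ _).2 hv
  have hϖ := hPp.isUniformizer_rat hp
  have hϖ' := hv.isUniformizer_of_isInert hp hi
  have hcv := hv.placeBelow_eq_of_isInert (c := c) D.finrank hp hi
  have hpq : ¬ p ∣ q := fun h ↦ by
    obtain rfl := (Nat.prime_dvd_prime_iff_eq hp D.prime).1 h
    exact hv.not_ramifies_of_isInert D.finrank hp hi (D.ramifies hv)
  obtain ⟨G, hG⟩ := hϖ.exists_int hp (hPp.absNorm_rat hp) (g : P.adicCompletionIntegers ℚ)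
  -- x + y√-q has norm congruent to g, where ν is nontrivial, so the base change is ramified. Two
  -- nontrivial quadratic characters of level p have the same kernel, the squares modulo p.
  obtain ⟨x, y, z, hxy⟩ := exists_dvd_sq_add_mul_sq_sub hp hp2 hpq G
  have hN : ((x + y * s : 𝓞 K) * RingOfIntegers.mapRingHom (c : K →+* K) (x + y * s)) =
      ((x ^ 2 + q * y ^ 2 : ℤ) : 𝓞 K) := by
    rw [map_add, map_mul, map_intCast, map_intCast, D.mapRingHom_sqrt]
    push_cast
    linear_combination -(y : 𝓞 K) ^ 2 * D.sq
  set M : ℤ := x ^ 2 + q * y ^ 2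
  have hgM : (p : P.adicCompletionIntegers ℚ) ∣ g - M := by
    rw [show M = G + p * z by omega]
    push_cast
    rw [← sub_sub]
    exact hG.sub (dvd_mul_right _ _)
  have hM : IsUnit (M : P.adicCompletionIntegers ℚ) := by
    rw [hϖ.isUnit_iff_not_dvd]
    intro h
    apply hϖ.not_isUnit
    refine isUnit_of_dvd_unit ?_ g.isUnit
    have := hgM.add h
    rwa [sub_add_cancel] at this
  obtain ⟨n, hn⟩ := hM
  have hNv : (algebraMap (𝓞 K) (v.adicCompletionIntegers K) (x + y * s)) *
      integerMapOver (c : K →+* K) hcv (algebraMap (𝓞 K) (v.adicCompletionIntegers K) (x + y * s)) =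
      integerMapOver (algebraMap ℚ K) hP n := by
    rw [integerMapOver_algebraMap, ← map_mul, hN, hn, map_intCast, map_intCast]
  have hu : IsUnit (algebraMap (𝓞 K) (v.adicCompletionIntegers K) (x + y * s)) := by
    refine isUnit_of_mul_isUnit_left (y := integerMapOver (c : K →+* K) hcv
      (algebraMap (𝓞 K) (v.adicCompletionIntegers K) (x + y * s))) ?_
    rw [hNv]
    exact (isUnit_integerMapOver_iff hP _).2 n.isUnit
  obtain ⟨u, hu⟩ := hu
  have hμu : unitComponent μ v u ≠ 1 := by
    rw [D.conj.unitComponent_norm hμ hP hcv u n (by rw [hu, hNv]),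
      ← ht.map_eq (u := g) (w := n) (by rw [hn]; exact hgM)]
    exact hg
  obtain ⟨g', hg'⟩ : ∃ g, unitComponent χ v g ≠ 1 := by
    by_contra! hc
    exact hne (MonoidHom.ext hc)
  ext1 u'
  have e1 := (trivialMod_of_odd hχ hϖ' hv hp hp2).eq_one_iff_of_odd hϖ'.maximalIdeal_eq
    (unitComponent_sq hχ) hg' u'
  have e2 := (trivialMod_of_odd hμ2 hϖ' hv hp hp2).eq_one_iff_of_odd hϖ'.maximalIdeal_eq
    (unitComponent_sq hμ2) hμu u'
  rw [← e2] at e1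
  rcases Circle.sq_eq_one_iff.1 (unitComponent_sq hχ u') with h | h
  · rw [h, e1.1 h]
  · rw [h, ((Circle.sq_eq_one_iff.1 (unitComponent_sq hμ2 u')).resolve_left fun h' ↦
      Circle.neg_one_ne_one (h.symm.trans (e1.2 h')))]

/-- The values of a base change character at the inert place above `2`. -/
theorem IsQuadraticData.unitComponent_inert_two (D : IsQuadraticData c s q)
    (hμ : ∀ x, μ.1 x = ν.1 (ideleNorm K x)) (hP : placeBelow (algebraMap ℚ K) v = P)
    (hv : IsAbove v 2) (hi : IsInert K 2) (ht : TrivialMod (unitComponent ν P) 8)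
    {z : v.adicCompletionIntegers K} (hz : z ^ 2 + z + 1 = 0)
    {five : (P.adicCompletionIntegers ℚ)ˣ} (hfive : (five : P.adicCompletionIntegers ℚ) = 5)
    {u f : (v.adicCompletionIntegers K)ˣ} (hu : (u : v.adicCompletionIntegers K) = 1 + 2 * z)
    (hf : (f : v.adicCompletionIntegers K) = 1 + 4 * z) :
    unitComponent μ v u = unitComponent ν P (-five) ∧
      unitComponent μ v f = unitComponent ν P five := by
  have := subsingleton_infinitePlace D.finrank
  have hcv := hv.placeBelow_eq_of_isInert (c := c) D.finrank Nat.prime_two hi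
  have h2 : IsUniformizer (2 : v.adicCompletionIntegers K) := by
    exact_mod_cast hv.isUniformizer_of_isInert Nat.prime_two hi
  -- c(z) is one of the roots z and -1 - z, and `dvd_conj_sub` excludes z.
  have hcz : integerMapOver (c : K →+* K) hcv z = -1 - z := by
    set y := integerMapOver (c : K →+* K) hcv z with hy
    have h1 : y ^ 2 + y + 1 = 0 := by
      rw [hy, ← map_pow, ← map_add, ← map_one (integerMapOver (c : K →+* K) hcv), ← map_add, hz,
        map_zero]
    have h3 : (y - z) * (y + z + 1) = 0 := by linear_combination h1 - hz
    rcases mul_eq_zero.1 h3 with h | h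
    · exfalso
      have hd := D.dvd_conj_sub hv hi hcv hz
      rw [← hy, show y - (1 + z) = -1 by linear_combination h] at hd
      exact h2.not_isUnit (isUnit_of_dvd_unit hd isUnit_one.neg)
    · linear_combination h
  obtain ⟨n, hn⟩ := D.conj.exists_norm hP hcv u
  obtain ⟨m, hm⟩ := D.conj.exists_norm hP hcv f
  -- N(1 + 2z) = 3 ≡ -5 and N(1 + 4z) = 13 ≡ 5 modulo 8.
  have hn3 : (n : P.adicCompletionIntegers ℚ) = 3 := by
    have : integerMapOver (algebraMap ℚ K) hP n = integerMapOver (algebraMap ℚ K) hP 3 := by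
      rw [hn, hu, map_add, map_mul, hcz, map_one, map_ofNat, map_ofNat]
      linear_combination -4 * hz
    exact integerMapOver_injective hP this
  have hm13 : (m : P.adicCompletionIntegers ℚ) = 13 := by
    have : integerMapOver (algebraMap ℚ K) hP m = integerMapOver (algebraMap ℚ K) hP 13 := by
      rw [hm, hf, map_add, map_mul, hcz, map_one, map_ofNat, map_ofNat]
      linear_combination -16 * hz
    exact integerMapOver_injective hP this
  rw [D.conj.unitComponent_norm hμ hP hcv u n hn, D.conj.unitComponent_norm hμ hP hcv f m hm]
  exact ⟨ht.map_eq ⟨1, by rw [hn3, Units.val_neg, hfive]; norm_num⟩,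
    ht.map_eq ⟨1, by rw [hm13, hfive]; norm_num⟩⟩

/-- The value of a base change character at `1 + π` if `2` ramifies. -/
theorem IsQuadraticData.unitComponent_ramified_two (D : IsQuadraticData c s 2)
    (hμ : ∀ x, μ.1 x = ν.1 (ideleNorm K x)) (hP : placeBelow (algebraMap ℚ K) v = P)
    (hv : IsAbove v 2) (hπ : Valued.v (π v) = WithZero.exp (-1 : ℤ))
    (ht : TrivialMod (unitComponent ν P) 4) {u : (v.adicCompletionIntegers K)ˣ}
    (hu : ((u : v.adicCompletionIntegers K) : v.adicCompletion K) = 1 + π v) :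
    unitComponent μ v u = unitComponent ν P (-1) := by
  have := subsingleton_infinitePlace D.finrank
  have hcv := hv.placeBelow_eq_of_ramifies (c := c) D.finrank Nat.prime_two (D.ramifies hv)
  have hP2 : IsAbove P 2 := by rw [← hP]; exact (isAbove_placeBelow _ _).2 hv
  have h2 : IsUniformizer (2 : P.adicCompletionIntegers ℚ) := by
    exact_mod_cast hP2.isUniformizer_rat Nat.prime_two
  obtain ⟨hsq, hσ, hres, π', a, U, hπ', ⟨b, hb⟩, hU, hπv⟩ := D.ramified_two hv hπ rfl
  set σ := algebraMap (𝓞 K) (v.adicCompletionIntegers K) s with hσ'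
  obtain rfl : u = U := Units.ext (Subtype.ext (by rw [hu, hU, ← hπv]; rfl))
  have hcσ : integerMapOver (c : K →+* K) hcv σ = -σ := by
    rw [hσ', integerMapOver_algebraMap, D.mapRingHom_sqrt, map_neg]
  have key : ∀ r, ∃ t, r - integerMapOver (c : K →+* K) hcv r = σ * t := fun r ↦ by
    rcases hres r with ⟨t, ht⟩ | ⟨t, ht⟩
    · exact ⟨t + integerMapOver (c : K →+* K) hcv t, by
        rw [ht, map_mul, hcσ]; ring⟩
    · obtain rfl : r = 1 + σ * t := by linear_combination ht
      exact ⟨t + integerMapOver (c : K →+* K) hcv t, by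
        rw [map_add, map_mul, hcσ, map_one]; ring⟩
  obtain ⟨n, hn⟩ := D.conj.exists_norm hP hcv u
  obtain rfl : a = 1 + σ * b := by linear_combination hb
  -- With π = σ(1 + σb) and b' = c(b), the norm of 1 + π is 1 - 2(b + b') + 2(1 + σb)(1 - σb'). Here
  -- b + b' is even, and the last product is 1 modulo 2 because σ ∣ b - b'; so the norm is 3 modulo
  -- 4.
  have hd : (4 : v.adicCompletionIntegers K) ∣ integerMapOver (algebraMap ℚ K) hP n + 1 := by
    rw [hn, hU, hπ', map_add, map_mul, map_add, map_mul, map_one, hcσ]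
    obtain ⟨t, ht⟩ := key b
    obtain ⟨e, he⟩ : ∃ e, b + integerMapOver (c : K →+* K) hcv b = 2 * e := by
      rcases hres b with ⟨d, hd⟩ | ⟨d, hd⟩
      · obtain ⟨r, hr⟩ := key d
        refine ⟨-r, ?_⟩
        rw [hd, map_mul, hcσ]
        linear_combination σ * hr + r * hsq
      · obtain ⟨r, hr⟩ := key d
        have hb1 : b = 1 + σ * d := by linear_combination hd
        refine ⟨1 - r, ?_⟩
        rw [hb1, map_add, map_mul, hcσ, map_one]
        linear_combination σ * hr + r * hsq
    generalize integerMapOver (c : K →+* K) hcv b = b' at ht he ⊢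
    refine ⟨1 - e + b * b' - t, ?_⟩
    linear_combination σ ^ 2 * he - σ ^ 3 * ht + (-1 + 2 * e + (b * b' - t) * (σ ^ 2 - 2)) * hsq
  rw [← map_one (integerMapOver (algebraMap ℚ K) hP), ← map_add,
    ← map_ofNat (integerMapOver (algebraMap ℚ K) hP) 4, integerMapOver_dvd_iff] at hd
  rw [D.conj.unitComponent_norm hμ hP hcv u n hn]
  exact ht.map_eq (by push_cast; rwa [sub_neg_eq_add])

end Correction

end IdeleClass

namespace IdeleClass

/-! ### Existence of a correction at every rational prime -/

section Correction

variable {K : Type*} [Field K] [NumberField K] {c : K ≃ₐ[ℚ] K} {s : 𝓞 K}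
  {q : ℕ} {v w : HeightOneSpectrum (𝓞 K)} {P : HeightOneSpectrum (𝓞 ℚ)} {p : ℕ}
  {χ : IdeleClassChar K} {S : Set (HeightOneSpectrum (𝓞 K))}
  {π ζ : ∀ v : HeightOneSpectrum (𝓞 K), v.adicCompletion K}
  {ρ : (v.adicCompletionIntegers K)ˣ →* Circle}

/-- The decomposition types exclude one another, so only the clauses for the type at hand have
content; likewise in the next two lemmas. -/
theorem IsConjugation.localGood_of_isInert (hc : IsConjugation c) (hdeg : Module.finrank ℚ K = 2)
    (hv : IsAbove v p) (hp : p.Prime) (hi : IsInert K p) (hodd : p ≠ 2 → ρ = 1)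
    (htwo : p = 2 → TrivialMod ρ 4 ∧ ∀ u : (v.adicCompletionIntegers K)ˣ,
      ((u : v.adicCompletionIntegers K) : v.adicCompletion K) = 1 + 2 * ζ v → ρ u = 1) :
    LocalGood S π ζ v ρ where
  inert p' hp' hp2 _ hv' := hodd (by rwa [hv.eq hv' hp hp'])
  split p' hp' hs hv' _ := by
    obtain rfl := hv.eq hv' hp hp'
    exact absurd (hv.placeBelow_eq_of_isInert (c := c) hdeg hp hi) ((hc.splits_iff hdeg hv hp).1 hs)
  two_ramified hr hv' := by
    obtain rfl := hv.eq hv' hp Nat.prime_two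
    exact absurd hr (hv.not_ramifies_of_isInert hdeg hp hi)
  two_inert _ hv' := htwo (hv.eq hv' hp Nat.prime_two)

theorem IsConjugation.localGood_of_ramifies (hc : IsConjugation c) (hdeg : Module.finrank ℚ K = 2)
    (hv : IsAbove v p) (hp : p.Prime) (hr : Ramifies K p)
    (htwo : p = 2 → ∀ u : (v.adicCompletionIntegers K)ˣ,
      ((u : v.adicCompletionIntegers K) : v.adicCompletion K) = 1 + π v → ρ u = 1) :
    LocalGood S π ζ v ρ where
  inert p' hp' hp2 hi hv' := by
    obtain rfl := hv.eq hv' hp hp'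
    exact absurd hr (hv.not_ramifies_of_isInert hdeg hp hi)
  split p' hp' hs hv' _ := by
    obtain rfl := hv.eq hv' hp hp'
    exact absurd (hv.placeBelow_eq_of_ramifies (c := c) hdeg hp hr) ((hc.splits_iff hdeg hv hp).1 hs)
  two_ramified _ hv' := htwo (hv.eq hv' hp Nat.prime_two)
  two_inert hi hv' := by
    obtain rfl := hv.eq hv' hp Nat.prime_two
    exact absurd hr (hv.not_ramifies_of_isInert hdeg hp hi)

theorem IsConjugation.localGood_of_splits (hc : IsConjugation c) (hdeg : Module.finrank ℚ K = 2)
    (hv : IsAbove v p) (hp : p.Prime) (hs : Splits K p) (h : v ∉ S → ρ = 1) :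
    LocalGood S π ζ v ρ where
  inert p' hp' hp2 hi hv' := by
    obtain rfl := hv.eq hv' hp hp'
    exact absurd (hv.placeBelow_eq_of_isInert (c := c) hdeg hp hi) ((hc.splits_iff hdeg hv hp).1 hs)
  split _ _ _ _ := h
  two_ramified hr hv' := by
    obtain rfl := hv.eq hv' hp Nat.prime_two
    exact absurd (hv.placeBelow_eq_of_ramifies (c := c) hdeg hp hr) ((hc.splits_iff hdeg hv hp).1 hs)
  two_inert hi hv' := by
    obtain rfl := hv.eq hv' hp Nat.prime_two
    exact absurd (hv.placeBelow_eq_of_isInert (c := c) hdeg hp hi) ((hc.splits_iff hdeg hv hp).1 hs)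

variable (S π ζ χ) in
/-- A local character at `P` corrects `χ` if its base change makes `χ` satisfy the local
conditions at the places above `P`. -/
structure IsCorrection (P : HeightOneSpectrum (𝓞 ℚ)) (ψ : (P.adicCompletionIntegers ℚ)ˣ →* Circle) :
    Prop where
  sq : ∀ u, ψ u ^ 2 = 1
  level : ∃ ϖ : P.adicCompletionIntegers ℚ, IsUniformizer ϖ ∧ ∃ N : ℕ, TrivialMod ψ (ϖ ^ N)
  good : ∀ (ν : IdeleClassChar ℚ) (μ : IdeleClassChar K), (∀ x, μ.1 x ^ 2 = 1) →
    (∀ x, μ.1 x = ν.1 (ideleNorm K x)) → unitComponent ν P = ψ →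
    ∀ v, placeBelow (algebraMap ℚ K) v = P →
      LocalGood S π ζ v (unitComponent χ v * unitComponent μ v)

variable [IsTotallyComplex K]

/-- If χ_v is ramified, the ramified quadratic character of ℤ_pˣ works: its base change is χ_v by
`unitComponent_eq_of_inert`, and χ_v² = 1. -/
theorem IsQuadraticData.exists_isCorrection_of_isInert (D : IsQuadraticData c s q)
    (hχ : ∀ x, χ.1 x ^ 2 = 1) (hP : placeBelow (algebraMap ℚ K) v = P) (hv : IsAbove v p)
    (hp : p.Prime) (hp2 : p ≠ 2) (hi : IsInert K p) : ∃ ψ, IsCorrection χ S π ζ P ψ := by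
  have := subsingleton_infinitePlace D.finrank
  have hPp : IsAbove P p := by rw [← hP]; exact (isAbove_placeBelow _ _).2 hv
  have hϖ := hPp.isUniformizer_rat hp
  have huniq : ∀ w, placeBelow (algebraMap ℚ K) w = P → w = v := fun w hw ↦ by
    have h := D.conj.eq_or_eq_placeBelow D.finrank hp hv
      ((isAbove_placeBelow (algebraMap ℚ K) w).1 (hw ▸ hPp))
    rwa [hv.placeBelow_eq_of_isInert (c := c) D.finrank hp hi, or_self] at h
  by_cases hne : unitComponent χ v = 1
  · refine ⟨1, fun _ ↦ one_pow _, ⟨p, hϖ, 0, fun _ _ ↦ rfl⟩, fun ν μ _ hμ hν w hw ↦ ?_⟩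
    obtain rfl := huniq w hw
    rw [hne, D.conj.unitComponent_eq_one_of_placeBelow hμ hw hν, one_mul]
    exact LocalGood.one
  · obtain ⟨ψ, h1, h2, g, hg⟩ := exists_char_of_odd hϖ.maximalIdeal_eq (hϖ.isUnit_two hPp hp hp2)
    refine ⟨ψ, h1, ⟨p, hϖ, 1, by rwa [pow_one]⟩, fun ν μ hμ2 hμ hν w hw ↦ ?_⟩
    obtain rfl := huniq w hw
    subst hν
    rw [← D.unitComponent_eq_of_inert hχ hμ2 hμ hP hv hp hp2 hi hne h2 (g := g)
      (by rw [hg]; exact Circle.neg_one_ne_one)]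
    have e : unitComponent χ w * unitComponent χ w = 1 :=
      MonoidHom.ext fun u ↦ (pow_two _).symm.trans (unitComponent_sq hχ u)
    rw [e]
    exact LocalGood.one

theorem IsQuadraticData.exists_isCorrection_of_isInert_two (D : IsQuadraticData c s q)
    (hζ : ∀ v : HeightOneSpectrum (𝓞 K), IsInert K 2 → IsAbove v 2 → IsPrimitiveRoot (ζ v) 3)
    (hχ : ∀ x, χ.1 x ^ 2 = 1) (hP : placeBelow (algebraMap ℚ K) v = P) (hv : IsAbove v 2)
    (hi : IsInert K 2) : ∃ ψ, IsCorrection χ S π ζ P ψ := by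
  have hp := Nat.prime_two
  have hP2 : IsAbove P 2 := by rw [← hP]; exact (isAbove_placeBelow _ _).2 hv
  have hϖ : IsUniformizer (2 : P.adicCompletionIntegers ℚ) := by
    exact_mod_cast hP2.isUniformizer_rat hp
  have huniq : ∀ w, placeBelow (algebraMap ℚ K) w = P → w = v := fun w hw ↦ by
    have h := D.conj.eq_or_eq_placeBelow D.finrank hp hv
      ((isAbove_placeBelow (algebraMap ℚ K) w).1 (hw ▸ hP2))
    rwa [hv.placeBelow_eq_of_isInert (c := c) D.finrank hp hi, or_self] at h
  obtain ⟨h2, z, U, hz, hres, hU, hzζ⟩ := hv.inert_two D.finrank hi (hζ v hi hv)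
  obtain ⟨f, hf⟩ := exists_unit_eq_one_add_mul h2.not_isUnit (2 * z)
  replace hf : (f : v.adicCompletionIntegers K) = 1 + 4 * z := by rw [hf]; ring
  obtain ⟨five, hfive⟩ := exists_unit_five hϖ.not_isUnit
  have hf2 := unitComponent_sq hχ f
  have hU2 := unitComponent_sq hχ U
  -- The base change of ψ is ψ(-5) at U = 1 + 2ζ and ψ(5) at f = 1 + 4ζ. To cancel χ at both, ψ(5)
  -- has to be χ(f), and ψ(-1) the product χ(f)χ(U).
  obtain ⟨ψ, h1, h8, h3, h4⟩ := exists_char_zmod_eight hϖ.not_isUnit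
    (hϖ.dvd_or_dvd_sub_one (hP2.absNorm_rat hp)) two_ne_zero_integers five hfive
    (unitComponent χ v f * unitComponent χ v U) (unitComponent χ v f)
    (by rw [mul_pow, hf2, hU2, one_mul]) hf2
  refine ⟨ψ, h1, ⟨2, hϖ, 3, by convert h8; norm_num⟩, fun ν μ hμ2 hμ hν w hw ↦ ?_⟩
  obtain rfl := huniq w hw
  subst hν
  obtain ⟨e1, e2⟩ := D.unitComponent_inert_two hμ hP hv hi h8 hz hfive hU hf
  have e3 : (unitComponent χ w * unitComponent μ w) U = 1 := by
    rw [MonoidHom.mul_apply, e1, ← neg_one_mul five, map_mul, h3, h4, mul_right_comm, ← pow_two,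
      hf2, one_mul, ← pow_two, hU2]
  have e4 : (unitComponent χ w * unitComponent μ w) f = 1 := by
    rw [MonoidHom.mul_apply, e2, h4, ← pow_two, hf2]
  have e5 : ∀ u, (unitComponent χ w * unitComponent μ w) u ^ 2 = 1 := fun u ↦ by
    rw [MonoidHom.mul_apply, mul_pow, unitComponent_sq hχ, unitComponent_sq hμ2, one_mul]
  have e6 : TrivialMod (unitComponent χ w * unitComponent μ w) 8 := by
    convert (exists_trivialMod_pow hχ h2).mul (exists_trivialMod_pow hμ2 h2) using 1
    norm_num
  refine D.conj.localGood_of_isInert D.finrank hv hp hi (absurd rfl) fun _ ↦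
    ⟨TrivialMod.four_of_inert hz hres hU e5 e6 hf e4, fun u hu ↦ ?_⟩
  rw [← e3]
  congr 1
  refine Units.ext (Subtype.ext ?_)
  rw [hu, hU, ← hzζ]
  rfl

theorem IsQuadraticData.exists_isCorrection_of_ramifies (D : IsQuadraticData c s q)
    (hπ : ∀ v : HeightOneSpectrum (𝓞 K), IsAbove v 2 → Valued.v (π v) = WithZero.exp (-1 : ℤ))
    (hχ : ∀ x, χ.1 x ^ 2 = 1) (hP : placeBelow (algebraMap ℚ K) v = P) (hv : IsAbove v p)
    (hp : p.Prime) (hr : Ramifies K p) : ∃ ψ, IsCorrection χ S π ζ P ψ := by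
  have hPp : IsAbove P p := by rw [← hP]; exact (isAbove_placeBelow _ _).2 hv
  have hϖ := hPp.isUniformizer_rat hp
  have habove : ∀ w, placeBelow (algebraMap ℚ K) w = P → IsAbove w p := fun w hw ↦
    (isAbove_placeBelow (algebraMap ℚ K) w).1 (hw ▸ hPp)
  obtain rfl := D.eq_of_ramifies p hp hr
  by_cases hp2 : p = 2
  · subst hp2
    have huniq : ∀ w, placeBelow (algebraMap ℚ K) w = P → w = v := fun w hw ↦ by
      have h := D.conj.eq_or_eq_placeBelow D.finrank hp hv (habove w hw)
      rwa [hv.placeBelow_eq_of_ramifies (c := c) D.finrank hp hr, or_self] at h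
    replace hϖ : IsUniformizer (2 : P.adicCompletionIntegers ℚ) := by exact_mod_cast hϖ
    obtain ⟨hsq, hσ, hres, π', a, U, hπ', hb, hU, hπv⟩ := D.ramified_two hv (hπ v hv) rfl
    obtain ⟨five, hfive⟩ := exists_unit_five hϖ.not_isUnit
    have hres2 := hϖ.dvd_or_dvd_sub_one (hPp.absNorm_rat hp)
    -- ψ(-1) is chosen to cancel χ at 1 + π. The value 1 at 5 makes ψ trivial modulo 4, the
    -- precision to which the norm of 1 + π is known.
    obtain ⟨ψ, h1, h8, h3, h4⟩ := exists_char_zmod_eight hϖ.not_isUnit hres2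
      two_ne_zero_integers five hfive (unitComponent χ v U) 1 (unitComponent_sq hχ U) (one_pow 2)
    refine ⟨ψ, h1, ⟨2, hϖ, 3, by convert h8; norm_num⟩, fun ν μ hμ2 hμ hν w hw ↦ ?_⟩
    obtain rfl := huniq w hw
    subst hν
    refine D.conj.localGood_of_ramifies D.finrank hv hp hr fun _ u hu ↦ ?_
    rw [MonoidHom.mul_apply, D.unitComponent_ramified_two hμ hP hv (hπ w hv)
      (TrivialMod.four_of_eight hres2 h8 hfive h4) hu, h3]
    obtain rfl : u = U := Units.ext (Subtype.ext (by rw [hu, hU, ← hπv]; rfl))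
    rw [← pow_two, unitComponent_sq hχ]
  · exact ⟨1, fun _ ↦ one_pow _, ⟨p, hϖ, 0, fun _ _ ↦ rfl⟩, fun ν μ _ hμ hν w hw ↦
      D.conj.localGood_of_ramifies D.finrank (habove w hw) hp hr (absurd · hp2)⟩

/-- At the conjugate w of the chosen place the local integers are those of ℚ_p, so χ_w is itself a
character ψ of ℤ_pˣ; its base change at w is χ_w, and χ_w² = 1. At the chosen place nothing is
required. -/
theorem IsQuadraticData.exists_isCorrection_of_splits (D : IsQuadraticData c s q)
    (hS : IsChoiceAboveSplit S) (hχ : ∀ x, χ.1 x ^ 2 = 1)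
    (hP : placeBelow (algebraMap ℚ K) w = P) (hw : IsAbove w p)
    (hp : p.Prime) (hs : Splits K p) : ∃ ψ, IsCorrection χ S π ζ P ψ := by
  have := subsingleton_infinitePlace D.finrank
  have hPp : IsAbove P p := by rw [← hP]; exact (isAbove_placeBelow _ _).2 hw
  have hϖ := hPp.isUniformizer_rat hp
  have habove : ∀ w, placeBelow (algebraMap ℚ K) w = P → IsAbove w p := fun w hw ↦
    (isAbove_placeBelow (algebraMap ℚ K) w).1 (hw ▸ hPp)
  obtain ⟨v, hvS, hv⟩ := (hS.existsUnique p hp hs).exists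
  have hPv : placeBelow (algebraMap ℚ K) (placeBelow (c : K →+* K) v) = P := by
    rw [placeBelow_conj]
    rcases D.conj.eq_or_eq_placeBelow D.finrank hp hw hv with rfl | rfl
    · exact hP
    · rw [placeBelow_conj, hP]
  have hv' := habove _ hPv
  have hne' := (D.conj.splits_iff D.finrank hv' hp).1 hs
  have hϖ' := hv'.isUniformizer_of_ne D.finrank hp hne'
  obtain ⟨N, hN⟩ := exists_trivialMod_unitComponent hχ _ hϖ'
  refine ⟨(unitComponent χ _).comp (Units.map (integerMapOver (algebraMap ℚ K) hPv).toMonoidHom),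
    fun u ↦ unitComponent_sq hχ _, ⟨p, hϖ, N, fun u hu ↦ hN _ ?_⟩, fun ν μ hμ2 hμ hν w hw ↦ ?_⟩
  · have h := (integerMapOver_dvd_iff hPv _ _).2 hu
    rw [map_pow, map_natCast, map_sub, map_one] at h
    exact h
  · refine D.conj.localGood_of_splits D.finrank (habove w hw) hp hs fun hwS ↦ ?_
    obtain rfl := (D.conj.eq_or_eq_placeBelow D.finrank hp hv (habove w hw)).resolve_left
      fun h ↦ hwS (h ▸ hvS)
    ext1 u
    obtain ⟨n, rfl⟩ := D.conj.exists_integerMapOver_eq hPv hne' u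
    rw [MonoidHom.mul_apply, D.conj.unitComponent_norm_of_ne hμ hPv hne', hν, MonoidHom.comp_apply,
      ← pow_two, unitComponent_sq hχ]
    rfl

theorem IsQuadraticData.exists_isCorrection (D : IsQuadraticData c s q)
    (hS : IsChoiceAboveSplit S)
    (hπ : ∀ v : HeightOneSpectrum (𝓞 K), IsAbove v 2 → Valued.v (π v) = WithZero.exp (-1 : ℤ))
    (hζ : ∀ v : HeightOneSpectrum (𝓞 K), IsInert K 2 → IsAbove v 2 → IsPrimitiveRoot (ζ v) 3)
    (hχ : ∀ x, χ.1 x ^ 2 = 1) (P : HeightOneSpectrum (𝓞 ℚ)) :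
    ∃ ψ, IsCorrection χ S π ζ P ψ := by
  obtain ⟨v, rfl⟩ := placeBelow_surjective (algebraMap ℚ K) P
  obtain ⟨p, hp, hv⟩ := exists_prime_isAbove v
  rcases hv.inert_or_ramifies_or_splits D.finrank hp with hi | hr | hs
  · by_cases hp2 : p = 2
    · subst hp2
      exact D.exists_isCorrection_of_isInert_two hζ hχ rfl hv hi
    · exact D.exists_isCorrection_of_isInert hχ rfl hv hp hp2 hi
  · exact D.exists_isCorrection_of_ramifies hπ hχ rfl hv hp hr
  · exact D.exists_isCorrection_of_splits hS hχ rfl hv hp hs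

end Correction

/-! ### Idele class characters of `ℚ` -/

section Rational

/-- The map from the units of the infinite adeles of `ℚ` to the reals. -/
def ratInfiniteToReal : InfiniteAdeleRing ℚ →+* ℝ :=
  (InfinitePlace.Completion.extensionEmbeddingOfIsReal Rat.isReal_infinitePlace).comp
    (Pi.evalRingHom (fun v : InfinitePlace ℚ ↦ v.Completion) Rat.infinitePlace)

theorem continuous_ratInfiniteToReal : Continuous ratInfiniteToReal :=
  (InfinitePlace.Completion.isometry_extensionEmbeddingOfIsReal _).continuous.comp
    (continuous_apply _)

/-- At the real place both signs at -1 are available. This freedom removes the product-formula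
obstruction over ℚ. -/
theorem exists_signChar (ε : Circle) (hε : ε ^ 2 = 1) :
    ∃ φ₀ : (InfiniteAdeleRing ℚ)ˣ →* Circle, (∀ z, φ₀ z ^ 2 = 1) ∧ Continuous φ₀ ∧
      φ₀ (-1) = ε := by
  classical
  have hne : ∀ z : (InfiniteAdeleRing ℚ)ˣ, ratInfiniteToReal z ≠ 0 := fun z ↦
    (z.isUnit.map ratInfiniteToReal).ne_zero
  have hcont : Continuous fun z : (InfiniteAdeleRing ℚ)ˣ ↦ ratInfiniteToReal z :=
    continuous_ratInfiniteToReal.comp Units.continuous_val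
  have hclopen : IsClopen {z : (InfiniteAdeleRing ℚ)ˣ | 0 < ratInfiniteToReal z} := by
    refine ⟨?_, isOpen_lt continuous_const hcont⟩
    convert isClosed_le continuous_const hcont using 1
    ext z
    change 0 < ratInfiniteToReal z ↔ 0 ≤ ratInfiniteToReal z
    exact ⟨le_of_lt, fun h ↦ lt_of_le_of_ne h (hne z).symm⟩
  let φ₀ : (InfiniteAdeleRing ℚ)ˣ →* Circle :=
    { toFun := fun z ↦ if 0 < ratInfiniteToReal z then 1 else ε
      map_one' := by simp
      map_mul' := fun x y ↦ by
        rw [Units.val_mul, map_mul]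
        rcases lt_or_gt_of_ne (hne x) with hx | hx <;> rcases lt_or_gt_of_ne (hne y) with hy | hy
        · rw [if_pos (mul_pos_of_neg_of_neg hx hy), if_neg hx.not_gt, if_neg hy.not_gt, ← pow_two, hε]
        · rw [if_neg (mul_neg_of_neg_of_pos hx hy).not_gt, if_neg hx.not_gt, if_pos hy, mul_one]
        · rw [if_neg (mul_neg_of_pos_of_neg hx hy).not_gt, if_pos hx, if_neg hy.not_gt, one_mul]
        · rw [if_pos (mul_pos hx hy), if_pos hx, if_pos hy, one_mul] }
  refine ⟨φ₀, fun z ↦ ?_, ?_, ?_⟩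
  · change (if _ then _ else _) ^ 2 = _
    split_ifs
    · exact one_pow 2
    · exact hε
  · refine Continuous.if (fun z hz ↦ ?_) continuous_const continuous_const
    rw [hclopen.frontier_eq] at hz
    exact absurd hz (Set.notMem_empty z)
  · change (if _ then _ else _) = _
    rw [if_neg]
    simp

theorem ringOfIntegers_rat_units (u : (𝓞 ℚ)ˣ) : u = 1 ∨ u = -1 := by
  have := Int.units_eq_one_or (Units.mapEquiv Rat.ringOfIntegersEquiv.toMulEquiv u)
  refine this.imp (fun h ↦ ?_) fun h ↦ ?_
  · rwa [map_eq_one_iff _ (MulEquiv.injective _)] at h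
  · apply (Units.mapEquiv Rat.ringOfIntegersEquiv.toMulEquiv).injective
    rw [h]
    ext
    simp

/-- Characters of the local units with values `±1`, almost all trivial, are the components of a
character of `ℚ`. -/
theorem exists_ratIdeleClassChar (T : Finset (HeightOneSpectrum (𝓞 ℚ)))
    (φ : ∀ P : HeightOneSpectrum (𝓞 ℚ), (P.adicCompletionIntegers ℚ)ˣ →* Circle)
    (hφ : ∀ P u, φ P u ^ 2 = 1)
    (hlevel : ∀ P, ∃ ϖ : P.adicCompletionIntegers ℚ, IsUniformizer ϖ ∧
      ∃ N : ℕ, TrivialMod (φ P) (ϖ ^ N)) :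
    ∃ ν : IdeleClassChar ℚ, (∀ x, ν.1 x ^ 2 = 1) ∧ (∀ P ∈ T, unitComponent ν P = φ P) ∧
      (∀ P ∉ T, unitComponent ν P = 1) := by
  have hε : (∏ P ∈ T, φ P (-1)) ^ 2 = 1 := by
    rw [← Finset.prod_pow]
    exact Finset.prod_eq_one fun P _ ↦ hφ P _
  -- The sign at infinity is matched to the product of the local values at -1, so that together they
  -- give a square of ±1.
  obtain ⟨φ₀, h1, h2, h3⟩ := exists_signChar _ hε
  have hodd : Odd (classNumber ℚ) := by rw [Rat.classNumber_eq]; exact odd_one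
  obtain ⟨ν, hν, hT, hT', -⟩ := exists_ideleClassChar hodd T φ₀ h1 h2 φ hφ hlevel fun u ↦ by
    rcases ringOfIntegers_rat_units u with rfl | rfl
    · simp
    · have e1 : Units.map ((algebraMap ℚ (InfiniteAdeleRing ℚ)).comp (algebraMap (𝓞 ℚ) ℚ) :
          𝓞 ℚ →+* InfiniteAdeleRing ℚ).toMonoidHom (-1) = -1 := Units.ext (by simp)
      have e2 : ∀ P : HeightOneSpectrum (𝓞 ℚ), Units.map
          (algebraMap (𝓞 ℚ) (P.adicCompletionIntegers ℚ) :
            𝓞 ℚ →* P.adicCompletionIntegers ℚ) (-1) = -1 := fun P ↦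
        Units.ext (by simp)
      simp_rw [e2]
      rw [e1, h3, ← pow_two, hε]
  exact ⟨ν, hν, hT, hT'⟩

end Rational

/-! ### Correcting a quadratic character by a base change -/

section BaseChange

variable {K : Type*} [Field K] [NumberField K] [IsTotallyComplex K] {c : K ≃ₐ[ℚ] K} {s : 𝓞 K}
  {q : ℕ} {χ : IdeleClassChar K} {S : Set (HeightOneSpectrum (𝓞 K))}
  {π ζ : ∀ v : HeightOneSpectrum (𝓞 K), v.adicCompletion K}

theorem IsQuadraticData.exists_isBaseChange (D : IsQuadraticData c s q)
    (hS : IsChoiceAboveSplit S)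
    (hπ : ∀ v : HeightOneSpectrum (𝓞 K), IsAbove v 2 → Valued.v (π v) = WithZero.exp (-1 : ℤ))
    (hζ : ∀ v : HeightOneSpectrum (𝓞 K), IsInert K 2 → IsAbove v 2 → IsPrimitiveRoot (ζ v) 3)
    (hχ : IsQuadratic χ) :
    ∃ μ : IdeleClassChar K, IsBaseChange μ ∧ μ ^ 2 = 1 ∧ CharConditions S π ζ (χ * μ) := by
  classical
  have := subsingleton_infinitePlace D.finrank
  have hχ2 := sq_eq_one_of_isQuadratic hχ
  choose ψ hψ using D.exists_isCorrection hS hπ hζ hχ2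
  obtain ⟨T, hT, -⟩ := exists_finset_unitComponent hχ2
  -- Only the primes below T are corrected; above the others both χ and the base change are
  -- unramified.
  obtain ⟨ν, hν2, hνT, hνT'⟩ := exists_ratIdeleClassChar (T.image (placeBelow (algebraMap ℚ K)))
    ψ (fun P ↦ (hψ P).sq) fun P ↦ (hψ P).level
  obtain ⟨μ, hμ⟩ := D.conj.exists_baseChange hν2
  have hμ2 : ∀ x, μ.1 x ^ 2 = 1 := fun x ↦ by rw [hμ, hν2]
  refine ⟨μ, ⟨ν, hμ⟩, ideleClassChar_ext fun x ↦ ?_, D.charConditions_of_localGood hπ hζ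
    (fun x ↦ ?_) fun v ↦ ?_⟩
  · have := hμ2 x
    rw [pow_two] at this ⊢
    exact this
  · change (χ.1 x * μ.1 x) ^ 2 = 1
    rw [mul_pow, hχ2, hμ2, one_mul]
  · rw [unitComponent_mul]
    by_cases hv : placeBelow (algebraMap ℚ K) v ∈ T.image (placeBelow (algebraMap ℚ K))
    · exact (hψ _).good ν μ hμ2 hμ (hνT _ hv) v rfl
    · rw [hT v fun h ↦ hv (Finset.mem_image_of_mem _ h),
        D.conj.unitComponent_eq_one_of_placeBelow hμ rfl (hνT' _ hv), one_mul]
      exact LocalGood.one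

end BaseChange

end IdeleClass

namespace IdeleClass

/-! ### Characters with prescribed conductor -/

section Signs

variable {K : Type*} [Field K] [NumberField K] {v : HeightOneSpectrum (𝓞 K)} {p : ℕ}

/-- The place `v` is above a prime congruent to `3` modulo `4`. -/
def IsThreeModFour (v : HeightOneSpectrum (𝓞 K)) : Prop :=
  ∃ p : ℕ, p.Prime ∧ p % 4 = 3 ∧ IsAbove v p

theorem IsAbove.isThreeModFour_iff (h : IsAbove v p) (hp : p.Prime) :
    IsThreeModFour v ↔ p % 4 = 3 :=
  ⟨fun ⟨p', hp', h3, h'⟩ ↦ by rwa [h.eq h' hp hp'], fun h3 ↦ ⟨p, hp, h3, h⟩⟩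

open scoped Classical in
/-- The value at `-1` of a ramified quadratic character of the local units at a place above an odd
prime. -/
def signAt (v : HeightOneSpectrum (𝓞 K)) : Circle := if IsThreeModFour v then -1 else 1

theorem prod_signAt {𝔣 : Ideal (𝓞 K)} {T : Finset (HeightOneSpectrum (𝓞 K))}
    (hT : ∀ v, v ∈ T ↔ v.asIdeal ∣ 𝔣) :
    ∏ v ∈ T, signAt v = (-1) ^ numPlacesThreeModFour 𝔣 := by
  classical
  have h : {v : HeightOneSpectrum (𝓞 K) | v.asIdeal ∣ 𝔣 ∧ ∃ p : ℕ, p.Prime ∧ p % 4 = 3 ∧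
      IsAbove v p} = ↑(T.filter IsThreeModFour) := by
    ext v
    rw [Finset.coe_filter]
    exact and_congr_left' (hT v).symm
  rw [numPlacesThreeModFour, h, Set.ncard_coe_finset]
  unfold signAt
  rw [Finset.prod_ite, Finset.prod_const, Finset.prod_const_one, mul_one]

theorem signAt_of_isAbove_two (h : IsAbove v 2) : signAt v = 1 := by
  rw [signAt, if_neg]
  rw [h.isThreeModFour_iff Nat.prime_two]
  omega

theorem prod_eq_of_forall_signAt {𝔣 : Ideal (𝓞 K)} {T : Finset (HeightOneSpectrum (𝓞 K))}
    (hT : ∀ v, v ∈ T ↔ v.asIdeal ∣ 𝔣) {f : HeightOneSpectrum (𝓞 K) → Circle}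
    (hf : ∀ v ∈ T, ¬ IsAbove v 2 → f v = signAt v) (h2 : ¬ ∃ v, v.asIdeal ∣ 𝔣 ∧ IsAbove v 2) :
    ∏ v ∈ T, f v = (-1) ^ numPlacesThreeModFour 𝔣 := by
  rw [← prod_signAt hT]
  exact Finset.prod_congr rfl fun v hv ↦ hf v hv fun h ↦ h2 ⟨v, (hT v).1 hv, h⟩

/-- `signAt` is 1 above 2, so the factor at v splits off and the others count the places above
primes ≡ 3 mod 4. -/
theorem prod_eq_mul_of_forall_signAt {𝔣 : Ideal (𝓞 K)} {T : Finset (HeightOneSpectrum (𝓞 K))}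
    (hT : ∀ v, v ∈ T ↔ v.asIdeal ∣ 𝔣) {f : HeightOneSpectrum (𝓞 K) → Circle}
    (hf : ∀ v ∈ T, ¬ IsAbove v 2 → f v = signAt v) (hv : v.asIdeal ∣ 𝔣) (hv2 : IsAbove v 2)
    (huniq : ∀ w : HeightOneSpectrum (𝓞 K), w.asIdeal ∣ 𝔣 → IsAbove w 2 → w = v) :
    ∏ v ∈ T, f v = f v * (-1) ^ numPlacesThreeModFour 𝔣 := by
  classical
  rw [← prod_signAt hT, ← Finset.mul_prod_erase T f ((hT v).2 hv),
    ← Finset.mul_prod_erase T signAt ((hT v).2 hv), signAt_of_isAbove_two hv2, one_mul]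
  congr 1
  refine Finset.prod_congr rfl fun w hw ↦ ?_
  rw [Finset.mem_erase] at hw
  exact hf w hw.2 fun h ↦ hw.1 (huniq w ((hT w).1 hw.2) h)

theorem exists_finset_dvd {𝔣 : Ideal (𝓞 K)} (h : 𝔣 ≠ ⊥) :
    ∃ T : Finset (HeightOneSpectrum (𝓞 K)), ∀ v, v ∈ T ↔ v.asIdeal ∣ 𝔣 :=
  ⟨(Ideal.finite_factors h).toFinset, fun v ↦ by rw [Set.Finite.mem_toFinset]; rfl⟩

theorem ideal_eq_of_emultiplicity {I J : Ideal (𝓞 K)} (hI : I ≠ ⊥) (hJ : J ≠ ⊥)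
    (h : ∀ v : HeightOneSpectrum (𝓞 K), emultiplicity v.asIdeal I = emultiplicity v.asIdeal J) :
    I = J := by
  have key : ∀ P : Ideal (𝓞 K), Prime P → emultiplicity P I = emultiplicity P J := fun P hP ↦
    h ⟨P, Ideal.isPrime_of_prime hP, hP.ne_zero⟩
  apply dvd_antisymm
  · exact (UniqueFactorizationMonoid.dvd_iff_emultiplicity_le hI).2 fun P hP ↦ (key P hP).le
  · exact (UniqueFactorizationMonoid.dvd_iff_emultiplicity_le hJ).2 fun P hP ↦ (key P hP).ge

theorem neg_one_pow_eq_one_iff_circle (n : ℕ) : (-1 : Circle) ^ n = 1 ↔ Even n := by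
  refine ⟨fun h ↦ ?_, fun h ↦ h.neg_one_pow⟩
  by_contra hn
  rw [Nat.not_even_iff_odd] at hn
  rw [hn.neg_one_pow] at h
  exact Circle.neg_one_ne_one h

end Signs

/-! ### Necessity of the parity conditions -/

section Necessity

variable {K : Type*} [Field K] [NumberField K] {c : K ≃ₐ[ℚ] K} {s : 𝓞 K} {q : ℕ}
  {S : Set (HeightOneSpectrum (𝓞 K))} {π ζ : ∀ v : HeightOneSpectrum (𝓞 K), v.adicCompletion K}
  {v w : HeightOneSpectrum (𝓞 K)} {p : ℕ} {χ : IdeleClassChar K} {𝔣 : Ideal (𝓞 K)}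

theorem IdealConditions.not_isInert (h : IdealConditions S 𝔣) (hv : v.asIdeal ∣ 𝔣)
    (hvp : IsAbove v p) (hp : p.Prime) (hp2 : p ≠ 2) : ¬ IsInert K p :=
  fun hi ↦ h.inert p v hp hp2 hi hvp hv

theorem IsQuadraticData.absNorm_of_not_isInert (D : IsQuadraticData c s q) (hvp : IsAbove v p)
    (hp : p.Prime) (hi : ¬ IsInert K p) : Ideal.absNorm v.asIdeal = p := by
  rcases hvp.inert_or_ramifies_or_splits D.finrank hp with h | h | h
  · exact absurd h hi
  · obtain rfl := D.eq_of_ramifies p hp h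
    exact D.absNorm_eq hvp
  · exact (hvp.span_eq_of_placeBelow_ne D.finrank hp ((D.conj.splits_iff D.finrank hvp hp).1 h)).2

/-- At most one place above `2` divides an ideal satisfying the conditions. -/
theorem IsQuadraticData.eq_of_isAbove_two (D : IsQuadraticData c s q) (hS : IsChoiceAboveSplit S)
    (h : IdealConditions S 𝔣) (hv : v.asIdeal ∣ 𝔣) (hv2 : IsAbove v 2) (hw : w.asIdeal ∣ 𝔣)
    (hw2 : IsAbove w 2) : w = v := by
  by_cases hs : Splits K 2
  · exact (hS.existsUnique 2 Nat.prime_two hs).unique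
      ⟨(h.split 2 w Nat.prime_two hs hw2 hw).1, hw2⟩ ⟨(h.split 2 v Nat.prime_two hs hv2 hv).1, hv2⟩
  · have h1 : placeBelow (c : K →+* K) v = v := by
      by_contra h1
      exact hs ((D.conj.splits_iff D.finrank hv2 Nat.prime_two).2 h1)
    have h2 := D.conj.eq_or_eq_placeBelow D.finrank Nat.prime_two hv2 hw2
    rwa [h1, or_self] at h2

theorem map_neg_one_eq_signAt {ρ : (v.adicCompletionIntegers K)ˣ →* Circle}
    (hρ : ∀ u, ρ u ^ 2 = 1) {ϖ : v.adicCompletionIntegers K} (hϖ : IsUniformizer ϖ)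
    (h : TrivialMod ρ ϖ) (hv : IsAbove v p) (hp : p.Prime)
    (hN : Ideal.absNorm v.asIdeal = p) (hne : ρ ≠ 1) : ρ (-1) = signAt v := by
  have h1 := map_neg_one_eq_one_iff hρ hϖ h hv hp hN hne
  rw [signAt]
  split_ifs with h3 <;> rw [hv.isThreeModFour_iff hp] at h3
  · exact (Circle.sq_eq_one_iff.1 (hρ _)).resolve_left fun h ↦ h1.1 h h3
  · exact h1.2 h3

/-- The value at `-1` of a character satisfying the conditions, at a place above `2` with conductor
exponent `2` or `4`. -/
theorem IsQuadraticData.map_neg_one_of_conductorExponent (D : IsQuadraticData c s q)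
    (hπ : ∀ v : HeightOneSpectrum (𝓞 K), IsAbove v 2 → Valued.v (π v) = WithZero.exp (-1 : ℤ))
    (hζ : ∀ v : HeightOneSpectrum (𝓞 K), IsInert K 2 → IsAbove v 2 → IsPrimitiveRoot (ζ v) 3)
    (hχ : ∀ x, χ.1 x ^ 2 = 1) (hloc : LocalGood S π ζ v (unitComponent χ v)) (hv : IsAbove v 2)
    (hne : unitComponent χ v ≠ 1) (he : conductorExponent χ v = 2 ∨ conductorExponent χ v = 4) :
    unitComponent χ v (-1) = -1 := by
  rcases hv.inert_or_ramifies_or_splits D.finrank Nat.prime_two with hi | hr | hs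
  · exact (hv.conductorExponent_of_inert_two D.finrank hi (hζ v hi hv) hχ hloc hne).2.1
  -- With exponent at most 4, the value 1 at -1 would make the component trivial; the split case
  -- below is similar, with exponent 2.
  · refine (Circle.sq_eq_one_iff.1 (unitComponent_sq hχ _)).resolve_left fun h1 ↦ hne ?_
    obtain rfl := D.eq_of_ramifies 2 Nat.prime_two hr
    obtain ⟨hsq, hσ, hres, π', a, U, hπ', ha, hU, hπv⟩ := D.ramified_two hv (hπ v hv) rfl
    have hρU := hloc.two_ramified hr hv U (by rw [hU, ← hπv]; rfl)
    have h4 := (conductorExponent_le_iff hχ hσ 4).1 (by omega)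
    exact MonoidHom.ext fun u ↦ TrivialMod.eq_one_of_four_ramified hsq hσ.not_isUnit hres hπ' ha hU
      (unitComponent_sq hχ) h4 hρU h1 u
  · refine (Circle.sq_eq_one_iff.1 (unitComponent_sq hχ _)).resolve_left fun h1 ↦ hne ?_
    have hcv := (D.conj.splits_iff D.finrank hv Nat.prime_two).1 hs
    have h2 : IsUniformizer (2 : v.adicCompletionIntegers K) := by
      exact_mod_cast hv.isUniformizer_of_ne D.finrank Nat.prime_two hcv
    have hN := (hv.span_eq_of_placeBelow_ne D.finrank Nat.prime_two hcv).2
    have h3 := hv.conductorExponent_of_split_two D.finrank hχ hcv hne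
    have h4 := (conductorExponent_le_iff hχ h2 2).1 (by omega)
    refine MonoidHom.ext fun u ↦ TrivialMod.eq_one_of_four h2.not_isUnit
      (h2.dvd_or_dvd_sub_one hN) (by convert h4 using 1; norm_num) h1 u

/-- The parity conditions on the conductor of a quadratic character. -/
theorem IsQuadraticData.parity_of_isQuadratic [IsTotallyComplex K] (D : IsQuadraticData c s q)
    (hS : IsChoiceAboveSplit S)
    (hπ : ∀ v : HeightOneSpectrum (𝓞 K), IsAbove v 2 → Valued.v (π v) = WithZero.exp (-1 : ℤ))
    (hζ : ∀ v : HeightOneSpectrum (𝓞 K), IsInert K 2 → IsAbove v 2 → IsPrimitiveRoot (ζ v) 3)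
    (h𝔣 : conductor χ ≠ ⊥) (hχ' : IsQuadratic χ) (h : CharConditions S π ζ χ) :
    ((¬ ∃ v : HeightOneSpectrum (𝓞 K), v.asIdeal ∣ conductor χ ∧ IsAbove v 2) →
        Even (numPlacesThreeModFour (conductor χ))) ∧
      ((∃ v : HeightOneSpectrum (𝓞 K), v.asIdeal ∣ conductor χ ∧ IsAbove v 2 ∧
          (emultiplicity v.asIdeal (conductor χ) = 2 ∨
            emultiplicity v.asIdeal (conductor χ) = 4)) →
        Odd (numPlacesThreeModFour (conductor χ))) := by
  have hχ := sq_eq_one_of_isQuadratic hχ'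
  obtain ⟨T, hT⟩ := exists_finset_dvd h𝔣
  obtain ⟨T', hT', hprod⟩ := exists_finset_forall_prod_eq_one hχ (map_infIdele_eq_one hχ)
  have hsub : T ⊆ T' := fun v hv ↦ by
    by_contra hv'
    exact (dvd_conductor_iff hχ).1 ((hT v).1 hv) (hT' v hv')
  -- Unramified places contribute 1, so the product formula runs over the divisors of the conductor.
  rw [← Finset.prod_subset hsub fun v _ hv ↦ by
    have : unitComponent χ v = 1 := by
      by_contra hne
      exact hv ((hT v).2 ((dvd_conductor_iff hχ).2 hne))
    rw [this]; rfl] at hprod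
  have hf : ∀ v ∈ T, ¬ IsAbove v 2 → unitComponent χ v (-1) = signAt v := fun v hv hv2 ↦ by
    have hd := (hT v).1 hv
    obtain ⟨p, hp, hvp⟩ := exists_prime_isAbove v
    have hp2 : p ≠ 2 := by rintro rfl; exact hv2 hvp
    obtain ⟨ϖ, hϖ⟩ := exists_isUniformizer v
    exact map_neg_one_eq_signAt (unitComponent_sq hχ) hϖ (trivialMod_of_odd hχ hϖ hvp hp hp2) hvp hp
      (D.absNorm_of_not_isInert hvp hp (h.ideal.not_isInert hd hvp hp hp2))
      ((dvd_conductor_iff hχ).1 hd)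
  refine ⟨fun h2 ↦ ?_, ?_⟩
  · rwa [prod_eq_of_forall_signAt hT hf h2, neg_one_pow_eq_one_iff_circle] at hprod
  · rintro ⟨v, hv, hv2, hm⟩
    rw [prod_eq_mul_of_forall_signAt hT hf hv hv2 fun w hw hw2 ↦
      D.eq_of_isAbove_two hS h.ideal hv hv2 hw hw2, D.map_neg_one_of_conductorExponent hπ hζ hχ
      (localGood_of_charConditions hχ h v) hv2 ((dvd_conductor_iff hχ).1 hv) (by
        rw [emultiplicity_conductor hχ] at hm
        exact_mod_cast hm), ← pow_succ', neg_one_pow_eq_one_iff_circle] at hprod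
    exact Nat.not_even_iff_odd.1 (Nat.even_add_one.1 hprod)

end Necessity

end IdeleClass

namespace IdeleClass

/-! ### Sufficiency of the parity conditions -/

section Sufficiency

variable {K : Type*} [Field K] [NumberField K] {c : K ≃ₐ[ℚ] K} {s : 𝓞 K} {q : ℕ}
  {S : Set (HeightOneSpectrum (𝓞 K))} {π ζ : ∀ v : HeightOneSpectrum (𝓞 K), v.adicCompletion K}
  {v w : HeightOneSpectrum (𝓞 K)} {p : ℕ} {χ : IdeleClassChar K} {𝔣 : Ideal (𝓞 K)}

/-- A local character with values `±1`, conductor exponent `m` and value `z` at `-1`. -/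
structure IsLocalChar (v : HeightOneSpectrum (𝓞 K)) (ρ : (v.adicCompletionIntegers K)ˣ →* Circle)
    (m : ℕ) (z : Circle) : Prop where
  sq : ∀ u, ρ u ^ 2 = 1
  map_neg_one : ρ (-1) = z
  exists_level : ∃ ϖ : v.adicCompletionIntegers K, IsUniformizer ϖ ∧ ∃ k, m = k + 1 ∧
    TrivialMod ρ (ϖ ^ (k + 1)) ∧ ¬ TrivialMod ρ (ϖ ^ k)

theorem IsLocalChar.conductorExponent_eq {m : ℕ} {z : Circle} (hχ : ∀ x, χ.1 x ^ 2 = 1)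
    (h : IsLocalChar v (unitComponent χ v) m z) : conductorExponent χ v = m := by
  obtain ⟨ϖ, hϖ, k, rfl, h1, h2⟩ := h.exists_level
  exact conductorExponent_eq_succ hχ hϖ h1 h2

theorem IsQuadraticData.exists_isLocalChar_odd (D : IsQuadraticData c s q)
    (h : IdealConditions S 𝔣) (hv : v.asIdeal ∣ 𝔣) (hv2 : ¬ IsAbove v 2) :
    ∃ ρ m, IsLocalChar v ρ m (signAt v) ∧ LocalGood S π ζ v ρ ∧ emultiplicity v.asIdeal 𝔣 = m := by
  obtain ⟨p, hp, hvp⟩ := exists_prime_isAbove v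
  have hp2 : p ≠ 2 := by rintro rfl; exact hv2 hvp
  have hi := h.not_isInert hv hvp hp hp2
  obtain ⟨ϖ, hϖ⟩ := exists_isUniformizer v
  obtain ⟨ρ, h1, h2, g, hg⟩ := exists_char_of_odd hϖ.maximalIdeal_eq (hϖ.isUnit_two hvp hp hp2)
  have hne : ρ ≠ 1 := by
    rintro rfl
    exact Circle.neg_one_ne_one hg.symm
  refine ⟨ρ, 1, ⟨h1, map_neg_one_eq_signAt h1 hϖ h2 hvp hp (D.absNorm_of_not_isInert hvp hp hi) hne,
    ϖ, hϖ, 0, rfl, by rwa [zero_add, pow_one], fun h0 ↦ hne (MonoidHom.ext fun u ↦ h0 u ?_)⟩, ?_⟩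
  · rw [pow_zero]
    exact one_dvd _
  rcases hvp.inert_or_ramifies_or_splits D.finrank hp with hi' | hr | hs
  · exact absurd hi' hi
  · refine ⟨D.conj.localGood_of_ramifies D.finrank hvp hp hr (absurd · hp2), ?_⟩
    rw [Nat.cast_one]
    refine h.ramified_exponent p v hp ?_ hr hvp hv
    obtain rfl := D.eq_of_ramifies p hp hr
    exact D.mod_four.resolve_left hp2
  · obtain ⟨hvS, h3, -⟩ := h.split p v hp hs hvp hv
    exact ⟨D.conj.localGood_of_splits D.finrank hvp hp hs (absurd hvS), h3 hp2⟩

theorem IsQuadraticData.exists_isLocalChar_inert_two (D : IsQuadraticData c s q)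
    (hζ : ∀ v : HeightOneSpectrum (𝓞 K), IsInert K 2 → IsAbove v 2 → IsPrimitiveRoot (ζ v) 3)
    (hv2 : IsAbove v 2) (hi : IsInert K 2) :
    ∃ ρ, IsLocalChar v ρ 2 (-1) ∧ LocalGood S π ζ v ρ := by
  obtain ⟨h2, z, U, hz, hres, hU, hzζ⟩ := hv2.inert_two D.finrank hi (hζ v hi hv2)
  obtain ⟨ρ, h1, h4, hρU, hneg⟩ :=
    exists_char_inert hz h2.not_isUnit hres hU two_ne_zero_integers
  refine ⟨ρ, ⟨h1, hneg, 2, h2, 1, rfl, by convert h4 using 1; norm_num, fun h ↦ ?_⟩,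
    D.conj.localGood_of_isInert D.finrank hv2 Nat.prime_two hi (absurd rfl) fun _ ↦
      ⟨h4, fun u hu ↦ ?_⟩⟩
  -- Since -1 ≡ 1 modulo 2, the value -1 at -1 rules out exponent at most 1.
  · refine Circle.neg_one_ne_one (hneg.symm.trans (h (-1) ⟨-1, ?_⟩))
    rw [Units.val_neg, Units.val_one]
    ring
  · rw [← hρU]
    congr 1
    refine Units.ext (Subtype.ext ?_)
    rw [hu, hU, ← hzζ]
    rfl

/-- Exponent 2 belongs to the nontrivial character of (ℤ/4)ˣ, which is -1 at -1. Exponent 3 means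
value -1 at 5, and the value at -1 is then free. -/
theorem IsQuadraticData.exists_isLocalChar_split_two (D : IsQuadraticData c s q)
    (hv2 : IsAbove v 2) (hs : Splits K 2) (hvS : v ∈ S) :
    (∃ ρ, IsLocalChar v ρ 2 (-1) ∧ LocalGood S π ζ v ρ) ∧
      ∀ ε : Circle, ε ^ 2 = 1 → ∃ ρ, IsLocalChar v ρ 3 ε ∧ LocalGood S π ζ v ρ := by
  have hcv := (D.conj.splits_iff D.finrank hv2 Nat.prime_two).1 hs
  have h2 : IsUniformizer (2 : v.adicCompletionIntegers K) := by
    exact_mod_cast hv2.isUniformizer_of_ne D.finrank Nat.prime_two hcv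
  have hres := h2.dvd_or_dvd_sub_one
    (hv2.span_eq_of_placeBelow_ne D.finrank Nat.prime_two hcv).2
  obtain ⟨five, hfive⟩ := exists_unit_five h2.not_isUnit
  have hgood : ∀ ρ, LocalGood S π ζ v ρ := fun ρ ↦
    D.conj.localGood_of_splits D.finrank hv2 Nat.prime_two hs (absurd hvS)
  have hneg1 : (-1 : Circle) ^ 2 = 1 := by rw [neg_one_sq]
  constructor
  · obtain ⟨ρ, h1, h8, h3, h5⟩ := exists_char_zmod_eight h2.not_isUnit hres two_ne_zero_integers
      five hfive (-1) 1 hneg1 (one_pow 2)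
    refine ⟨ρ, ⟨h1, h3, 2, h2, 1, rfl, ?_, fun h ↦ ?_⟩, hgood ρ⟩
    · convert TrivialMod.four_of_eight hres h8 hfive h5 using 1
      norm_num
    · refine Circle.neg_one_ne_one (h3.symm.trans (h (-1) ⟨-1, ?_⟩))
      rw [Units.val_neg, Units.val_one]
      ring
  · intro ε hε
    obtain ⟨ρ, h1, h8, h3, h5⟩ := exists_char_zmod_eight h2.not_isUnit hres two_ne_zero_integers
      five hfive ε (-1) hε hneg1
    refine ⟨ρ, ⟨h1, h3, 2, h2, 2, rfl, by convert h8 using 1; norm_num, fun h ↦ ?_⟩, hgood ρ⟩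
    refine Circle.neg_one_ne_one (h5.symm.trans (h five ⟨1, ?_⟩))
    rw [hfive]
    norm_num

/-- In exponent 5 the sign at -1 is switched by the character ρ of exponent 4, which is -1 at -1 and
trivial at 5 = 1 + σ⁴, so the value -1 at 5 survives. -/
theorem IsQuadraticData.exists_isLocalChar_ramified_two (D : IsQuadraticData c s q)
    (hπ : ∀ v : HeightOneSpectrum (𝓞 K), IsAbove v 2 → Valued.v (π v) = WithZero.exp (-1 : ℤ))
    (hv2 : IsAbove v 2) (hr : Ramifies K 2) :
    (∃ ρ, IsLocalChar v ρ 4 (-1) ∧ LocalGood S π ζ v ρ) ∧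
      ∀ ε : Circle, ε ^ 2 = 1 → ∃ ρ, IsLocalChar v ρ 5 ε ∧ LocalGood S π ζ v ρ := by
  obtain rfl := D.eq_of_ramifies 2 Nat.prime_two hr
  obtain ⟨hsq, hσ, hres, π', a, U, hπ', ha, hU, hπv⟩ := D.ramified_two hv2 (hπ v hv2) rfl
  set σ := algebraMap (𝓞 K) (v.adicCompletionIntegers K) s
  have hgood : ∀ ρ : (v.adicCompletionIntegers K)ˣ →* Circle, ρ U = 1 → LocalGood S π ζ v ρ :=
    fun ρ hρU ↦ D.conj.localGood_of_ramifies D.finrank hv2 Nat.prime_two hr fun _ u hu ↦ by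
      rw [← hρU]
      congr 1
      refine Units.ext (Subtype.ext ?_)
      rw [hu, hU, ← hπv]
      rfl
  obtain ⟨five, hfive⟩ : ∃ five : (v.adicCompletionIntegers K)ˣ,
      (five : v.adicCompletionIntegers K) = 5 := by
    obtain ⟨u, hu⟩ := exists_unit_eq_one_add_mul hσ.not_isUnit (σ ^ 3)
    exact ⟨u, by rw [hu]; linear_combination (σ ^ 2 - 2) * hsq⟩
  have hfive4 : σ ^ 4 ∣ (five : v.adicCompletionIntegers K) - 1 :=
    ⟨1, by rw [hfive]; linear_combination -(σ ^ 2 - 2) * hsq⟩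
  obtain ⟨ρ, h1, h4, hρU, hneg⟩ := exists_char_ramified_four hsq hσ.not_isUnit hres hπ' ha hU
    hσ.ne_zero
  obtain ⟨ψ, k1, k5, hψU, kneg, kfive⟩ := exists_char_ramified_five hsq hσ.not_isUnit hres hπ' ha hU
    hσ.ne_zero hfive
  refine ⟨⟨ρ, ⟨h1, hneg, σ, hσ, 3, rfl, h4, fun h ↦ ?_⟩, hgood ρ hρU⟩, fun ε hε ↦ ?_⟩
  · exact Circle.neg_one_ne_one (hneg.symm.trans
      (TrivialMod.eq_one_of_cube hsq hσ.not_isUnit hres hπ' ha hU h1 h hρU (-1)))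
  · rcases Circle.sq_eq_one_iff.1 hε with rfl | rfl
    · exact ⟨ψ, ⟨k1, kneg, σ, hσ, 4, rfl, k5, fun h ↦
        Circle.neg_one_ne_one (kfive.symm.trans (h five hfive4))⟩, hgood ψ hψU⟩
    · refine ⟨ψ * ρ, ⟨fun u ↦ ?_, ?_, σ, hσ, 4, rfl,
        k5.mul (h4.of_dvd (pow_dvd_pow σ (by norm_num))), fun h ↦ ?_⟩, hgood _ ?_⟩
      · rw [MonoidHom.mul_apply, mul_pow, k1, h1, one_mul]
      · rw [MonoidHom.mul_apply, kneg, hneg, one_mul]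
      · have h5 := h five hfive4
        rw [MonoidHom.mul_apply, kfive, h4 five hfive4, mul_one] at h5
        exact Circle.neg_one_ne_one h5
      · rw [MonoidHom.mul_apply, hψU, hρU, one_mul]

theorem IsQuadraticData.exists_isLocalChar_two (D : IsQuadraticData c s q)
    (hπ : ∀ v : HeightOneSpectrum (𝓞 K), IsAbove v 2 → Valued.v (π v) = WithZero.exp (-1 : ℤ))
    (hζ : ∀ v : HeightOneSpectrum (𝓞 K), IsInert K 2 → IsAbove v 2 → IsPrimitiveRoot (ζ v) 3)
    (h : IdealConditions S 𝔣) (hv : v.asIdeal ∣ 𝔣) (hv2 : IsAbove v 2) {ε : Circle}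
    (hε : ε ^ 2 = 1)
    (hneg : emultiplicity v.asIdeal 𝔣 = 2 ∨ emultiplicity v.asIdeal 𝔣 = 4 → ε = -1) :
    ∃ ρ m, IsLocalChar v ρ m ε ∧ LocalGood S π ζ v ρ ∧ emultiplicity v.asIdeal 𝔣 = m := by
  rcases hv2.inert_or_ramifies_or_splits D.finrank Nat.prime_two with hi | hr | hs
  · have hm := h.two_inert v hi hv2 hv
    obtain rfl := hneg (Or.inl hm)
    obtain ⟨ρ, h1, h2⟩ := D.exists_isLocalChar_inert_two (S := S) (π := π) hζ hv2 hi
    exact ⟨ρ, 2, h1, h2, hm⟩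
  · obtain ⟨h4, h5⟩ := D.exists_isLocalChar_ramified_two (S := S) (ζ := ζ) hπ hv2 hr
    rcases h.two_ramified v hr hv2 hv with hm | hm
    · obtain rfl := hneg (Or.inr hm)
      obtain ⟨ρ, h1, h2⟩ := h4
      exact ⟨ρ, 4, h1, h2, hm⟩
    · obtain ⟨ρ, h1, h2⟩ := h5 ε hε
      exact ⟨ρ, 5, h1, h2, hm⟩
  · obtain ⟨hvS, -, hm⟩ := h.split 2 v Nat.prime_two hs hv2 hv
    obtain ⟨h2, h3⟩ := D.exists_isLocalChar_split_two (π := π) (ζ := ζ) hv2 hs hvS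
    rcases hm rfl with hm | hm
    · obtain rfl := hneg (Or.inl hm)
      obtain ⟨ρ, h1, h2⟩ := h2
      exact ⟨ρ, 2, h1, h2, hm⟩
    · obtain ⟨ρ, h1, h2⟩ := h3 ε hε
      exact ⟨ρ, 3, h1, h2, hm⟩

/-- The existence of a quadratic character with a given conductor. -/
theorem IsQuadraticData.exists_conductor_eq [IsTotallyComplex K] (D : IsQuadraticData c s q)
    (hS : IsChoiceAboveSplit S)
    (hπ : ∀ v : HeightOneSpectrum (𝓞 K), IsAbove v 2 → Valued.v (π v) = WithZero.exp (-1 : ℤ))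
    (hζ : ∀ v : HeightOneSpectrum (𝓞 K), IsInert K 2 → IsAbove v 2 → IsPrimitiveRoot (ζ v) 3)
    (h0 : 𝔣 ≠ ⊥) (h1 : 𝔣 ≠ ⊤) (h : IdealConditions S 𝔣)
    (heven : (¬ ∃ v : HeightOneSpectrum (𝓞 K), v.asIdeal ∣ 𝔣 ∧ IsAbove v 2) →
      Even (numPlacesThreeModFour 𝔣))
    (hodd : (∃ v : HeightOneSpectrum (𝓞 K), v.asIdeal ∣ 𝔣 ∧ IsAbove v 2 ∧
      (emultiplicity v.asIdeal 𝔣 = 2 ∨ emultiplicity v.asIdeal 𝔣 = 4)) →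
      Odd (numPlacesThreeModFour 𝔣)) :
    ∃ χ : IdeleClassChar K, IsQuadratic χ ∧ conductor χ = 𝔣 ∧ CharConditions S π ζ χ := by
  classical
  -- The factors away from 2 multiply to (-1)^r, so a place above 2 must contribute ε = (-1)^r at
  -- -1. Exponents 2 and 4 only allow -1, which is why r must then be odd; without a place above 2,
  -- r must be even.
  set ε : Circle := (-1) ^ numPlacesThreeModFour 𝔣 with hε
  have hε2 : ε ^ 2 = 1 := by rw [hε, ← pow_mul, mul_comm, pow_mul, neg_one_sq, one_pow]
  have hlocal : ∀ v : HeightOneSpectrum (𝓞 K), ∃ ρ m,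
      (v.asIdeal ∣ 𝔣 → IsLocalChar v ρ m (if IsAbove v 2 then ε else signAt v)) ∧
      (¬ v.asIdeal ∣ 𝔣 → ρ = 1) ∧ LocalGood S π ζ v ρ ∧ emultiplicity v.asIdeal 𝔣 = (m : ℕ) := by
    intro v
    by_cases hv : v.asIdeal ∣ 𝔣
    · by_cases hv2 : IsAbove v 2
      · obtain ⟨ρ, m, h1, h2, h3⟩ := D.exists_isLocalChar_two hπ hζ h hv hv2 hε2 fun hm ↦ by
          rw [hε, (hodd ⟨v, hv, hv2, hm⟩).neg_one_pow]
        exact ⟨ρ, m, fun _ ↦ by rwa [if_pos hv2], absurd hv, h2, h3⟩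
      · obtain ⟨ρ, m, h1, h2, h3⟩ := D.exists_isLocalChar_odd (π := π) (ζ := ζ) h hv hv2
        exact ⟨ρ, m, fun _ ↦ by rwa [if_neg hv2], absurd hv, h2, h3⟩
    · exact ⟨1, 0, fun h ↦ absurd h hv, fun _ ↦ rfl, LocalGood.one, by
        rw [emultiplicity_eq_zero.2 hv]; rfl⟩
  choose ρ m hρ hρ1 hgood hm using hlocal
  obtain ⟨T, hT⟩ := exists_finset_dvd h0
  have hρ2 : ∀ v u, ρ v u ^ 2 = 1 := fun v u ↦ by
    by_cases hv : v.asIdeal ∣ 𝔣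
    · exact (hρ v hv).sq u
    · rw [hρ1 v hv]; exact one_pow 2
  have hneg : ∏ v ∈ T, ρ v (-1) = 1 := by
    have hf : ∀ v ∈ T, ¬ IsAbove v 2 → ρ v (-1) = signAt v := fun v hv hv2 ↦ by
      rw [(hρ v ((hT v).1 hv)).map_neg_one, if_neg hv2]
    by_cases h2 : ∃ v : HeightOneSpectrum (𝓞 K), v.asIdeal ∣ 𝔣 ∧ IsAbove v 2
    · obtain ⟨v, hv, hv2⟩ := h2
      rw [prod_eq_mul_of_forall_signAt hT hf hv hv2 fun w hw hw2 ↦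
        D.eq_of_isAbove_two hS h hv hv2 hw hw2, (hρ v hv).map_neg_one, if_pos hv2, ← hε,
        ← pow_two, hε2]
    · rw [prod_eq_of_forall_signAt hT hf h2, (heven h2).neg_one_pow]
  obtain ⟨χ, hχ, hχT, hχT', -⟩ := exists_ideleClassChar D.odd T 1 (fun _ ↦ one_pow 2)
    continuous_const ρ hρ2 (fun v ↦ by
      by_cases hv : v.asIdeal ∣ 𝔣
      · obtain ⟨ϖ, hϖ, k, -, hk, -⟩ := (hρ v hv).exists_level
        exact ⟨ϖ, hϖ, k + 1, hk⟩
      · obtain ⟨ϖ, hϖ⟩ := exists_isUniformizer v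
        refine ⟨ϖ, hϖ, 0, ?_⟩
        rw [hρ1 v hv]
        exact fun _ _ ↦ rfl) fun u ↦ by
      rw [MonoidHom.one_apply, one_mul]
      -- Values are ±1, so u may be replaced by u³ = ±1, and only the product at -1 has to be
      -- checked.
      have hcube : ∀ z : Circle, z ^ 2 = 1 → z = z ^ 3 := fun z hz ↦ by
        rw [pow_succ, hz, one_mul]
      rw [Finset.prod_congr rfl fun v _ ↦ (hcube _ (hρ2 v _)).trans (map_pow (ρ v) _ 3).symm]
      simp_rw [← map_pow]
      rcases D.units u with hu | hu
      · simp [hu]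
      · rw [hu, ← hneg]
        refine Finset.prod_congr rfl fun v _ ↦ congrArg (ρ v) (Units.ext ?_)
        simp
  have hχρ : ∀ v, unitComponent χ v = ρ v := fun v ↦ by
    by_cases hv : v ∈ T
    · exact hχT v hv
    · rw [hχT' v hv, hρ1 v fun h ↦ hv ((hT v).2 h)]
  have hcond : conductor χ = 𝔣 := by
    refine ideal_eq_of_emultiplicity ?_ h0 fun v ↦ ?_
    · obtain ⟨T', -, h⟩ := exists_finset_conductor_eq hχ
      rw [h]
      exact Finset.prod_ne_zero_iff.2 fun v _ ↦ pow_ne_zero _ v.ne_bot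
    · by_cases hv : v.asIdeal ∣ 𝔣
      · have h3 := hρ v hv
        rw [← hχρ v] at h3
        rw [emultiplicity_conductor hχ, hm, h3.conductorExponent_eq hχ]
      · rw [emultiplicity_eq_zero.2 hv, emultiplicity_eq_zero.2]
        rw [dvd_conductor_iff hχ, hχρ, hρ1 v hv]
        exact fun h ↦ h rfl
  refine ⟨χ, isQuadratic_of_sq_eq_one hχ ?_, hcond, D.charConditions_of_localGood hπ hζ hχ
    fun v ↦ by rw [hχρ]; exact hgood v⟩
  -- A proper ideal 𝔣 has a prime divisor, and the character is ramified there, so it is not 1.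
  rintro rfl
  obtain ⟨P, hP, hle⟩ := Ideal.exists_le_maximal 𝔣 h1
  let v : HeightOneSpectrum (𝓞 K) := ⟨P, hP.isPrime, fun hbot ↦ h0 (le_bot_iff.1 (hbot ▸ hle))⟩
  refine (dvd_conductor_iff (v := v) hχ).1 ?_ rfl
  rw [hcond]
  exact Ideal.dvd_iff_le.2 hle

end Sufficiency

end IdeleClass

end

/-! ### The classification -/

open IdeleClass

theorem theorem4p3 (K : Type*) [Field K] [NumberField K]
    -- `K` is imaginary quadratic, with odd class number and unit group `{±1}` or `⟨μ₆⟩`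
    (hdeg : Module.finrank ℚ K = 2) (himag : IsTotallyComplex K)
    (hclass : Odd (classNumber K))
    (hunits : (∀ u : (𝓞 K)ˣ, u = 1 ∨ u = -1) ∨
      ∃ u : (𝓞 K)ˣ, IsPrimitiveRoot u 6 ∧ Subgroup.zpowers u = ⊤)
    -- `c` is the nontrivial automorphism of `K`
    (c : K ≃ₐ[ℚ] K) (hc : c ≠ 1)
    -- the chosen places above the split primes
    (S : Set (HeightOneSpectrum (𝓞 K))) (hS : IsChoiceAboveSplit S)
    -- the chosen uniformizer at a place above `2`
    (π : ∀ v : HeightOneSpectrum (𝓞 K), v.adicCompletion K)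
    (hπ : ∀ v : HeightOneSpectrum (𝓞 K), IsAbove v 2 →
      Valued.v (π v) = WithZero.exp (-1 : ℤ))
    -- the chosen primitive cube root of unity at the place above `2`, if `2` is inert
    (ζ : ∀ v : HeightOneSpectrum (𝓞 K), v.adicCompletion K)
    (hζ : ∀ v : HeightOneSpectrum (𝓞 K), IsInert K 2 → IsAbove v 2 →
      IsPrimitiveRoot (ζ v) 3) :
    -- (I)
    (∀ χ : IdeleClassChar K, IsQuadratic χ →
      ∃ μ : IdeleClassChar K, IsBaseChange μ ∧ μ ^ 2 = 1 ∧ CharConditions S π ζ (χ * μ)) ∧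
    -- (II)
    (∀ χ : IdeleClassChar K, IsQuadratic χ → conductor χ ≠ ⊤ → CharConditions S π ζ χ →
      ¬ IsBaseChange χ ∧
      ∃ δ : IdeleClassChar K, IsQuadratic δ ∧
        ∀ x : IdeleGroup K, χ.1 (ideleConj c x) = χ.1 x * δ.1 x) ∧
    -- (III)
    (∀ χ η : IdeleClassChar K, IsQuadratic χ → IsQuadratic η →
      CharConditions S π ζ χ → CharConditions S π ζ η → χ ≠ η →
      ¬ ∃ μ : IdeleClassChar K, IsBaseChange μ ∧ χ = η * μ) ∧
    -- (IV)
    (∀ 𝔣 : Ideal (𝓞 K), 𝔣 ≠ ⊥ → 𝔣 ≠ ⊤ → IdealConditions S 𝔣 →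
      ((∃ χ : IdeleClassChar K, IsQuadratic χ ∧ conductor χ = 𝔣 ∧ CharConditions S π ζ χ) ↔
        ((¬ ∃ v : HeightOneSpectrum (𝓞 K), v.asIdeal ∣ 𝔣 ∧ IsAbove v 2) →
          Even (numPlacesThreeModFour 𝔣)) ∧
        ((∃ v : HeightOneSpectrum (𝓞 K), v.asIdeal ∣ 𝔣 ∧ IsAbove v 2 ∧
            (emultiplicity v.asIdeal 𝔣 = 2 ∨ emultiplicity v.asIdeal 𝔣 = 4)) →
          Odd (numPlacesThreeModFour 𝔣)))) := by
  have := himag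
  have := subsingleton_infinitePlace hdeg
  obtain ⟨s, q, D⟩ := exists_isQuadraticData hdeg hclass hunits hc
  refine ⟨fun χ hχ ↦ D.exists_isBaseChange hS hπ hζ hχ, fun χ hχ _ h ↦
    ⟨D.not_isBaseChange hS hπ hζ hχ h, D.exists_conj_eq_mul hS hπ hζ hχ h⟩,
    fun χ η hχ hη h h' hne ↦ D.not_exists_isBaseChange_mul hS hπ hζ hχ hη h h' hne,
    fun 𝔣 h0 h1 h ↦ ⟨?_, fun ⟨heven, hodd⟩ ↦
      D.exists_conductor_eq hS hπ hζ h0 h1 h heven hodd⟩⟩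
  rintro ⟨χ, hχ, rfl, h'⟩
  exact D.parity_of_isQuadratic hS hπ hζ h0 hχ h'
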